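/- Let $\mathfrak N$ be a nilpotent complex Lie algebra with ordered basis $f_1>\dots>f_N$, and fix an induced homogeneous monomial order on $\mathbb Z_{\ge 0}^N$ (a monomial order comparing total degrees first, with the exponent of $f_i$ larger than that of $f_j$ for $i<j$). Let $M=U(\mathfrak N)v_M$ be a finite-dimensional cyclic $\mathfrak N$-module on which $\mathfrak N$ acts nilpotently (all simple subquotients are trivial), $v_M\neq 0$. For $\mathbf p\in\mathbb Z_{\ge0}^N$ put $v_M(\mathbf p)=f_1^{p_1}\cdots f_N^{p_N}v_M$, $F_{\mathbf p}=\mathrm{span}\{v_M(\mathbf q):\mathbf q\le\mathbf p\}$, $F_{\mathbf p}^-=\mathrm{span}\{v_M(\mathbf q):\mathbf q<\mathbf p\}$, and $\mathrm{es}(M)=\{\mathbf p: v_M(\mathbf p)\notin F_{\mathbf p}^-\}$. Let $M^{\odot n}=U(\mathfrak N)(v_M\otimes\cdots\otimes v_M)\subseteq M^{\otimes n}$. Assume that $M$ is favourable with respect to these choices: $\mathrm{es}(M)$ is the set of lattice points of a normal polytope $P(M)\subset\mathbb R^N$ (a convex lattice polytope such that for all $n\ge1$ each lattice point of $nP(M)$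 is a sum of $n$ lattice points of $P(M)$), and for all $n$ the dimension of $M^{\odot n}$ equals the cardinality of the $n$-fold Minkowski sum of $\mathrm{es}(M)$. Let $M^a=\bigoplus_{s\ge0}U(\mathfrak N)_sv_M/U(\mathfrak N)_{s-1}v_M$ be the associated graded space for the PBW filtration and $M^t=\bigoplus_{\mathbf p}F_{\mathbf p}/F_{\mathbf p}^-$. The abelian Lie algebra $\mathfrak N^a$ with underlying vector space $\mathfrak N$ acts on $M^a$, each $x$ by the induced operator of degree $1$, and on $M^t$, each $f_i$ by the induced operator of degree $e_i$. Let $$\mathcal F_{\mathfrak N}(M)=\overline{\exp(\mathfrak N)\cdot[v_M]}\subseteq\mathbb P(M),\quad \mathcal F_{\mathfrak N^a}(M^a)=\overline{\exp(\mathfrak N^a)\cdot[v_M]}\subseteq\mathbb P(M^a),\quad \mathcal F_{\mathfrak N^a}(M^t)=\overline{\exp(\mathfrak N^a)\cdot[v_M]}\subseteq\mathbb P(M^t),$$ and let $\hat{\mathcal F}_{\mathfrak N}(M)$, $\hat{\mathcal F}_{\mathfrak N^a}(M^a)$, $\hat{\mathcal F}_{\mathfrak N^a}(M^t)$ be the affine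 cones over them. By a flat degeneration of a complex variety $Y$ into a complex variety $Y_0$ we mean a complex variety $X$ with a flat morphism $\pi:X\to\mathbb A^1$ whose scheme-theoretic fibre over each $t\ne0$ is isomorphic to $Y$ and over $t=0$ is isomorphic to $Y_0$, together with an algebraic $\mathbb C^*$-action on $X$ for which $\pi$ is equivariant with respect to the $t^{-1}$-multiplication action of $\mathbb C^*$ on $\mathbb A^1$. Then: (i) there is a flat degeneration, with affine total space, of $\hat{\mathcal F}_{\mathfrak N}(M)$ into $\hat{\mathcal F}_{\mathfrak N^a}(M^a)$, and there are such flat degenerations of both $\hat{\mathcal F}_{\mathfrak N}(M)$ and $\hat{\mathcal F}_{\mathfrak N^a}(M^a)$ into $\hat{\mathcal F}_{\mathfrak N^a}(M^t)$; (ii) there is a flat degeneration, proper over $\mathbb A^1$, of $\mathcal F_{\mathfrak N}(M)$ into $\mathcal F_{\mathfrak N^a}(M^a)$, and there are such flat degenerations of both $\mathcal F_{\mathfrak N}(M)$ and $\mathcal F_{\mathfrak N^a}(M^a)$ into $\mathcal F_{\mathfrak N^a}(M^t)$. -/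

import Mathlib

open scoped Pointwise TensorProduct DirectSum

noncomputable section

namespace Favourable

/-! ## Cyclic submodules and spans of ordered products of operators -/

section Operators

variable {V W : Type*} [AddCommGroup V] [Module ℂ V] [AddCommGroup W] [Module ℂ W]

/-- The product `x₁ ⋯ x_l · w` for a list `[x₁, …, x_l]` of elements of `V` acting through `ρ`. -/
def word (ρ : V →ₗ[ℂ] Module.End ℂ W) (l : List V) (w : W) : W :=
  ((l.map ρ).prod : Module.End ℂ W) w

/-- `U(V) w`: the span of all vectors `x₁ ⋯ x_l · w`. -/
def cyclicSpan (ρ : V →ₗ[ℂ] Module.End ℂ W) (w : W) : Submodule ℂ W :=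
  Submodule.span ℂ {u | ∃ l : List V, u = word ρ l w}

/-- The PBW filtration `U(V)_s w`: the span of all `x₁ ⋯ x_l · w` with `l ≤ s`. -/
def pbw (ρ : V →ₗ[ℂ] Module.End ℂ W) (w : W) (s : ℕ) : Submodule ℂ W :=
  Submodule.span ℂ {u | ∃ l : List V, l.length ≤ s ∧ u = word ρ l w}

/-- The previous step `U(V)_{s-1} w` of the PBW filtration (zero for `s = 0`). -/
def pbwPrev (ρ : V →ₗ[ℂ] Module.End ℂ W) (w : W) (s : ℕ) : Submodule ℂ W :=
  Submodule.span ℂ {u | ∃ l : List V, l.length < s ∧ u = word ρ l w}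

/-- The operator `∑ᵢ 1 ⊗ ⋯ ⊗ T ⊗ ⋯ ⊗ 1` (with `T` in place `i`) on `W^{⊗ n}`. -/
def tensorOp (n : ℕ) (T : Module.End ℂ W) : Module.End ℂ (⨂[ℂ]^n W) :=
  ∑ i : Fin n, PiTensorProduct.map (Function.update (fun _ => LinearMap.id) i T)

/-- The Cartan component `W^{⊙ n} = U(V)(w ⊗ ⋯ ⊗ w) ⊆ W^{⊗ n}`. -/
def cartanPower (ρ : V →ₗ[ℂ] Module.End ℂ W) (w : W) (n : ℕ) : Submodule ℂ (⨂[ℂ]^n W) :=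
  Submodule.span ℂ {u | ∃ l : List V,
    u = ((l.map fun x => tensorOp n (ρ x)).prod : Module.End ℂ (⨂[ℂ]^n W))
      (PiTensorProduct.tprod ℂ fun _ => w)}

theorem word_nil (ρ : V →ₗ[ℂ] Module.End ℂ W) (w : W) : word ρ [] w = w := by
  simp [word]

theorem word_cons (ρ : V →ₗ[ℂ] Module.End ℂ W) (x : V) (l : List V) (w : W) :
    word ρ (x :: l) w = ρ x (word ρ l w) := by
  simp [word]

theorem word_mem_pbw (ρ : V →ₗ[ℂ] Module.End ℂ W) (w : W) (l : List V) {s : ℕ}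
    (h : l.length ≤ s) : word ρ l w ∈ pbw ρ w s :=
  Submodule.subset_span ⟨l, h, rfl⟩

theorem word_mem_pbwPrev (ρ : V →ₗ[ℂ] Module.End ℂ W) (w : W) (l : List V) {s : ℕ}
    (h : l.length < s) : word ρ l w ∈ pbwPrev ρ w s :=
  Submodule.subset_span ⟨l, h, rfl⟩

theorem mem_pbw_zero (ρ : V →ₗ[ℂ] Module.End ℂ W) (w : W) : w ∈ pbw ρ w 0 := by
  simpa [word_nil] using word_mem_pbw ρ w [] (s := 0) (by simp)

theorem pbw_le_pbwPrev (ρ : V →ₗ[ℂ] Module.End ℂ W) (w : W) {s t : ℕ} (h : s < t) :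
    pbw ρ w s ≤ pbwPrev ρ w t := by
  refine Submodule.span_le.2 ?_
  rintro _ ⟨l, hl, rfl⟩
  exact word_mem_pbwPrev ρ w l (by omega)

theorem pbw_le_comap (ρ : V →ₗ[ℂ] Module.End ℂ W) (w : W) (x : V) (s : ℕ) :
    pbw ρ w s ≤ (pbw ρ w (s + 1)).comap (ρ x) := by
  refine Submodule.span_le.2 ?_
  rintro _ ⟨l, hl, rfl⟩
  have h := word_mem_pbw ρ w (x :: l) (s := s + 1) (by simpa using hl)
  rwa [word_cons] at h

theorem pbwPrev_le_comap (ρ : V →ₗ[ℂ] Module.End ℂ W) (w : W) (x : V) (s : ℕ) :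
    pbwPrev ρ w s ≤ (pbwPrev ρ w (s + 1)).comap (ρ x) := by
  refine Submodule.span_le.2 ?_
  rintro _ ⟨l, hl, rfl⟩
  have h := word_mem_pbwPrev ρ w (x :: l) (s := s + 1) (by simpa using hl)
  rwa [word_cons] at h

end Operators

/-! ## Associated graded spaces -/

section Graded

variable {ι W : Type*} [DecidableEq ι] [AddCommGroup W] [Module ℂ W]

/-- The graded space `⨁ᵢ Fᵢ / Gᵢ` (used with `Gᵢ ⊆ Fᵢ`). -/
abbrev Gr (F G : ι → Submodule ℂ W) : Type _ :=
  ⨁ i, (F i ⧸ (G i).submoduleOf (F i))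

/-- The class in `Fᵢ / Gᵢ` of a vector of `Fᵢ`. -/
def grClass (F G : ι → Submodule ℂ W) (i : ι) (w : W) (hw : w ∈ F i) : Gr F G :=
  DirectSum.lof ℂ ι (fun i => F i ⧸ (G i).submoduleOf (F i)) i
    (Submodule.Quotient.mk ⟨w, hw⟩)

/-- The operator on the graded space induced by an operator `T` with
`T Fᵢ ⊆ F_{σ i}` and `T Gᵢ ⊆ G_{σ i}`. -/
def grMap (F G : ι → Submodule ℂ W) (σ : ι → ι) (T : Module.End ℂ W)
    (hF : ∀ i, F i ≤ (F (σ i)).comap T) (hG : ∀ i, G i ≤ (G (σ i)).comap T) :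
    Module.End ℂ (Gr F G) :=
  DirectSum.toModule ℂ ι (Gr F G) fun i =>
    DirectSum.lof ℂ ι (fun i => F i ⧸ (G i).submoduleOf (F i)) (σ i) ∘ₗ
      Submodule.mapQ ((G i).submoduleOf (F i)) ((G (σ i)).submoduleOf (F (σ i)))
        (T.restrict (hF i)) (fun _ hx => hG i hx)

theorem grMap_grClass (F G : ι → Submodule ℂ W) (σ : ι → ι) (T : Module.End ℂ W)
    (hF : ∀ i, F i ≤ (F (σ i)).comap T) (hG : ∀ i, G i ≤ (G (σ i)).comap T)
    (i : ι) (w : W) (hw : w ∈ F i) :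
    grMap F G σ T hF hG (grClass F G i w hw) = grClass F G (σ i) (T w) (hF i hw) := by
  rw [grMap, grClass, DirectSum.toModule_lof]
  rfl

theorem gr_hom_ext {W' : Type*} [AddCommGroup W'] [Module ℂ W'] (F G : ι → Submodule ℂ W)
    (S T : Gr F G →ₗ[ℂ] W')
    (h : ∀ i w (hw : w ∈ F i), S (grClass F G i w hw) = T (grClass F G i w hw)) : S = T := by
  refine DirectSum.linearMap_ext ℂ fun i => LinearMap.ext fun x => ?_
  obtain ⟨y, rfl⟩ := Submodule.Quotient.mk_surjective _ x
  exact h i y.1 y.2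

theorem grClass_add (F G : ι → Submodule ℂ W) (i : ι) (w w' : W) (hw : w ∈ F i) (hw' : w' ∈ F i) :
    grClass F G i (w + w') (add_mem hw hw') = grClass F G i w hw + grClass F G i w' hw' := by
  simp only [grClass]
  rw [← map_add, ← Submodule.Quotient.mk_add]
  rfl

theorem grClass_smul (F G : ι → Submodule ℂ W) (i : ι) (c : ℂ) (w : W) (hw : w ∈ F i) :
    grClass F G i (c • w) (Submodule.smul_mem _ c hw) = c • grClass F G i w hw := by
  simp only [grClass]
  rw [← map_smul, ← Submodule.Quotient.mk_smul]
  rfl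

/-- The associated graded space of a filtration of a finite-dimensional space by a totally ordered
set is finite-dimensional. -/
theorem gr_finite {α : Type*} [LinearOrder α] [FiniteDimensional ℂ W]
    (F G : ι → Submodule ℂ W) (r : ι → α) (hr : Function.Injective r)
    (hGF : ∀ i, G i ≤ F i) (h : ∀ i j, r i < r j → F i ≤ G j) :
    FiniteDimensional ℂ (Gr F G) := by
  have hmono : ∀ i j, r i < r j → ¬ F j ≤ G j →
      Module.finrank ℂ (F i) < Module.finrank ℂ (F j) := by
    intro i j hij hj
    refine Submodule.finrank_lt_finrank_of_lt
      (lt_of_le_of_ne ((h i j hij).trans (hGF j)) ?_)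
    intro he
    exact hj (he ▸ h i j hij)
  have hfin : {i | ¬ F i ≤ G i}.Finite := by
    refine Set.Finite.of_finite_image (f := fun i => Module.finrank ℂ (F i))
      ((Set.finite_Iic (Module.finrank ℂ W)).subset ?_) ?_
    · rintro _ ⟨i, -, rfl⟩
      exact Submodule.finrank_le (F i)
    · intro i hi j hj he
      by_contra hne
      rcases lt_or_gt_of_ne (fun e => hne (hr e)) with hlt | hlt
      · exact absurd he (hmono i j hlt hj).ne
      · exact absurd he (hmono j i hlt hi).ne'
  refine ⟨?_⟩
  have htop : (⊤ : Submodule ℂ (Gr F G)) = ⨆ i ∈ hfin.toFinset,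
      LinearMap.range (DirectSum.lof ℂ ι (fun i => F i ⧸ (G i).submoduleOf (F i)) i) := by
    refine (eq_top_iff.2 fun x _ => ?_).symm
    induction x using DirectSum.induction_on with
    | zero => exact Submodule.zero_mem _
    | add x y hx hy => exact Submodule.add_mem _ (hx trivial) (hy trivial)
    | of i x =>
      by_cases hi : F i ≤ G i
      · have hx : x = 0 := by
          obtain ⟨y, rfl⟩ := Submodule.Quotient.mk_surjective _ x
          exact (Submodule.Quotient.mk_eq_zero _).2 (hi y.2)
        rw [hx, map_zero]
        exact Submodule.zero_mem _
      · refine Submodule.mem_iSup_of_mem i (Submodule.mem_iSup_of_mem ?_ ⟨x, rfl⟩)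
        simpa using hi
  rw [htop]
  refine Submodule.fg_biSup _ _ fun i _ => ?_
  rw [LinearMap.range_eq_map]
  exact (Module.Finite.fg_top (R := ℂ) (M := F i ⧸ (G i).submoduleOf (F i))).map _

end Graded

/-! ## Essential monomials and the two degenerate modules -/

/-- A homogeneous monomial order on the multi-exponents of `f₁, …, f_N` induced by the order
`f₁ > ⋯ > f_N` of the basis: a monomial order that compares total degrees first and for which
the exponent of `f_i` is larger than that of `f_j` if `i < j`. -/
structure HomogeneousOrder (N : ℕ) extends MonomialOrder (Fin N) where
  homogeneous : ∀ p q : Fin N →₀ ℕ, p.degree < q.degree → toSyn p < toSyn q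
  induced : ∀ i j : Fin N, i < j → toSyn (Finsupp.single j 1) < toSyn (Finsupp.single i 1)

section Lie

variable {𝔫 M : Type*} [LieRing 𝔫] [LieAlgebra ℂ 𝔫] [AddCommGroup M] [Module ℂ M]
  [LieRingModule 𝔫 M] [LieModule ℂ 𝔫 M]

variable (𝔫 M) in
/-- The action of `𝔫` on `M` as a linear map. -/
def lieAct : 𝔫 →ₗ[ℂ] Module.End ℂ M := (LieModule.toEnd ℂ 𝔫 M : 𝔫 →ₗ[ℂ] Module.End ℂ M)

theorem lieAct_apply (x : 𝔫) (m : M) : lieAct 𝔫 M x m = ⁅x, m⁆ := rfl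

variable {N : ℕ}

/-- The list `[f₁, …, f₁, …, f_N, …, f_N]`, with `f_i` repeated `p_i` times. -/
def expList (b : Module.Basis (Fin N) ℂ 𝔫) (p : Fin N →₀ ℕ) : List 𝔫 :=
  (List.finRange N).flatMap fun i => List.replicate (p i) (b i)

/-- The vector `v_M(p) = f₁^{p₁} ⋯ f_N^{p_N} v`. -/
def monomialVec (b : Module.Basis (Fin N) ℂ 𝔫) (v : M) (p : Fin N →₀ ℕ) : M :=
  ((List.finRange N).map fun i => lieAct 𝔫 M (b i) ^ p i).prod v

/-- `F_p(M)`, the span of all `v_M(q)` with `q ≤ p`. -/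
def monFil (b : Module.Basis (Fin N) ℂ 𝔫) (ord : HomogeneousOrder N) (v : M)
    (p : Fin N →₀ ℕ) : Submodule ℂ M :=
  Submodule.span ℂ {u | ∃ q, ord.toSyn q ≤ ord.toSyn p ∧ u = monomialVec b v q}

/-- `F_p(M)^-`, the span of all `v_M(q)` with `q < p`. -/
def monFilPrev (b : Module.Basis (Fin N) ℂ 𝔫) (ord : HomogeneousOrder N) (v : M)
    (p : Fin N →₀ ℕ) : Submodule ℂ M :=
  Submodule.span ℂ {u | ∃ q, ord.toSyn q < ord.toSyn p ∧ u = monomialVec b v q}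

/-- The set `es(M)` of essential multi-exponents. -/
def essential (b : Module.Basis (Fin N) ℂ 𝔫) (ord : HomogeneousOrder N) (v : M) :
    Set (Fin N →₀ ℕ) :=
  {p | monomialVec b v p ∉ monFilPrev b ord v p}

/-! The facts that make the action on the second degenerate module well defined: the generators
commute up to lower order, and ordered monomials span. -/

theorem word_perm_sub_mem (v : M) {l l' : List 𝔫} (h : l.Perm l') :
    word (lieAct 𝔫 M) l v - word (lieAct 𝔫 M) l' v ∈ pbwPrev (lieAct 𝔫 M) v l.length := by
  induction h with
  | nil => simp
  | cons x _ ih =>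
    rw [word_cons, word_cons, ← map_sub]
    exact pbwPrev_le_comap _ v x _ ih
  | swap x y l =>
    have h : word (lieAct 𝔫 M) (y :: x :: l) v - word (lieAct 𝔫 M) (x :: y :: l) v =
        word (lieAct 𝔫 M) (⁅y, x⁆ :: l) v := by
      simp only [word_cons, lieAct_apply, lie_lie]
    rw [h]
    exact word_mem_pbwPrev _ v _ (by simp)
  | trans h₁ _ ih₁ ih₂ =>
    rw [← h₁.length_eq] at ih₂
    simpa using Submodule.add_mem _ ih₁ ih₂

theorem length_expList (b : Module.Basis (Fin N) ℂ 𝔫) (p : Fin N →₀ ℕ) :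
    (expList b p).length = p.degree := by
  rw [expList, List.length_flatMap, Finsupp.degree_eq_sum, ← List.sum_ofFn, List.ofFn_eq_map]
  simp

theorem monomialVec_eq_word (b : Module.Basis (Fin N) ℂ 𝔫) (v : M) (p : Fin N →₀ ℕ) :
    monomialVec b v p = word (lieAct 𝔫 M) (expList b p) v := by
  have h : ∀ L : List (Fin N), (L.map fun i => lieAct 𝔫 M (b i) ^ p i).prod =
      ((L.flatMap fun i => List.replicate (p i) (b i)).map (lieAct 𝔫 M)).prod := by
    intro L
    induction L with
    | nil => simp
    | cons i L ih => simp [ih]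
  rw [monomialVec, word, h, expList]

theorem expList_perm (b : Module.Basis (Fin N) ℂ 𝔫) (p : Fin N →₀ ℕ) (i : Fin N) :
    (b i :: expList b p).Perm (expList b (p + Finsupp.single i 1)) := by
  classical
  rw [List.perm_iff_count]
  intro x
  have hc : ∀ q : Fin N →₀ ℕ, (expList b q).count x =
      ∑ j, if b j = x then q j else 0 := by
    intro q
    rw [expList, List.count_flatMap, ← List.sum_ofFn, List.ofFn_eq_map]
    congr 1
    refine List.map_congr_left fun j _ => ?_
    simp [List.count_replicate]
  rw [List.count_cons, hc, hc]
  have h1 : ∀ j : Fin N, (if b j = x then (p + Finsupp.single i 1 : Fin N →₀ ℕ) j else 0) =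
      (if b j = x then p j else 0) + (if j = i then (if b i = x then 1 else 0) else 0) := by
    intro j
    by_cases hj : j = i
    · subst hj
      by_cases hx : b j = x <;> simp [hx]
    · simp [hj]
  rw [Finset.sum_congr rfl fun j _ => h1 j, Finset.sum_add_distrib]
  simp

theorem monomialVec_sub_mem (b : Module.Basis (Fin N) ℂ 𝔫) (v : M) (p : Fin N →₀ ℕ) (i : Fin N) :
    lieAct 𝔫 M (b i) (monomialVec b v p) - monomialVec b v (p + Finsupp.single i 1) ∈
      pbw (lieAct 𝔫 M) v p.degree := by
  have h := word_perm_sub_mem (M := M) v (expList_perm b p i)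
  rw [word_cons, ← monomialVec_eq_word, ← monomialVec_eq_word, List.length_cons,
    length_expList] at h
  refine (Submodule.span_mono ?_ : pbwPrev _ _ _ ≤ _) h
  rintro _ ⟨l, hl, rfl⟩
  exact ⟨l, by omega, rfl⟩

theorem pbw_le_span (b : Module.Basis (Fin N) ℂ 𝔫) (v : M) (s : ℕ) :
    pbw (lieAct 𝔫 M) v s ≤
      Submodule.span ℂ {u | ∃ q : Fin N →₀ ℕ, q.degree ≤ s ∧ u = monomialVec b v q} := by
  induction s with
  | zero =>
    refine Submodule.span_le.2 ?_
    rintro _ ⟨l, hl, rfl⟩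
    obtain rfl : l = [] := List.length_eq_zero_iff.1 (by omega)
    refine Submodule.subset_span ⟨0, by simp, ?_⟩
    rw [word_nil]
    simp [monomialVec]
  | succ s ih =>
    have hmono : ∀ {s t : ℕ}, s ≤ t →
        Submodule.span ℂ {u | ∃ q : Fin N →₀ ℕ, q.degree ≤ s ∧ u = monomialVec b v q} ≤
        Submodule.span ℂ {u | ∃ q : Fin N →₀ ℕ, q.degree ≤ t ∧ u = monomialVec b v q} := by
      intro s t hst
      refine Submodule.span_mono ?_
      rintro _ ⟨q, hq, rfl⟩
      exact ⟨q, hq.trans hst, rfl⟩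
    refine Submodule.span_le.2 ?_
    rintro _ ⟨l, hl, rfl⟩
    cases l with
    | nil => exact hmono (Nat.le_succ s) (ih (word_mem_pbw _ v [] (by simp)))
    | cons x l =>
      have h1 := ih (word_mem_pbw _ v l (by simpa using hl))
      rw [word_cons]
      have h2 : Submodule.span ℂ {u | ∃ q : Fin N →₀ ℕ, q.degree ≤ s ∧ u = monomialVec b v q} ≤
          (Submodule.span ℂ {u | ∃ q : Fin N →₀ ℕ, q.degree ≤ s + 1 ∧
            u = monomialVec b v q}).comap (lieAct 𝔫 M x) := by
        refine Submodule.span_le.2 ?_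
        rintro _ ⟨q, hq, rfl⟩
        rw [SetLike.mem_coe, Submodule.mem_comap, ← b.sum_repr x, map_sum, LinearMap.sum_apply]
        refine Submodule.sum_mem _ fun i _ => ?_
        rw [map_smul, LinearMap.smul_apply]
        refine Submodule.smul_mem _ _ ?_
        have h3 := monomialVec_sub_mem b v q i
        have h4 : pbw (lieAct 𝔫 M) v q.degree ≤ pbw (lieAct 𝔫 M) v s := by
          refine Submodule.span_mono ?_
          rintro _ ⟨l, hl, rfl⟩
          exact ⟨l, hl.trans hq, rfl⟩
        have h5 := hmono (Nat.le_succ s) (ih (h4 h3))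
        have h6 : monomialVec b v (q + Finsupp.single i 1) ∈
            Submodule.span ℂ {u | ∃ q : Fin N →₀ ℕ, q.degree ≤ s + 1 ∧
              u = monomialVec b v q} :=
          Submodule.subset_span ⟨_, by simpa using hq, rfl⟩
        simpa using Submodule.add_mem _ h5 h6
      exact h2 h1

theorem monFil_le_monFilPrev (b : Module.Basis (Fin N) ℂ 𝔫) (ord : HomogeneousOrder N) (v : M)
    (p q : Fin N →₀ ℕ) (h : ord.toSyn p < ord.toSyn q) :
    monFil b ord v p ≤ monFilPrev b ord v q := by
  refine Submodule.span_mono ?_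
  rintro _ ⟨r, hr, rfl⟩
  exact ⟨r, hr.trans_lt h, rfl⟩

theorem monFilPrev_le_monFil (b : Module.Basis (Fin N) ℂ 𝔫) (ord : HomogeneousOrder N) (v : M)
    (p : Fin N →₀ ℕ) : monFilPrev b ord v p ≤ monFil b ord v p := by
  refine Submodule.span_mono ?_
  rintro _ ⟨r, hr, rfl⟩
  exact ⟨r, hr.le, rfl⟩

theorem lieAct_monomialVec_mem (b : Module.Basis (Fin N) ℂ 𝔫) (ord : HomogeneousOrder N) (v : M)
    (p : Fin N →₀ ℕ) (i : Fin N) :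
    lieAct 𝔫 M (b i) (monomialVec b v p) ∈ monFil b ord v (p + Finsupp.single i 1) := by
  have h1 := pbw_le_span b v _ (monomialVec_sub_mem b v p i)
  have h2 : Submodule.span ℂ {u | ∃ q : Fin N →₀ ℕ, q.degree ≤ p.degree ∧
      u = monomialVec b v q} ≤ monFil b ord v (p + Finsupp.single i 1) := by
    refine Submodule.span_mono ?_
    rintro _ ⟨q, hq, rfl⟩
    refine ⟨q, (ord.homogeneous _ _ ?_).le, rfl⟩
    have : (p + Finsupp.single i 1).degree = p.degree + 1 := by simp
    omega
  have h3 : monomialVec b v (p + Finsupp.single i 1) ∈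
      monFil b ord v (p + Finsupp.single i 1) := Submodule.subset_span ⟨_, le_rfl, rfl⟩
  simpa using Submodule.add_mem _ (h2 h1) h3

theorem monFil_le_comap (b : Module.Basis (Fin N) ℂ 𝔫) (ord : HomogeneousOrder N) (v : M)
    (i : Fin N) (p : Fin N →₀ ℕ) :
    monFil b ord v p ≤ (monFil b ord v (p + Finsupp.single i 1)).comap (lieAct 𝔫 M (b i)) := by
  refine Submodule.span_le.2 ?_
  rintro _ ⟨q, hq, rfl⟩
  refine (Submodule.span_mono ?_ : monFil b ord v (q + Finsupp.single i 1) ≤ _)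
    (lieAct_monomialVec_mem b ord v q i)
  rintro _ ⟨r, hr, rfl⟩
  refine ⟨r, hr.trans ?_, rfl⟩
  rw [map_add, map_add]
  exact add_le_add_left hq _

theorem monFilPrev_le_comap (b : Module.Basis (Fin N) ℂ 𝔫) (ord : HomogeneousOrder N) (v : M)
    (i : Fin N) (p : Fin N →₀ ℕ) :
    monFilPrev b ord v p ≤
      (monFilPrev b ord v (p + Finsupp.single i 1)).comap (lieAct 𝔫 M (b i)) := by
  refine Submodule.span_le.2 ?_
  rintro _ ⟨q, hq, rfl⟩
  refine monFil_le_monFilPrev b ord v _ _ ?_ (lieAct_monomialVec_mem b ord v q i)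
  rw [map_add, map_add]
  exact add_lt_add_left hq _

theorem mem_monFil_zero (b : Module.Basis (Fin N) ℂ 𝔫) (ord : HomogeneousOrder N) (v : M) :
    v ∈ monFil b ord v 0 :=
  Submodule.subset_span ⟨0, le_rfl, by simp [monomialVec]⟩

variable (𝔫) in
/-- The PBW-degenerate module `M^a = ⨁ₛ U(𝔫)ₛ v / U(𝔫)ₛ₋₁ v`. -/
abbrev Ma (v : M) : Type _ := Gr (pbw (lieAct 𝔫 M) v) (pbwPrev (lieAct 𝔫 M) v)

variable (𝔫) in
/-- The cyclic vector of `M^a`: the class of `v` in degree `0`. -/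
def vecA (v : M) : Ma 𝔫 v := grClass _ _ 0 v (mem_pbw_zero _ v)

variable (𝔫) in
/-- The action on `M^a` of the abelian Lie algebra `𝔫^a` with underlying space `𝔫`: the element `x`
acts by the operator of degree `1` induced by the action of `x` on `M`. -/
def actA (v : M) : 𝔫 →ₗ[ℂ] Module.End ℂ (Ma 𝔫 v) where
  toFun x := grMap _ _ (fun s => s + 1) (lieAct 𝔫 M x) (pbw_le_comap _ v x)
    (pbwPrev_le_comap _ v x)
  map_add' x y := by
    refine gr_hom_ext (W' := Ma 𝔫 v) (pbw (lieAct 𝔫 M) v) (pbwPrev (lieAct 𝔫 M) v) _ _ fun s m hm => ?_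
    rw [LinearMap.add_apply, grMap_grClass, grMap_grClass, grMap_grClass, ← grClass_add]
    congr 1
    rw [map_add, LinearMap.add_apply]
  map_smul' c x := by
    refine gr_hom_ext (W' := Ma 𝔫 v) (pbw (lieAct 𝔫 M) v) (pbwPrev (lieAct 𝔫 M) v) _ _ fun s m hm => ?_
    rw [RingHom.id_apply, LinearMap.smul_apply, grMap_grClass, grMap_grClass, ← grClass_smul]
    congr 1
    rw [map_smul, LinearMap.smul_apply]

/-- The toric degenerate module `M^t = ⨁_p F_p(M) / F_p(M)^-`. -/
abbrev Mt (b : Module.Basis (Fin N) ℂ 𝔫) (ord : HomogeneousOrder N) (v : M) : Type _ :=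
  Gr (monFil b ord v) (monFilPrev b ord v)

/-- The cyclic vector of `M^t`: the class of `v` in degree `0`. -/
def vecT (b : Module.Basis (Fin N) ℂ 𝔫) (ord : HomogeneousOrder N) (v : M) : Mt b ord v :=
  grClass _ _ 0 v (mem_monFil_zero b ord v)

/-- The operator of degree `e_i` on `M^t` induced by the action of `f_i` on `M`. -/
def genT (b : Module.Basis (Fin N) ℂ 𝔫) (ord : HomogeneousOrder N) (v : M) (i : Fin N) :
    Module.End ℂ (Mt b ord v) :=
  grMap _ _ (fun p => p + Finsupp.single i 1) (lieAct 𝔫 M (b i)) (monFil_le_comap b ord v i)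
    (monFilPrev_le_comap b ord v i)

/-- The action on `M^t` of the abelian Lie algebra `𝔫^a` with underlying space `𝔫`: the basis
element `f_i` acts by the operator of degree `e_i` induced by its action on `M`. -/
def actT (b : Module.Basis (Fin N) ℂ 𝔫) (ord : HomogeneousOrder N) (v : M) :
    𝔫 →ₗ[ℂ] Module.End ℂ (Mt b ord v) :=
  b.constr ℂ (genT b ord v)

instance finite_Ma [FiniteDimensional ℂ M] (v : M) : FiniteDimensional ℂ (Ma 𝔫 v) :=
  gr_finite _ _ (fun s : ℕ => s) Function.injective_id
    (fun _ => Submodule.span_mono fun _ ⟨l, hl, h⟩ => ⟨l, hl.le, h⟩)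
    (fun _ _ h => pbw_le_pbwPrev _ v h)

instance finite_Mt [FiniteDimensional ℂ M] (b : Module.Basis (Fin N) ℂ 𝔫)
    (ord : HomogeneousOrder N) (v : M) : FiniteDimensional ℂ (Mt b ord v) :=
  gr_finite _ _ ord.toSyn ord.toSyn.injective (monFilPrev_le_monFil b ord v)
    (monFil_le_monFilPrev b ord v)

/-! ## Favourable modules -/

/-- The `n`-fold Minkowski sum of a set of multi-exponents. -/
def minkowski (n : ℕ) (S : Set (Fin N →₀ ℕ)) : Set (Fin N →₀ ℕ) :=
  {q | ∃ p : Fin n → (Fin N →₀ ℕ), (∀ i, p i ∈ S) ∧ q = ∑ i, p i}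

/-- The lattice point of `ℝ^N` with the given integer coordinates. -/
def latticePt (z : Fin N → ℤ) : Fin N → ℝ := fun i => (z i : ℝ)

/-- A normal polytope in `ℝ^N`: the convex hull of finitely many lattice points, such that for
each `n ≥ 1` each lattice point of `nP` is a sum of `n` lattice points of `P`. -/
def IsNormalPolytope (P : Set (Fin N → ℝ)) : Prop :=
  (∃ A : Finset (Fin N → ℤ), P = convexHull ℝ (latticePt '' (A : Set (Fin N → ℤ)))) ∧
  ∀ n : ℕ, 1 ≤ n → ∀ z : Fin N → ℤ, latticePt z ∈ (n : ℝ) • P →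
    ∃ y : Fin n → (Fin N → ℤ), (∀ i, latticePt (y i) ∈ P) ∧ z = ∑ i, y i

/-- The cyclic module `M = U(𝔫) v` is favourable, as witnessed by the ordered basis `b` and the
homogeneous monomial order `ord`: `es(M)` is the set of lattice points of a normal polytope, and
`dim M^{⊙ n}` is the number of elements of the `n`-fold Minkowski sum of `es(M)`. -/
structure IsFavourable (b : Module.Basis (Fin N) ℂ 𝔫) (ord : HomogeneousOrder N) (v : M) :
    Prop where
  cyclic : cyclicSpan (lieAct 𝔫 M) v = ⊤
  polytope : ∃ P : Set (Fin N → ℝ), IsNormalPolytope P ∧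
    ∀ z : Fin N → ℤ, latticePt z ∈ P ↔ ∃ p ∈ essential b ord v, z = fun i => (p i : ℤ)
  finrank_eq : ∀ n : ℕ, Module.finrank ℂ (cartanPower (lieAct 𝔫 M) v n) =
    (minkowski n (essential b ord v)).ncard

end Lie

/-! ## Orbit closures, affine cones and coordinate rings -/

section Orbits

variable {V W : Type*} [AddCommGroup V] [Module ℂ V] [AddCommGroup W] [Module ℂ W]

/-- The exponential of a nilpotent endomorphism of a complex vector space. -/
def expEnd (T : Module.End ℂ W) : Module.End ℂ W :=
  letI : Module ℚ (Module.End ℂ W) := Module.compHom _ (algebraMap ℚ ℂ)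
  IsNilpotent.exp T

/-- The unipotent group `exp(V)` of operators on `W`, for a (nilpotent) action `ρ` on `W` of a
nilpotent Lie algebra with underlying space `V`. -/
def unipotentGroup (ρ : V →ₗ[ℂ] Module.End ℂ W) : Set (Module.End ℂ W) :=
  Set.range fun x => expEnd (ρ x)

/-- The union of the lines `ℂ · u w`, `u` in the unipotent group: the set of all vectors lying on
a line of the orbit through the line `ℂ w`. -/
def orbitLines (ρ : V →ₗ[ℂ] Module.End ℂ W) (w : W) : Set W :=
  {z | ∃ c : ℂ, ∃ u ∈ unipotentGroup ρ, z = c • u w}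

variable [FiniteDimensional ℂ W]

/-- Coordinates on `W`. -/
def coords : W ≃ₗ[ℂ] (Fin (Module.finrank ℂ W) → ℂ) :=
  (Module.finBasis ℂ W).equivFun

/-- The ideal, in the polynomial ring of `W`, of all polynomials vanishing on the lines of the
orbit through `ℂ w`; it is the ideal of the affine cone over the closure of that orbit
in `ℙ(W)`. -/
def coneIdeal (ρ : V →ₗ[ℂ] Module.End ℂ W) (w : W) :
    Ideal (MvPolynomial (Fin (Module.finrank ℂ W)) ℂ) :=
  MvPolynomial.vanishingIdeal ℂ (coords '' orbitLines ρ w)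

/-- The homogeneous coordinate ring of the closure in `ℙ(W)` of the orbit through `ℂ w`, which is
the coordinate ring of the affine cone over it. -/
abbrev CoordRing (ρ : V →ₗ[ℂ] Module.End ℂ W) (w : W) : Type :=
  MvPolynomial (Fin (Module.finrank ℂ W)) ℂ ⧸ coneIdeal ρ w

/-- The homogeneous components of the homogeneous coordinate ring: the images of the spaces of
homogeneous polynomials. -/
def coordDeg (ρ : V →ₗ[ℂ] Module.End ℂ W) (w : W) (n : ℕ) : Submodule ℂ (CoordRing ρ w) :=
  (MvPolynomial.homogeneousSubmodule (Fin (Module.finrank ℂ W)) ℂ n).map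
    (Ideal.Quotient.mkₐ ℂ (coneIdeal ρ w)).toLinearMap

theorem aeval_smul_of_isHomogeneous {d k : ℕ} {g : MvPolynomial (Fin d) ℂ}
    (hg : g.IsHomogeneous k) (t : ℂ) (y : Fin d → ℂ) :
    MvPolynomial.aeval (t • y) g = t ^ k * MvPolynomial.aeval y g := by
  simp only [MvPolynomial.aeval_def, MvPolynomial.eval₂_eq', Finset.mul_sum]
  refine Finset.sum_congr rfl fun m hm => ?_
  have hdeg : ∑ i, m i = k := by
    have h := hg (MvPolynomial.mem_support_iff.1 hm)
    rw [← h, ← Finsupp.degree_eq_sum, Finsupp.degree_eq_weight_one]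
    rfl
  simp only [Pi.smul_apply, smul_eq_mul, mul_pow, Finset.prod_mul_distrib]
  rw [Finset.prod_pow_eq_pow_sum, hdeg]
  exact mul_left_comm _ _ _

theorem homogeneousComponent_mem_coneIdeal (ρ : V →ₗ[ℂ] Module.End ℂ W) (w : W)
    (f : MvPolynomial (Fin (Module.finrank ℂ W)) ℂ) (hf : f ∈ coneIdeal ρ w) (n : ℕ) :
    MvPolynomial.homogeneousComponent n f ∈ coneIdeal ρ w := by
  rintro _ ⟨z, ⟨c, u, hu, rfl⟩, rfl⟩
  set y := coords (c • u w) with hy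
  have key : ∀ t : ℂ, MvPolynomial.aeval (t • y) f = 0 := by
    intro t
    refine hf _ ⟨t • c • u w, ⟨t * c, u, hu, by rw [mul_smul]⟩, ?_⟩
    rw [map_smul]
  let P : Polynomial ℂ := ∑ k ∈ Finset.range (f.totalDegree + 1),
    Polynomial.C (MvPolynomial.aeval y (MvPolynomial.homogeneousComponent k f)) *
      Polynomial.X ^ k
  have hP : P = 0 := by
    refine Polynomial.funext fun t => ?_
    have h1 := key t
    rw [← MvPolynomial.sum_homogeneousComponent f, map_sum] at h1
    rw [Polynomial.eval_zero, ← h1, Polynomial.eval_finsetSum]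
    refine Finset.sum_congr rfl fun k _ => ?_
    rw [aeval_smul_of_isHomogeneous (MvPolynomial.homogeneousComponent_isHomogeneous k f),
      Polynomial.eval_mul, Polynomial.eval_C, Polynomial.eval_pow, Polynomial.eval_X, mul_comm]
  by_cases hn : n < f.totalDegree + 1
  · have h3 := congrArg (fun q => Polynomial.coeff q n) hP
    simp only [P, Polynomial.finsetSum_coeff, Polynomial.coeff_C_mul_X_pow,
      Polynomial.coeff_zero] at h3
    rw [Finset.sum_eq_single n] at h3
    · simpa using h3
    · intro k _ hk
      simp [hk.symm]
    · intro hh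
      exact absurd (Finset.mem_range.2 hn) hh
  · rw [MvPolynomial.homogeneousComponent_eq_zero n f (by omega), map_zero]

theorem coordDeg_isInternal (ρ : V →ₗ[ℂ] Module.End ℂ W) (w : W) :
    DirectSum.IsInternal (coordDeg ρ w) := by
  classical
  constructor
  · rw [injective_iff_map_eq_zero]
    intro x hx
    have hx' : ∀ n, ∃ f : MvPolynomial (Fin (Module.finrank ℂ W)) ℂ,
        f.IsHomogeneous n ∧ Ideal.Quotient.mk (coneIdeal ρ w) f = (x n : CoordRing ρ w) :=
      fun n => by
        obtain ⟨f, hf, hfx⟩ := (x n).2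
        exact ⟨f, hf, hfx⟩
    choose f hf hfx using hx'
    rw [DirectSum.coeAddMonoidHom_eq_dfinsuppSum, DFinsupp.sum] at hx
    have hmem : ∑ n ∈ DFinsupp.support x, f n ∈ coneIdeal ρ w := by
      rw [← Ideal.Quotient.eq_zero_iff_mem, map_sum, ← hx]
      exact Finset.sum_congr rfl fun n _ => hfx n
    ext n
    by_cases hn : n ∈ DFinsupp.support x
    · have h1 := homogeneousComponent_mem_coneIdeal ρ w _ hmem n
      rw [map_sum, Finset.sum_eq_single n] at h1
      · rw [MvPolynomial.homogeneousComponent_of_mem (hf n), if_pos rfl] at h1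
        rw [← hfx n, Ideal.Quotient.eq_zero_iff_mem.2 h1]
        rfl
      · intro k _ hk
        rw [MvPolynomial.homogeneousComponent_of_mem (hf k), if_neg hk.symm]
      · intro hh
        exact absurd hn hh
    · rw [DFinsupp.notMem_support_iff.1 hn]
      rfl
  · intro y
    obtain ⟨g, rfl⟩ := Ideal.Quotient.mk_surjective y
    refine ⟨∑ n ∈ Finset.range (g.totalDegree + 1),
      DirectSum.of (fun n => coordDeg ρ w n) n
        ⟨Ideal.Quotient.mk (coneIdeal ρ w) (MvPolynomial.homogeneousComponent n g),
          ⟨_, MvPolynomial.homogeneousComponent_isHomogeneous n g, rfl⟩⟩, ?_⟩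
    rw [map_sum]
    simp only [DirectSum.coeAddMonoidHom_of]
    rw [← map_sum, MvPolynomial.sum_homogeneousComponent]

/-- The homogeneous coordinate ring is graded by its homogeneous components. -/
instance coordGraded (ρ : V →ₗ[ℂ] Module.End ℂ W) (w : W) : GradedAlgebra (coordDeg ρ w) where
  one_mem := ⟨1, MvPolynomial.isHomogeneous_one _ _, by simp⟩
  mul_mem := by
    rintro m n _ _ ⟨f, hf, rfl⟩ ⟨g, hg, rfl⟩
    exact ⟨f * g, MvPolynomial.IsHomogeneous.mul hf hg, by simp⟩
  toDecomposition := (coordDeg_isInternal ρ w).chooseDecomposition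

end Orbits

/-! ## The schemes, and flat degenerations -/

section Schemes

open AlgebraicGeometry CategoryTheory CategoryTheory.Limits

/-- The spectrum of `ℂ`. -/
abbrev SpecC : Scheme.{0} := Spec (CommRingCat.of ℂ)

/-- The affine line `𝔸¹ = Spec ℂ[t]`. -/
abbrev A1 : Scheme.{0} := Spec (CommRingCat.of (Polynomial ℂ))

/-- The structure morphism `𝔸¹ ⟶ Spec ℂ`. -/
def A1toC : A1 ⟶ SpecC := Spec.map (CommRingCat.ofHom Polynomial.C)

/-- The closed point `t = a` of the affine line. -/
def A1pt (a : ℂ) : SpecC ⟶ A1 := Spec.map (CommRingCat.ofHom (Polynomial.evalRingHom a))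

/-- The coordinate `t`, evaluated on a `T`-valued point of the affine line. -/
def A1coord {T : Scheme.{0}} (p : T ⟶ A1) : Γ(T, ⊤) :=
  p.appTop.hom ((Scheme.ΓSpecIso (CommRingCat.of (Polynomial ℂ))).inv.hom Polynomial.X)

section Cone

variable {V W : Type*} [AddCommGroup V] [Module ℂ V] [AddCommGroup W] [Module ℂ W]
  [FiniteDimensional ℂ W]

/-- The affine cone over the closure in `ℙ(W)` of the orbit through the line `ℂ w`, as a
`ℂ`-scheme. -/
def affineCone (ρ : V →ₗ[ℂ] Module.End ℂ W) (w : W) : Over SpecC :=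
  Over.mk (Spec.map (CommRingCat.ofHom (algebraMap ℂ (CoordRing ρ w))))

/-- The flag variety: the closure in `ℙ(W)` of the orbit of the unipotent group through the line
`ℂ w`, as a projective `ℂ`-scheme. -/
def flagVariety (ρ : V →ₗ[ℂ] Module.End ℂ W) (w : W) : Over SpecC :=
  Over.mk (Proj.toSpecZero (coordDeg ρ w) ≫
    Spec.map (CommRingCat.ofHom (algebraMap ℂ (coordDeg ρ w 0))))

end Cone

/-- An (algebraic) action of `ℂ^* = 𝔾ₘ` on a `ℂ`-scheme `X`, by its functor of points: for each
`ℂ`-scheme `T`, an action of the group of units on `T` on the set `X(T)`, natural in `T`. -/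
structure GmAction (X : Over SpecC) where
  act : ∀ {T : Over SpecC}, Γ(T.left, ⊤)ˣ → (T ⟶ X) → (T ⟶ X)
  one_act : ∀ {T : Over SpecC} (x : T ⟶ X), act 1 x = x
  mul_act : ∀ {T : Over SpecC} (u u' : Γ(T.left, ⊤)ˣ) (x : T ⟶ X),
    act (u * u') x = act u (act u' x)
  comp_act : ∀ {S T : Over SpecC} (f : S ⟶ T) (u : Γ(T.left, ⊤)ˣ) (x : T ⟶ X),
    f ≫ act u x = act (Units.map (f.left.appTop.hom : Γ(T.left, ⊤) →* Γ(S.left, ⊤)) u) (f ≫ x)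

/-- The scheme-theoretic fibre of `π : X ⟶ 𝔸¹` over the point `t = a`, as a `ℂ`-scheme. -/
def fibreAt {X : Scheme.{0}} (π : X ⟶ A1) (a : ℂ) : Over SpecC :=
  Over.mk (pullback.snd π (A1pt a))

/-- A flat degeneration of `Y` into `Y₀`: a complex variety `X` with a flat morphism
`π : X ⟶ 𝔸¹` all of whose fibres over `t ≠ 0` are isomorphic to `Y` and whose fibre over `t = 0`
is isomorphic to `Y₀`, together with a `ℂ^*`-action on `X` for which `π` is equivariant with
respect to the action of `ℂ^*` on `𝔸¹` by `t⁻¹`-multiplication. -/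
structure FlatDegeneration (Y Y₀ : Over SpecC) where
  X : Scheme.{0}
  π : X ⟶ A1
  integral : IsIntegral X
  separated : IsSeparated π
  finiteType : LocallyOfFiniteType π
  quasiCompact : QuasiCompact π
  flat : Flat π
  fibre_ne_zero : ∀ a : ℂ, a ≠ 0 → Nonempty (fibreAt π a ≅ Y)
  fibre_zero : Nonempty (fibreAt π 0 ≅ Y₀)
  action : GmAction (Over.mk (π ≫ A1toC))
  equivariant : ∀ {T : Over SpecC} (u : Γ(T.left, ⊤)ˣ) (x : T ⟶ Over.mk (π ≫ A1toC)),
    A1coord ((action.act u x).left ≫ π) = ((u⁻¹ : Γ(T.left, ⊤)ˣ) : Γ(T.left, ⊤)) *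
      A1coord (x.left ≫ π)

/-- `Y` admits a flat degeneration into `Y₀` with affine total space. -/
def HasAffineFlatDegeneration (Y Y₀ : Over SpecC) : Prop :=
  ∃ D : FlatDegeneration Y Y₀, IsAffine D.X

/-- `Y` admits a flat degeneration into `Y₀` that is proper over the affine line. -/
def HasProperFlatDegeneration (Y Y₀ : Over SpecC) : Prop :=
  ∃ D : FlatDegeneration Y Y₀, IsProper D.π

end Schemes

end Favourable

end

/-!
All the varieties in question are orbit closures `closure (exp(V) · [w]) ⊆ ℙ(W)` for a nilpotent
action of a space `V = 𝔫` with the basis `b` on a space `W`. Since `x ↦ exp(x) w` is a polynomial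
map, a linear form `ξ` on `W` gives a polynomial `x ↦ ξ (exp(x) w)` in `N` variables. Let `A ⊆
ℂ[x]` be the finite-dimensional space of these polynomials (`orbitSpace`). The homogeneous
coordinate ring of the orbit closure is `⨁ₙ Aⁿ zⁿ ⊆ ℂ[x][z]` (`coneAlg`, `coordRingEquiv`), so
that the problem becomes one on the three spaces `A_M`, `A_{M^a}` and `A_{M^t}` of polynomials in
the same variables.

The coefficient of `x^p` in `exp(x) v` is a nonzero multiple of `v(p)` up to lower order
(`exists_momentVec_eq`). Therefore `A_{M^a}` is spanned by lowest-degree forms of elements of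
`A_M` (`orbitSpace_actA_le`). The space `A_{M^t}` is spanned by the monomials `x^p` with `p`
essential (`orbitSpace_actT`), and these are initial forms of elements of `A_M` and of `A_{M^a}`
for weights `ω` that induce the given monomial order on the exponents of bounded degree
(`exists_weight`, `isInitial_of_essential`, `isInitial_actA_of_essential`).

If `B` is spanned by initial forms of elements `f j` of `A`, let `F j = t^{-m j} f j (t^ω x)` and
let `Ã` be the `ℂ[t]`-module they span. The domain `⨁ Ãⁿ zⁿ` is flat over `ℂ[t]`. If moreover `dim
Aⁿ = dim Bⁿ` for all `n`, a basis of `Bⁿ` made of products of the initial forms lifts to a basis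
of `Ãⁿ` (`exists_frame`), so that the fibre over `0` is `⨁ Bⁿ zⁿ` and all the others are `⨁ Aⁿ
zⁿ`; giving `t` the weight `-1` and `F j z` the weight `m j` defines the torus action. Taking the
spectrum and the projective spectrum yields the affine and the proper degeneration
(`hasFlatDegenerations_of_initial`).

The dimensions agree: the space of polynomials of `M^{⊗ n}` is the span of the products of `n`
polynomials of `M`, and a space of orbit polynomials has the dimension of the cyclic module it
comes from, so `dim A_Mⁿ = dim M^{⊙ n}` (`finrank_orbitSpace_pow`); `dim A_{M^t}ⁿ` is the number
of elements of the `n`-fold Minkowski sum of the essential set (`finrank_span_monomial_pow`). For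
a favourable module these are equal, and `dim A_{M^a}ⁿ` lies between them
(`finrank_pow_le_of_initial`).
-/

open scoped Pointwise TensorProduct DirectSum

noncomputable section

namespace Favourable

/-! ### Base change of projective spectra -/

section ProjBaseChange

open AlgebraicGeometry CategoryTheory CategoryTheory.Limits HomogeneousLocalization

variable {A B σ τ : Type} [CommRing A] [SetLike σ A] [AddSubgroupClass σ A]
  [CommRing B] [SetLike τ B] [AddSubgroupClass τ B]
  {𝒜 : ℕ → σ} {ℬ : ℕ → τ} [GradedRing 𝒜] [GradedRing ℬ]

/-- The morphism `Proj 𝒜 ⟶ Spec R` given by a ring homomorphism `R → 𝒜₀`. -/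
def projTo (𝒜 : ℕ → σ) [GradedRing 𝒜] {R : Type} [CommRing R] (φ : R →+* 𝒜 0) :
    Proj 𝒜 ⟶ Spec (CommRingCat.of R) :=
  Proj.toSpecZero 𝒜 ≫ Spec.map (CommRingCat.ofHom φ)

theorem awayι_projTo {R : Type} [CommRing R] (φ : R →+* 𝒜 0) {i : ℕ} (hi : 0 < i) (s : A)
    (hs : s ∈ 𝒜 i) : Proj.awayι 𝒜 s hs hi ≫ projTo 𝒜 φ =
      Spec.map (CommRingCat.ofHom ((fromZeroRingHom 𝒜 (Submonoid.powers s)).comp φ)) := by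
  rw [projTo, Proj.awayι_toSpecZero_assoc, ← Spec.map_comp]
  rfl

theorem isPullback_awayι (f : 𝒜 →+*ᵍ ℬ)
    (hf : HomogeneousIdeal.irrelevant ℬ ≤ (HomogeneousIdeal.irrelevant 𝒜).map f)
    {i : ℕ} (hi : 0 < i) (s : A) (hs : s ∈ 𝒜 i) :
    IsPullback (Proj.awayι ℬ (f s) (f.2 hs) hi) (Spec.map (CommRingCat.ofHom (Away.map f s)))
      (Proj.map f hf) (Proj.awayι 𝒜 s hs hi) := by
  refine (IsOpenImmersion.isPullback _ _ _ _ ?_ ?_).flip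
  · exact Proj.awayι_comp_map f hf hi s hs
  · rw [Proj.opensRange_awayι, Proj.opensRange_awayι]
    rfl

/-- Base change of `Proj` can be checked on the charts `D₊(s)`. -/
theorem isPullback_projMap (f : 𝒜 →+*ᵍ ℬ)
    (hf : HomogeneousIdeal.irrelevant ℬ ≤ (HomogeneousIdeal.irrelevant 𝒜).map f)
    {R S : Type} [CommRing R] [CommRing S] (φ : R →+* 𝒜 0) (ψ : S →+* ℬ 0) (h : R →+* S)
    (H : ∀ (i : ℕ) (_ : 0 < i) (s : A) (_ : s ∈ 𝒜 i),
      IsPushout (CommRingCat.ofHom ((fromZeroRingHom 𝒜 (Submonoid.powers s)).comp φ))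
        (CommRingCat.ofHom h)
        (CommRingCat.ofHom (Away.map f s))
        (CommRingCat.ofHom ((fromZeroRingHom ℬ (Submonoid.powers (f s))).comp ψ))) :
    IsPullback (Proj.map f hf) (projTo ℬ ψ) (projTo 𝒜 φ) (Spec.map (CommRingCat.ofHom h)) := by
  refine Scheme.isPullback_of_openCover _ _ _ _ (Proj.affineOpenCover 𝒜).openCover fun j => ?_
  have h1 := isPullback_SpecMap_of_isPushout _ _ _ _ (H j.1 j.1.2 j.2 j.2.2)
  have h2 := (isPullback_awayι f hf j.1.2 (j.2 : A) j.2.2)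
  refine IsPullback.of_iso h1 (h2.isoPullback) (Iso.refl _) (Iso.refl _) (Iso.refl _) ?_ ?_ ?_ ?_
  · exact (Category.comp_id _).trans h2.isoPullback_hom_snd.symm
  · refine (Category.comp_id _).trans
      ((awayι_projTo ψ j.1.2 (f (j.2 : A)) (f.2 j.2.2)).symm.trans ?_)
    exact (congrArg (· ≫ projTo ℬ ψ) h2.isoPullback_hom_fst.symm).trans (Category.assoc _ _ _)
  · have h4 := awayι_projTo φ j.1.2 (j.2 : A) (j.2.2)
    exact (Category.comp_id _).trans (h4.symm.trans (Category.id_comp _).symm)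
  · simp

/-- A surjection of rings whose kernel is generated by the kernel of a surjection `R → S` is a
pushout of `R → S`. -/
theorem isPushout_of_surjective {R S A' B' : Type} [CommRing R] [CommRing S] [CommRing A']
    [CommRing B'] (φ : R →+* A') (h : R →+* S) (g : A' →+* B') (ψ : S →+* B')
    (hc : g.comp φ = ψ.comp h) (hh : Function.Surjective h) (hg : Function.Surjective g)
    (hk : RingHom.ker g ≤ (RingHom.ker h).map φ) :
    IsPushout (CommRingCat.ofHom φ) (CommRingCat.ofHom h) (CommRingCat.ofHom g)
      (CommRingCat.ofHom ψ) := by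
  refine ⟨⟨?_⟩, ⟨PushoutCocone.IsColimit.mk _ (fun s => CommRingCat.ofHom
    (RingHom.liftOfSurjective g hg ⟨s.inl.hom, ?_⟩)) ?_ ?_ ?_⟩⟩
  · ext x
    exact congrArg (fun k => k x) hc
  · refine hk.trans (Ideal.map_le_iff_le_comap.2 fun r hr => ?_)
    have := congrArg (fun k => k.hom r) s.condition
    simp only [CommRingCat.hom_comp, RingHom.comp_apply, CommRingCat.hom_ofHom] at this
    rw [Ideal.mem_comap, RingHom.mem_ker, this, RingHom.mem_ker.1 hr, map_zero]
  · intro s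
    ext x
    exact RingHom.liftOfRightInverse_comp_apply _ _ (Function.rightInverse_surjInv hg) _ _
  · intro s
    ext x
    obtain ⟨r, rfl⟩ := hh x
    have h1 := congrArg (fun k => k.hom r) s.condition
    simp only [CommRingCat.hom_comp, RingHom.comp_apply, CommRingCat.hom_ofHom] at h1 ⊢
    have h2 := congrArg (fun k => k r) hc
    simp only [RingHom.comp_apply] at h2
    rw [← h2, RingHom.liftOfRightInverse_comp_apply, h1]
  · intro s m hm _
    ext x
    obtain ⟨a, rfl⟩ := hg x
    have h1 := congrArg (fun k => k.hom a) hm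
    simp only [CommRingCat.hom_comp, RingHom.comp_apply, CommRingCat.hom_ofHom] at h1 ⊢
    rw [h1, RingHom.liftOfRightInverse_comp_apply]

/-- The degree-zero localizations of a surjective homomorphism of graded rings with kernel
generated by an element `φ r` of degree zero form a pushout of a surjection `R → S` killing `r`. -/
theorem isPushout_away_of_surjective (f : 𝒜 →+*ᵍ ℬ) {R S : Type} [CommRing R] [CommRing S]
    (φ : R →+* 𝒜 0) (ψ : S →+* ℬ 0) (h : R →+* S) (hh : Function.Surjective h)
    (hc : ∀ r, f (φ r : A) = ψ (h r)) (hf : ∀ n, ∀ y ∈ ℬ n, ∃ x ∈ 𝒜 n, f x = y)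
    (r : R) (hr : h r = 0) (hk : ∀ x, f x = 0 → ∃ x', x = (φ r : A) * x')
    {i : ℕ} {s : A} (hs : s ∈ 𝒜 i) :
    IsPushout (CommRingCat.ofHom ((fromZeroRingHom 𝒜 (Submonoid.powers s)).comp φ))
        (CommRingCat.ofHom h)
        (CommRingCat.ofHom (Away.map f s))
        (CommRingCat.ofHom ((fromZeroRingHom ℬ (Submonoid.powers (f s))).comp ψ)) := by
  have hk' : ∀ n, ∀ x ∈ 𝒜 n, f x = 0 → ∃ x' ∈ 𝒜 n, x = (φ r : A) * x' := by
    intro n x hx h0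
    obtain ⟨x', hx'⟩ := hk x h0
    refine ⟨DirectSum.decompose 𝒜 x' n, SetLike.coe_mem _, ?_⟩
    have := DirectSum.coe_decompose_mul_of_left_mem_zero 𝒜 (j := n) (b := x') (φ r).2
    rw [← this, ← hx', DirectSum.decompose_of_mem_same 𝒜 hx]
  refine isPushout_of_surjective _ _ _ _ ?_ hh ?_ ?_
  · ext x
    simp only [RingHom.comp_apply, fromZeroRingHom, Away.map]
    erw [HomogeneousLocalization.map_mk]
    simp [hc]
    rfl
  · intro y
    obtain ⟨n, b, hb, rfl⟩ := Away.mk_surjective ℬ (f.2 hs) y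
    obtain ⟨a, ha, rfl⟩ := hf _ b hb
    exact ⟨Away.mk 𝒜 hs n a ha, Away.map_mk f s hs n a ha⟩
  · intro x hx
    obtain ⟨n, a, ha, rfl⟩ := Away.mk_surjective 𝒜 hs x
    rw [RingHom.mem_ker, Away.map_mk, HomogeneousLocalization.ext_iff_val, Away.val_mk,
      val_zero, Localization.mk_eq_mk', IsLocalization.mk'_eq_zero_iff] at hx
    obtain ⟨⟨_, m, rfl⟩, hm⟩ := hx
    obtain ⟨a', ha', hE⟩ := hk' (m • i + n • i) (s ^ m * a)
      (SetLike.mul_mem_graded (SetLike.pow_mem_graded m hs) ha) (by simpa using hm)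
    have h1 : Away.mk 𝒜 hs n a ha = (fromZeroRingHom 𝒜 (Submonoid.powers s)).comp φ r *
        Away.mk 𝒜 hs (m + n) a' (by rwa [add_smul]) := by
      ext
      simp only [RingHom.comp_apply, fromZeroRingHom, val_mul, Away.val_mk]
      erw [HomogeneousLocalization.val_mk]
      rw [Localization.mk_mul, Localization.mk_eq_mk_iff, Localization.r_iff_exists]
      refine ⟨1, ?_⟩
      simp only [OneMemClass.coe_one, one_mul, Submonoid.coe_mul]
      erw [one_mul]
      rw [← hE, pow_add]
      ring
    rw [h1]
    exact Ideal.mul_mem_right _ _ (Ideal.mem_map_of_mem _ hr)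

end ProjBaseChange

/-! ### Degree-zero localizations of a base change -/

section TensorBaseChange

open AlgebraicGeometry CategoryTheory CategoryTheory.Limits HomogeneousLocalization

variable {A : Type} [CommRing A] [Algebra ℂ A] (𝒜 : ℕ → Submodule ℂ A) [GradedAlgebra 𝒜]

/-- The `ℂ`-algebra structure on a degree-zero localization that factors through `𝒜₀`. -/
instance awayAlgebra (s : A) : Algebra ℂ (Away 𝒜 s) where
  algebraMap := (fromZeroRingHom 𝒜 (Submonoid.powers s)).comp (algebraMap ℂ (𝒜 0))
  commutes' _ _ := mul_comm _ _
  smul_def' c x := by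
    obtain ⟨y, rfl⟩ := HomogeneousLocalization.mk_surjective x
    ext
    simp only [val_smul, val_mul, val_mk, RingHom.comp_apply, fromZeroRingHom]
    erw [val_mk]
    rw [Localization.mk_mul, Localization.smul_mk]
    simp [Algebra.smul_def]

/-- The linear map `a ↦ a / sⁿ` from the elements of degree `n deg s` to the degree-zero
localization at `s`. -/
def awayMk {i : ℕ} {s : A} (hs : s ∈ 𝒜 i) (n : ℕ) : 𝒜 (n • i) →ₗ[ℂ] Away 𝒜 s where
  toFun a := Away.mk 𝒜 hs n a a.2
  map_add' a a' := by
    ext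
    simp [Localization.add_mk_self]
  map_smul' c a := by
    ext
    simp [Localization.smul_mk]

theorem awayMk_pow_mul {i : ℕ} {s : A} (hs : s ∈ 𝒜 i) (m n k : ℕ) (hk : k = m + n)
    (a : 𝒜 (n • i)) (h : s ^ m * (a : A) ∈ 𝒜 (k • i)) :
    awayMk 𝒜 hs k ⟨s ^ m * a, h⟩ = awayMk 𝒜 hs n a := by
  subst hk
  ext
  simp only [awayMk, LinearMap.coe_mk, AddHom.coe_mk, Away.val_mk]
  rw [Localization.mk_eq_mk_iff, Localization.r_iff_exists]
  refine ⟨1, ?_⟩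
  simp only [pow_add]
  ring

variable (S : Type) [CommRing S] [Algebra ℂ S]

/-- The inclusion of a graded algebra into its base change, as a homomorphism of graded rings. -/
def tensorIncl : 𝒜 →+*ᵍ (fun n => (𝒜 n).baseChange S) where
  toRingHom := (Algebra.TensorProduct.includeRight : A →ₐ[ℂ] S ⊗[ℂ] A).toRingHom
  map_mem hx := Submodule.tmul_mem_baseChange_of_mem _ hx

omit [GradedAlgebra 𝒜] in
theorem tensorIncl_apply (a : A) : tensorIncl 𝒜 S a = 1 ⊗ₜ a := rfl

theorem away_map_algebraMap (s : A) (c : ℂ) :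
    Away.map (tensorIncl 𝒜 S) s (algebraMap ℂ (Away 𝒜 s) c) =
      (fromZeroRingHom (fun n => (𝒜 n).baseChange S) (Submonoid.powers (tensorIncl 𝒜 S s)))
        (algebraMap S _ (algebraMap ℂ S c)) := by
  change Away.map (tensorIncl 𝒜 S) s (HomogeneousLocalization.mk _) =
    HomogeneousLocalization.mk _
  rw [Away.map, HomogeneousLocalization.map_mk]
  ext
  rw [val_mk, val_mk]
  congr 1
  · change (1 : S) ⊗ₜ[ℂ] (algebraMap ℂ A c) = (algebraMap ℂ S c) ⊗ₜ 1
    rw [Algebra.algebraMap_eq_smul_one, Algebra.algebraMap_eq_smul_one, TensorProduct.tmul_smul,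
      TensorProduct.smul_tmul']

/-- The comparison map from the base change of a degree-zero localization to the degree-zero
localization of the base change. -/
def awayTensorHom (s : A) : Away 𝒜 s ⊗[ℂ] S →+*
    Away (fun n => (𝒜 n).baseChange S) (tensorIncl 𝒜 S s) :=
  letI ψ := (fromZeroRingHom (fun n => (𝒜 n).baseChange S)
    (Submonoid.powers (tensorIncl 𝒜 S s))).comp (algebraMap S ((𝒜 0).baseChange S))
  letI : Algebra ℂ (Away (fun n => (𝒜 n).baseChange S) (tensorIncl 𝒜 S s)) :=
    (ψ.comp (algebraMap ℂ S)).toAlgebra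
  (Algebra.TensorProduct.lift
    { Away.map (tensorIncl 𝒜 S) s with commutes' := away_map_algebraMap 𝒜 S s }
    { ψ with commutes' := fun _ => rfl }
    (fun _ _ => Commute.all _ _) : Away 𝒜 s ⊗[ℂ] S →ₐ[ℂ] _).toRingHom

theorem awayTensorHom_tmul (s : A) (x : Away 𝒜 s) (c : S) :
    awayTensorHom 𝒜 S s (x ⊗ₜ c) = Away.map (tensorIncl 𝒜 S) s x *
      (fromZeroRingHom (fun n => (𝒜 n).baseChange S)
        (Submonoid.powers (tensorIncl 𝒜 S s)) (algebraMap S ((𝒜 0).baseChange S) c)) := by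
  let ψ := (fromZeroRingHom (fun n => (𝒜 n).baseChange S)
    (Submonoid.powers (tensorIncl 𝒜 S s))).comp (algebraMap S ((𝒜 0).baseChange S))
  let : Algebra ℂ (Away (fun n => (𝒜 n).baseChange S) (tensorIncl 𝒜 S s)) :=
    (ψ.comp (algebraMap ℂ S)).toAlgebra
  exact Algebra.TensorProduct.lift_tmul _ _ _ _ _

theorem val_awayTensorHom_awayMk {i : ℕ} {s : A} (hs : s ∈ 𝒜 i) (n : ℕ)
    (y : 𝒜 (n • i) ⊗[ℂ] S) :
    (awayTensorHom 𝒜 S s ((awayMk 𝒜 hs n).rTensor S y)).val =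
      Localization.mk (TensorProduct.comm ℂ A S ((𝒜 (n • i)).subtype.rTensor S y))
        (⟨tensorIncl 𝒜 S s ^ n, ⟨n, rfl⟩⟩ : Submonoid.powers (tensorIncl 𝒜 S s)) := by
  induction y using TensorProduct.induction_on with
  | zero => simp [Localization.mk_zero]
  | add y y' hy hy' => simp only [map_add, val_add, hy, hy', Localization.add_mk_self]
  | tmul a c =>
    rw [LinearMap.rTensor_tmul, LinearMap.rTensor_tmul, awayTensorHom_tmul, val_mul]
    simp only [awayMk, LinearMap.coe_mk, AddHom.coe_mk, Away.map_mk, Away.val_mk]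
    erw [val_mk]
    rw [Localization.mk_mul]
    congr 1
    · change ((1 : S) ⊗ₜ[ℂ] (a : A)) * (c ⊗ₜ[ℂ] (1 : A)) = c ⊗ₜ[ℂ] (a : A)
      simp
    · ext
      exact mul_one _

theorem exists_awayMk_rTensor {i : ℕ} {s : A} (hs : s ∈ 𝒜 i) (x : Away 𝒜 s ⊗[ℂ] S) :
    ∃ n y, x = (awayMk 𝒜 hs n).rTensor S y := by
  have key : ∀ (m n k : ℕ) (_ : k = m + n) (y : 𝒜 (n • i) ⊗[ℂ] S), ∃ y' : 𝒜 (k • i) ⊗[ℂ] S,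
      (awayMk 𝒜 hs n).rTensor S y = (awayMk 𝒜 hs k).rTensor S y' := by
    rintro m n _ rfl y
    have hmem : ∀ a : 𝒜 (n • i), s ^ m * (a : A) ∈ 𝒜 ((m + n) • i) := fun a => by
      rw [add_smul]
      exact SetLike.mul_mem_graded (SetLike.pow_mem_graded m hs) a.2
    induction y using TensorProduct.induction_on with
    | zero => exact ⟨0, by simp⟩
    | add y y' hy hy' =>
      obtain ⟨z, hz⟩ := hy
      obtain ⟨z', hz'⟩ := hy'
      exact ⟨z + z', by simp [hz, hz']⟩
    | tmul a c =>
      refine ⟨⟨s ^ m * a, hmem a⟩ ⊗ₜ c, ?_⟩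
      rw [LinearMap.rTensor_tmul, LinearMap.rTensor_tmul, awayMk_pow_mul 𝒜 hs m n _ rfl]
  induction x using TensorProduct.induction_on with
  | zero => exact ⟨0, 0, by simp⟩
  | tmul x c =>
    obtain ⟨n, a, ha, rfl⟩ := Away.mk_surjective 𝒜 hs x
    exact ⟨n, ⟨a, ha⟩ ⊗ₜ c, rfl⟩
  | add x x' hx hx' =>
    obtain ⟨n, y, rfl⟩ := hx
    obtain ⟨n', y', rfl⟩ := hx'
    obtain ⟨z, hz⟩ := key n' n _ rfl y
    obtain ⟨z', hz'⟩ := key n n' (n' + n) (add_comm _ _) y'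
    exact ⟨n' + n, z + z', by rw [hz, hz', map_add]⟩

/-- A fraction `y / sⁿ` vanishes after the base change only if some `s ^ m * y` does, and `S` is
flat over `ℂ`, so that `s ^ m * y` then vanishes in the homogeneous component tensored with `S`.
-/
theorem awayTensorHom_bijective {i : ℕ} {s : A} (hs : s ∈ 𝒜 i) :
    Function.Bijective (awayTensorHom 𝒜 S s) := by
  constructor
  · rw [injective_iff_map_eq_zero]
    intro x hx
    obtain ⟨n, y, rfl⟩ := exists_awayMk_rTensor 𝒜 S hs x
    rw [HomogeneousLocalization.ext_iff_val, val_awayTensorHom_awayMk, val_zero,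
      Localization.mk_eq_mk', IsLocalization.mk'_eq_zero_iff] at hx
    obtain ⟨⟨_, m, rfl⟩, hm⟩ := hx
    have hmem : ∀ a : 𝒜 (n • i), s ^ m * (a : A) ∈ 𝒜 ((m + n) • i) := fun a => by
      rw [add_smul]
      exact SetLike.mul_mem_graded (SetLike.pow_mem_graded m hs) a.2
    let μ : 𝒜 (n • i) →ₗ[ℂ] 𝒜 ((m + n) • i) :=
      ((LinearMap.mulLeft ℂ (s ^ m)).comp (𝒜 (n • i)).subtype).codRestrict _ hmem
    have h1 : (awayMk 𝒜 hs n) = (awayMk 𝒜 hs (m + n)).comp μ := by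
      ext1 a
      exact (awayMk_pow_mul 𝒜 hs m n _ rfl a (hmem a)).symm
    have h2 : ∀ z : 𝒜 (n • i) ⊗[ℂ] S,
        TensorProduct.comm ℂ A S ((𝒜 ((m + n) • i)).subtype.rTensor S (μ.rTensor S z)) =
        tensorIncl 𝒜 S s ^ m * TensorProduct.comm ℂ A S ((𝒜 (n • i)).subtype.rTensor S z) := by
      intro z
      induction z using TensorProduct.induction_on with
      | zero => simp
      | add z z' hz hz' => simp only [map_add, hz, hz', mul_add]
      | tmul a c =>
        rw [tensorIncl_apply, Algebra.TensorProduct.tmul_pow]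
        simp [μ]
    have h3 : μ.rTensor S y = 0 := by
      apply Module.Flat.rTensor_preserves_injective_linearMap (M := S) _
        (𝒜 ((m + n) • i)).injective_subtype
      apply (TensorProduct.comm ℂ A S).injective
      rw [h2, hm]
      simp
    rw [h1, LinearMap.rTensor_comp, LinearMap.comp_apply, h3, map_zero]
  · intro y
    obtain ⟨n, b, hb, rfl⟩ := Away.mk_surjective (fun n => (𝒜 n).baseChange S)
      ((tensorIncl 𝒜 S).map_mem hs) y
    have h1 : ∃ z : 𝒜 (n • i) ⊗[ℂ] S,
        TensorProduct.comm ℂ A S ((𝒜 (n • i)).subtype.rTensor S z) = b := by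
      rw [Submodule.baseChange_eq_span] at hb
      induction hb using Submodule.span_induction with
      | zero => exact ⟨0, by simp⟩
      | add b b' _ _ hb hb' =>
        obtain ⟨z, rfl⟩ := hb
        obtain ⟨z', rfl⟩ := hb'
        exact ⟨z + z', by simp⟩
      | mem b hb =>
        obtain ⟨a, ha, rfl⟩ := hb
        exact ⟨⟨a, ha⟩ ⊗ₜ 1, by simp⟩
      | smul c b hb₀ hb =>
        clear hb₀
        obtain ⟨z, rfl⟩ := hb
        refine ⟨(LinearMap.mulLeft ℂ c).lTensor _ z, ?_⟩
        induction z using TensorProduct.induction_on with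
        | zero => simp
        | add z z' hz hz' => simp only [map_add, hz, hz', smul_add]
        | tmul a d => simp [TensorProduct.smul_tmul']
    obtain ⟨z, rfl⟩ := h1
    refine ⟨(awayMk 𝒜 hs n).rTensor S z, ?_⟩
    ext
    rw [val_awayTensorHom_awayMk, Away.val_mk]
    rfl

/-- Degree-zero localization commutes with base change, so `Proj` does. -/
theorem isPushout_away_tensor {i : ℕ} {s : A} (hs : s ∈ 𝒜 i) :
    IsPushout (CommRingCat.ofHom ((fromZeroRingHom 𝒜 (Submonoid.powers s)).comp
        (algebraMap ℂ (𝒜 0))))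
      (CommRingCat.ofHom (algebraMap ℂ S))
      (CommRingCat.ofHom (Away.map (tensorIncl 𝒜 S) s))
      (CommRingCat.ofHom ((fromZeroRingHom (fun n => (𝒜 n).baseChange S)
        (Submonoid.powers (tensorIncl 𝒜 S s))).comp (algebraMap S ((𝒜 0).baseChange S)))) := by
  refine IsPushout.of_iso (CommRingCat.isPushout_tensorProduct ℂ (Away 𝒜 s) S)
    (Iso.refl _) (Iso.refl _) (Iso.refl _)
    (RingEquiv.ofBijective _ (awayTensorHom_bijective 𝒜 S hs)).toCommRingCatIso ?_ ?_ ?_ ?_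
  · rfl
  · rfl
  · refine CommRingCat.hom_ext (RingHom.ext fun x => ?_)
    change awayTensorHom 𝒜 S s (x ⊗ₜ 1) = Away.map (tensorIncl 𝒜 S) s x
    rw [awayTensorHom_tmul, map_one, map_one, mul_one]
  · refine CommRingCat.hom_ext (RingHom.ext fun x => ?_)
    change awayTensorHom 𝒜 S s (1 ⊗ₜ x) = _
    rw [awayTensorHom_tmul, map_one, one_mul]
    rfl

end TensorBaseChange

/-! ### Integrality and flatness of projective spectra -/

section ProjLemmas

open AlgebraicGeometry CategoryTheory CategoryTheory.Limits HomogeneousLocalization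

variable {A B σ τ : Type} [CommRing A] [SetLike σ A] [AddSubgroupClass σ A]
  [CommRing B] [SetLike τ B] [AddSubgroupClass τ B]
  {𝒜 : ℕ → σ} {ℬ : ℕ → τ} [GradedRing 𝒜] [GradedRing ℬ]

theorem irrelevant_le_map (f : 𝒜 →+*ᵍ ℬ)
    (h : ∀ n, 0 < n → ∀ y ∈ ℬ n, y ∈ Ideal.span (f '' (𝒜 n : Set A))) :
    HomogeneousIdeal.irrelevant ℬ ≤ (HomogeneousIdeal.irrelevant 𝒜).map f := by
  rw [HomogeneousIdeal.irrelevant_le]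
  intro i hi y hy
  have h1 := h i hi y hy
  have h2 : Ideal.span (f '' (𝒜 i : Set A)) ≤
      ((HomogeneousIdeal.irrelevant 𝒜).map f).toIdeal := by
    refine Ideal.span_mono ?_
    exact Set.image_mono fun a ha => HomogeneousIdeal.mem_irrelevant_of_mem _ hi ha
  exact h2 h1

theorem projMap_projTo (f : 𝒜 →+*ᵍ ℬ)
    (hf : HomogeneousIdeal.irrelevant ℬ ≤ (HomogeneousIdeal.irrelevant 𝒜).map f)
    {R : Type} [CommRing R] (φ : R →+* 𝒜 0) (ψ : R →+* ℬ 0)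
    (h : ∀ r, f (φ r : A) = ψ r) :
    Proj.map f hf ≫ projTo 𝒜 φ = projTo ℬ ψ := by
  have key : ∀ (i : ℕ) (hi : 0 < i) (s : A) (hs : s ∈ 𝒜 i),
      Proj.awayι ℬ (f s) (f.2 hs) hi ≫ Proj.map f hf ≫ projTo 𝒜 φ =
        Proj.awayι ℬ (f s) (f.2 hs) hi ≫ projTo ℬ ψ := by
    intro i hi s hs
    have h1 := Proj.awayι_comp_map f hf hi s hs
    rw [awayι_projTo ψ hi (f s) (f.2 hs), ← Category.assoc]
    erw [h1]
    rw [Category.assoc, awayι_projTo, ← Spec.map_comp, ← CommRingCat.ofHom_comp]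
    congr 2
    ext r
    simp only [RingHom.comp_apply, fromZeroRingHom, Away.map]
    erw [HomogeneousLocalization.map_mk]
    simp [h]
    rfl
  exact (Proj.mapAffineOpenCover f hf).openCover.hom_ext _ _ fun s => key s.1 s.1.2 s.2 s.2.2

theorem isIntegral_proj [IsDomain A] {i : ℕ} (hi : 0 < i) {s : A} (hs : s ∈ 𝒜 i) (hs0 : s ≠ 0) :
    IsIntegral (Proj 𝒜) := by
  have hdom : ∀ a : A, a ≠ 0 → IsDomain (Away 𝒜 a) := fun a ha => by
    have : IsDomain (Localization.Away a) :=
      IsLocalization.isDomain_localization (powers_le_nonZeroDivisors_of_noZeroDivisors ha)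
    exact (val_injective (𝒜 := 𝒜) (Submonoid.powers a)).isDomain
      (algebraMap (Away 𝒜 a) (Localization.Away a))
  -- The zero ideal is a generic point.
  let η : Proj 𝒜 := ⟨⊥, by
    change (⊥ : Ideal A).IsPrime
    exact Ideal.isPrime_bot, fun h => hs0 (h (HomogeneousIdeal.mem_irrelevant_of_mem 𝒜 hi hs))⟩
  have hη : ∀ U : (Proj 𝒜).Opens, (U : Set (Proj 𝒜)).Nonempty → η ∈ U := by
    rintro U ⟨x, hx⟩
    obtain ⟨_, ⟨a, rfl⟩, hxa, haU⟩ :=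
      TopologicalSpace.Opens.isBasis_iff_nbhd.1 (Proj.isBasis_basicOpen 𝒜) hx
    refine haU ?_
    rw [Proj.mem_basicOpen] at hxa ⊢
    intro h
    have : a = 0 := h
    exact hxa (this ▸ zero_mem _)
  have : IrreducibleSpace (Proj 𝒜) := by
    refine { isPreirreducible_univ := ?_, toNonempty := ⟨η⟩ }
    rintro U V hU hV ⟨x, -, hx⟩ ⟨y, -, hy⟩
    exact ⟨η, trivial, hη ⟨U, hU⟩ ⟨x, hx⟩, hη ⟨V, hV⟩ ⟨y, hy⟩⟩
  have : IsReduced (Proj 𝒜) := by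
    have : ∀ j, IsReduced ((Proj.affineOpenCover 𝒜).openCover.X j) := by
      rintro ⟨j, a⟩
      change IsReduced (Spec (CommRingCat.of (Away 𝒜 (a : A))))
      have : _root_.IsReduced (Away 𝒜 (a : A)) := by
        by_cases ha : (a : A) = 0
        · have := HomogeneousLocalization.subsingleton 𝒜 (x := Submonoid.powers (a : A))
            ⟨1, by simp [ha]⟩
          exact ⟨fun x _ => Subsingleton.elim _ _⟩
        · have := hdom _ ha
          exact isReduced_of_noZeroDivisors
      infer_instance
    exact IsReduced.of_openCover _ (Proj.affineOpenCover 𝒜).openCover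
  exact isIntegral_of_irreducibleSpace_of_isReduced _

/-- Over a Bézout domain flatness means torsion-freeness, which holds on the charts of the `Proj` of
a domain. -/
theorem flat_projTo [IsDomain A] {R : Type} [CommRing R] [IsDomain R] [IsBezout R]
    (φ : R →+* 𝒜 0) (hφ : Function.Injective φ) : Flat (projTo 𝒜 φ) := by
  have : ∀ j, IsAffine ((Proj.affineOpenCover 𝒜).openCover.X j) := fun j =>
    inferInstanceAs (IsAffine (Spec _))
  rw [HasRingHomProperty.iff_of_source_openCover (P := @AlgebraicGeometry.Flat)
    (Proj.affineOpenCover 𝒜).openCover]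
  rintro ⟨j, a⟩
  have h := awayι_projTo φ j.2 (a : A) a.2
  have := this ⟨j, a⟩
  refine HasRingHomProperty.appTop (P := @AlgebraicGeometry.Flat)
    ((Proj.affineOpenCover 𝒜).openCover.f ⟨j, a⟩ ≫ projTo 𝒜 φ)
    ((congrArg (fun k => AlgebraicGeometry.Flat k) h).mpr ?_)
  rw [Flat.SpecMap_iff]
  let : Algebra R (Away 𝒜 (a : A)) :=
    ((fromZeroRingHom 𝒜 (Submonoid.powers (a : A))).comp φ).toAlgebra
  change Module.Flat R (Away 𝒜 (a : A))
  by_cases ha : (a : A) = 0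
  · have := HomogeneousLocalization.subsingleton 𝒜 (x := Submonoid.powers (a : A))
            ⟨1, by simp [ha]⟩
    infer_instance
  have : IsDomain (Localization.Away (a : A)) :=
      IsLocalization.isDomain_localization (powers_le_nonZeroDivisors_of_noZeroDivisors ha)
  have : IsDomain (Away 𝒜 (a : A)) := (val_injective (𝒜 := 𝒜) (Submonoid.powers (a : A))).isDomain
      (algebraMap (Away 𝒜 (a : A)) (Localization.Away (a : A)))
  have hinj : Function.Injective (algebraMap R (Away 𝒜 (a : A))) := by
    intro r r' hr
    have h1 := congrArg val hr
    have h2 : algebraMap A (Localization.Away (a : A)) (φ r) = algebraMap A _ (φ r') := by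
      rw [← Localization.mk_one_eq_algebraMap, ← Localization.mk_one_eq_algebraMap]
      exact h1
    exact hφ (Subtype.ext (IsLocalization.injective _
      (powers_le_nonZeroDivisors_of_noZeroDivisors ha) h2))
  rw [Module.Flat.flat_iff_torsion_eq_bot_of_isBezout, ← Submodule.isTorsionFree_iff_torsion_eq_bot]
  exact Module.isTorsionFree_iff_algebraMap_injective.2 hinj

end ProjLemmas

/-! ### Actions of the multiplicative group from families of automorphisms -/

section GmActions

open AlgebraicGeometry CategoryTheory CategoryTheory.Limits

/-- The `ℂ`-algebra structure on the global functions of a `ℂ`-scheme. -/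
abbrev globalAlgebra (T : Over SpecC) : Algebra ℂ Γ(T.left, ⊤) :=
  (T.hom.appTop.hom.comp (Scheme.ΓSpecIso (CommRingCat.of ℂ)).inv.hom).toAlgebra

theorem toSpecΓ_globalAlgebra (T : Over SpecC) :
    letI := globalAlgebra T
    T.left.toSpecΓ ≫ Spec.map (CommRingCat.ofHom (algebraMap ℂ Γ(T.left, ⊤))) = T.hom := by
  change T.left.toSpecΓ ≫ Spec.map ((Scheme.ΓSpecIso (CommRingCat.of ℂ)).inv ≫ T.hom.appTop) = _
  rw [Spec.map_comp, ← Category.assoc, ← Scheme.toSpecΓ_naturality, Category.assoc]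
  erw [toSpecΓ_SpecMap_ΓSpecIso_inv]
  exact Category.comp_id _

/-- A family of base changes `X_S` of a `ℂ`-scheme `X` along `Spec S ⟶ Spec ℂ`, with automorphisms
`α u` of `X_S` over `Spec S`, indexed by the units `u` of `S` and natural in `S`. -/
structure UnitAutFamily {X : Scheme.{0}} (p : X ⟶ SpecC) where
  XS : ∀ (S : Type) [CommRing S] [Algebra ℂ S], Scheme.{0}
  pr : ∀ (S : Type) [CommRing S] [Algebra ℂ S], XS S ⟶ X
  q : ∀ (S : Type) [CommRing S] [Algebra ℂ S], XS S ⟶ Spec (CommRingCat.of S)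
  isPullback : ∀ (S : Type) [CommRing S] [Algebra ℂ S],
    IsPullback (pr S) (q S) p (Spec.map (CommRingCat.ofHom (algebraMap ℂ S)))
  α : ∀ (S : Type) [CommRing S] [Algebra ℂ S], Sˣ → (XS S ⟶ XS S)
  α_q : ∀ (S : Type) [CommRing S] [Algebra ℂ S] (u : Sˣ), α S u ≫ q S = q S
  α_one : ∀ (S : Type) [CommRing S] [Algebra ℂ S], α S 1 = 𝟙 _
  α_mul : ∀ (S : Type) [CommRing S] [Algebra ℂ S] (u u' : Sˣ), α S (u * u') = α S u' ≫ α S u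
  natural : ∀ (S S' : Type) [CommRing S] [Algebra ℂ S] [CommRing S'] [Algebra ℂ S']
    (h : S →ₐ[ℂ] S'), ∃ g : XS S' ⟶ XS S, g ≫ pr S = pr S' ∧
      g ≫ q S = q S' ≫ Spec.map (CommRingCat.ofHom h.toRingHom) ∧
      ∀ u : Sˣ, g ≫ α S u ≫ pr S = α S' (Units.map h u) ≫ pr S'

namespace UnitAutFamily

variable {X : Scheme.{0}} {p : X ⟶ SpecC} (F : UnitAutFamily p)

theorem α_pr_p (S : Type) [CommRing S] [Algebra ℂ S] (u : Sˣ) :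
    (F.α S u ≫ F.pr S) ≫ p = F.pr S ≫ p := by
  rw [Category.assoc, (F.isPullback S).w, ← Category.assoc, F.α_q]

/-- The point of `X_S`, for `S = Γ(T)`, given by a `T`-valued point of `X`. -/
def lift {T : Over SpecC} (x : T ⟶ Over.mk p) :
    letI := globalAlgebra T
    T.left ⟶ F.XS Γ(T.left, ⊤) :=
  letI := globalAlgebra T
  (F.isPullback Γ(T.left, ⊤)).lift x.left T.left.toSpecΓ
    ((Over.w x).trans (toSpecΓ_globalAlgebra T).symm)

theorem lift_pr {T : Over SpecC} (x : T ⟶ Over.mk p) :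
    letI := globalAlgebra T
    F.lift x ≫ F.pr _ = x.left :=
  letI := globalAlgebra T
  (F.isPullback Γ(T.left, ⊤)).lift_fst _ _ _

theorem lift_q {T : Over SpecC} (x : T ⟶ Over.mk p) :
    letI := globalAlgebra T
    F.lift x ≫ F.q _ = T.left.toSpecΓ :=
  letI := globalAlgebra T
  (F.isPullback Γ(T.left, ⊤)).lift_snd _ _ _

/-- The action of a unit on a point. -/
def act {T : Over SpecC} (u : Γ(T.left, ⊤)ˣ) (x : T ⟶ Over.mk p) : T ⟶ Over.mk p :=
  letI := globalAlgebra T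
  Over.homMk (F.lift x ≫ F.α _ u ≫ F.pr _) (by
    have h1 := F.α_pr_p _ u
    change (F.lift x ≫ F.α _ u ≫ F.pr _) ≫ p = T.hom
    rw [Category.assoc, h1, ← Category.assoc, F.lift_pr]
    exact Over.w x)

theorem act_left {T : Over SpecC} (u : Γ(T.left, ⊤)ˣ) (x : T ⟶ Over.mk p) :
    letI := globalAlgebra T
    (F.act u x).left = F.lift x ≫ F.α _ u ≫ F.pr _ := rfl

theorem lift_act {T : Over SpecC} (u : Γ(T.left, ⊤)ˣ) (x : T ⟶ Over.mk p) :
    letI := globalAlgebra T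
    F.lift (F.act u x) = F.lift x ≫ F.α _ u := by
  let := globalAlgebra T
  refine (F.isPullback Γ(T.left, ⊤)).hom_ext ?_ ?_
  · rw [F.lift_pr, F.act_left, Category.assoc]
  · rw [F.lift_q, Category.assoc, F.α_q, F.lift_q]

/-- The action of the multiplicative group given by a natural family of automorphisms. -/
def gmAction : GmAction (Over.mk p) where
  act := F.act
  one_act {T} x := by
    let := globalAlgebra T
    ext1
    rw [act_left, F.α_one, Category.id_comp, lift_pr]
  mul_act {T} u u' x := by
    let := globalAlgebra T
    ext1
    rw [act_left, act_left, lift_act, F.α_mul]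
    simp only [Category.assoc]
  comp_act {S T} f u x := by
    let := globalAlgebra T
    let := globalAlgebra S
    let h : Γ(T.left, ⊤) →ₐ[ℂ] Γ(S.left, ⊤) :=
      { f.left.appTop.hom with
        commutes' := fun c => by
          have h1 := Over.w f
          have h2 : T.hom.appTop ≫ f.left.appTop = S.hom.appTop := by
            rw [← Scheme.Hom.comp_appTop, h1]
          exact congrArg (fun k => k.hom ((Scheme.ΓSpecIso (CommRingCat.of ℂ)).inv.hom c)) h2 }
    obtain ⟨g, hg1, hg2, hg3⟩ := F.natural _ _ h
    have h3 : f.left ≫ F.lift x = F.lift (f ≫ x) ≫ g := by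
      refine (F.isPullback Γ(T.left, ⊤)).hom_ext ?_ ?_
      · rw [Category.assoc, F.lift_pr, Category.assoc, hg1, F.lift_pr]
        rfl
      · rw [Category.assoc, F.lift_q, Category.assoc, hg2, ← Category.assoc, F.lift_q]
        exact Scheme.toSpecΓ_naturality f.left
    ext1
    change f.left ≫ F.lift x ≫ F.α _ u ≫ F.pr _ = F.lift (f ≫ x) ≫ F.α _ _ ≫ F.pr _
    rw [← Category.assoc, h3, Category.assoc, hg3]
    rfl

theorem A1coord_comp {S T : Scheme.{0}} (f : S ⟶ T) (y : T ⟶ A1) :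
    A1coord (f ≫ y) = f.appTop.hom (A1coord y) := by
  rw [A1coord, Scheme.Hom.comp_appTop]
  rfl

/-- Equivariance of a morphism to the affine line may be checked on the base changes `X_S`. -/
theorem equivariant (π : X ⟶ A1)
    (h : ∀ (S : Type) [CommRing S] [Algebra ℂ S] (u : Sˣ),
      A1coord (F.α S u ≫ F.pr S ≫ π) =
        (F.q S).appTop.hom ((Scheme.ΓSpecIso (CommRingCat.of S)).inv.hom ((u⁻¹ : Sˣ) : S)) *
          A1coord (F.pr S ≫ π))
    {T : Over SpecC} (u : Γ(T.left, ⊤)ˣ) (x : T ⟶ Over.mk p) :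
    A1coord ((F.act u x).left ≫ π) = ((u⁻¹ : Γ(T.left, ⊤)ˣ) : Γ(T.left, ⊤)) *
      A1coord (x.left ≫ π) := by
  let := globalAlgebra T
  have h1 : (F.act u x).left ≫ π = F.lift x ≫ (F.α _ u ≫ F.pr _ ≫ π) := by
    rw [act_left]
    simp only [Category.assoc]
  have h2 : x.left ≫ π = F.lift x ≫ F.pr _ ≫ π := by
    rw [← Category.assoc, F.lift_pr]
  rw [h1, h2, A1coord_comp, A1coord_comp (F.lift x), h, map_mul]
  congr 1
  rw [← RingHom.comp_apply, ← RingHom.comp_apply, ← CommRingCat.hom_comp, ← CommRingCat.hom_comp,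
    ← Scheme.Hom.comp_appTop, F.lift_q, Scheme.toSpecΓ_appTop]
  exact congrArg (fun k => k.hom ((u⁻¹ : Γ(T.left, ⊤)ˣ) : Γ(T.left, ⊤)))
    (Scheme.ΓSpecIso Γ(T.left, ⊤)).inv_hom_id

end UnitAutFamily

end GmActions

/-! ### Torus actions on affine schemes -/

section Weights

open AlgebraicGeometry CategoryTheory CategoryTheory.Limits

/-- An action of the multiplicative group on the spectrum of a `ℂ`-algebra `R`, given by weights
of a family of generators: for each unit `u` of a `ℂ`-algebra `S` there is a homomorphism
`R → S ⊗ R` multiplying each generator by the power of `u` prescribed by its weight. -/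
structure WeightedGenerators (R : Type) [CommRing R] [Algebra ℂ R] where
  ι : Type
  gen : ι → R
  wt : ι → ℤ
  adjoin_gen : Algebra.adjoin ℂ (Set.range gen) = ⊤
  exists_hom : ∀ (S : Type) [CommRing S] [Algebra ℂ S] (u : Sˣ),
    ∃ α : R →ₐ[ℂ] S ⊗[ℂ] R, ∀ i, α (gen i) = ((u ^ wt i : Sˣ) : S) ⊗ₜ gen i

theorem ΓSpecIso_inv_appTop {A B : Type} [CommRing A] [CommRing B] (φ : A →+* B) (a : A) :
    (Spec.map (CommRingCat.ofHom φ)).appTop.hom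
      ((Scheme.ΓSpecIso (CommRingCat.of A)).inv.hom a) =
      (Scheme.ΓSpecIso (CommRingCat.of B)).inv.hom (φ a) :=
  (congrArg (fun k => k.hom a) (Scheme.ΓSpecIso_inv_naturality (CommRingCat.ofHom φ))).symm

namespace WeightedGenerators

variable {R : Type} [CommRing R] [Algebra ℂ R] (G : WeightedGenerators R)
  (S : Type) [CommRing S] [Algebra ℂ S]

/-- The automorphism of `S ⊗ R` multiplying each generator by the power of `u` prescribed by its
weight. -/
def hom (u : Sˣ) : S ⊗[ℂ] R →ₐ[S] S ⊗[ℂ] R :=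
  Algebra.TensorProduct.lift (Algebra.ofId S (S ⊗[ℂ] R)) (G.exists_hom S u).choose
    (fun _ _ => Commute.all _ _)

theorem hom_gen (u : Sˣ) (i : G.ι) :
    G.hom S u (1 ⊗ₜ G.gen i) = ((u ^ G.wt i : Sˣ) : S) ⊗ₜ G.gen i := by
  rw [hom, Algebra.TensorProduct.lift_tmul, map_one, one_mul, (G.exists_hom S u).choose_spec]

variable {S}

theorem hom_ext {T : Type} [CommRing T] [Algebra ℂ T] {f g : R →ₐ[ℂ] T}
    (h : ∀ i, f (G.gen i) = g (G.gen i)) : f = g := by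
  refine AlgHom.ext_of_adjoin_eq_top G.adjoin_gen ?_
  rintro _ ⟨i, rfl⟩
  exact h i

theorem tensor_hom_ext {T : Type} [CommRing T] [Algebra S T] {f g : S ⊗[ℂ] R →ₐ[S] T}
    (h : ∀ i, f (1 ⊗ₜ G.gen i) = g (1 ⊗ₜ G.gen i)) : f = g := by
  let : Algebra ℂ T := ((algebraMap S T).comp (algebraMap ℂ S)).toAlgebra
  have : IsScalarTower ℂ S T := IsScalarTower.of_algebraMap_eq fun _ => rfl
  refine Algebra.TensorProduct.ext (AlgHom.ext fun s => ?_) (G.hom_ext fun i => h i)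
  simpa using (f.commutes s).trans (g.commutes s).symm

theorem hom_tmul_gen (u : Sˣ) (s : S) (i : G.ι) :
    G.hom S u (s ⊗ₜ G.gen i) = (s * ((u ^ G.wt i : Sˣ) : S)) ⊗ₜ G.gen i := by
  have h1 : s ⊗ₜ[ℂ] G.gen i = s • ((1 : S) ⊗ₜ[ℂ] G.gen i) := by
    rw [TensorProduct.smul_tmul', smul_eq_mul, mul_one]
  rw [h1, map_smul, hom_gen, TensorProduct.smul_tmul', smul_eq_mul]

theorem hom_one : G.hom S 1 = AlgHom.id S _ :=
  G.tensor_hom_ext fun i => by simp [hom_gen]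

theorem hom_mul (u u' : Sˣ) : G.hom S (u * u') = (G.hom S u').comp (G.hom S u) :=
  G.tensor_hom_ext fun i => by
    rw [AlgHom.comp_apply, hom_gen, hom_gen, hom_tmul_gen, mul_zpow, Units.val_mul]

theorem hom_natural {S' : Type} [CommRing S'] [Algebra ℂ S'] (h : S →ₐ[ℂ] S') (u : Sˣ) (r : R) :
    Algebra.TensorProduct.map h (AlgHom.id ℂ R) (G.hom S u (1 ⊗ₜ r)) =
      G.hom S' (Units.map h u) (1 ⊗ₜ r) := by
  have := G.hom_ext (f := ((Algebra.TensorProduct.map h (AlgHom.id ℂ R)).comp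
      ((G.hom S u).restrictScalars ℂ)).comp Algebra.TensorProduct.includeRight)
    (g := ((G.hom S' (Units.map h u)).restrictScalars ℂ).comp Algebra.TensorProduct.includeRight)
    (fun i => by
      simp only [AlgHom.comp_apply, Algebra.TensorProduct.includeRight_apply,
        AlgHom.restrictScalars_apply, hom_gen, Algebra.TensorProduct.map_tmul, AlgHom.id_apply]
      rw [← map_zpow]
      rfl)
  exact congrArg (fun k => k r) this

/-- The family of automorphisms of the base changes of `Spec R`. -/
def specFamily (p : Spec (CommRingCat.of R) ⟶ SpecC)
    (hp : p = Spec.map (CommRingCat.ofHom (algebraMap ℂ R))) : UnitAutFamily p where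
  XS S _ _ := Spec (CommRingCat.of (S ⊗[ℂ] R))
  pr S _ _ := Spec.map (CommRingCat.ofHom
    (Algebra.TensorProduct.includeRight : R →ₐ[ℂ] S ⊗[ℂ] R).toRingHom)
  q S _ _ := Spec.map (CommRingCat.ofHom (algebraMap S (S ⊗[ℂ] R)))
  isPullback S _ _ := by
    subst hp
    exact (isPullback_SpecMap_of_isPushout _ _ _ _
      (CommRingCat.isPushout_tensorProduct ℂ S R)).flip
  α S _ _ u := Spec.map (CommRingCat.ofHom (G.hom S u).toRingHom)
  α_q S _ _ u := by
    rw [← Spec.map_comp, ← CommRingCat.ofHom_comp]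
    congr 2
    ext s
    exact (G.hom S u).commutes s
  α_one S _ _ := by
    rw [hom_one]
    exact Spec.map_id _
  α_mul S _ _ u u' := by
    rw [← Spec.map_comp, ← CommRingCat.ofHom_comp, hom_mul]
    rfl
  natural S S' _ _ _ _ h := by
    refine ⟨Spec.map (CommRingCat.ofHom
      (Algebra.TensorProduct.map h (AlgHom.id ℂ R)).toRingHom), ?_, ?_, fun u => ?_⟩
    · rw [← Spec.map_comp, ← CommRingCat.ofHom_comp]
      congr 2
      ext r
      simp
    · rw [← Spec.map_comp, ← CommRingCat.ofHom_comp, ← Spec.map_comp, ← CommRingCat.ofHom_comp]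
      congr 2
    · simp only [← Spec.map_comp, ← CommRingCat.ofHom_comp]
      congr 2
      ext r
      exact G.hom_natural h u r

/-- The morphism `Spec R ⟶ 𝔸¹` is equivariant if the pullback of the coordinate `t` is a generator
of weight `-1`. -/
theorem specFamily_equivariant (p : Spec (CommRingCat.of R) ⟶ SpecC)
    (hp : p = Spec.map (CommRingCat.ofHom (algebraMap ℂ R))) (φ : Polynomial ℂ →+* R)
    (i₀ : G.ι) (h₀ : G.gen i₀ = φ Polynomial.X) (hw : G.wt i₀ = -1)
    (S : Type) [CommRing S] [Algebra ℂ S] (u : Sˣ) :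
    let F := G.specFamily p hp
    A1coord (F.α S u ≫ F.pr S ≫ Spec.map (CommRingCat.ofHom φ)) =
        (F.q S).appTop.hom ((Scheme.ΓSpecIso (CommRingCat.of S)).inv.hom ((u⁻¹ : Sˣ) : S)) *
          A1coord (F.pr S ≫ Spec.map (CommRingCat.ofHom φ)) := by
  intro F
  have hA : ∀ ψ : Polynomial ℂ →+* S ⊗[ℂ] R, A1coord (Spec.map (CommRingCat.ofHom ψ)) =
      (Scheme.ΓSpecIso (CommRingCat.of (S ⊗[ℂ] R))).inv.hom (ψ Polynomial.X) := fun ψ =>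
    ΓSpecIso_inv_appTop ψ _
  have hq : (F.q S).appTop.hom ((Scheme.ΓSpecIso (CommRingCat.of S)).inv.hom ((u⁻¹ : Sˣ) : S)) =
      (Scheme.ΓSpecIso (CommRingCat.of (S ⊗[ℂ] R))).inv.hom (algebraMap S _ ((u⁻¹ : Sˣ) : S)) :=
    ΓSpecIso_inv_appTop (algebraMap S (S ⊗[ℂ] R)) _
  have e1 : F.pr S ≫ Spec.map (CommRingCat.ofHom φ) = Spec.map (CommRingCat.ofHom
      ((Algebra.TensorProduct.includeRight : R →ₐ[ℂ] S ⊗[ℂ] R).toRingHom.comp φ)) := by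
    rw [CommRingCat.ofHom_comp, Spec.map_comp]
    rfl
  have e2 : F.α S u ≫ F.pr S ≫ Spec.map (CommRingCat.ofHom φ) = Spec.map (CommRingCat.ofHom
      ((G.hom S u).toRingHom.comp
        ((Algebra.TensorProduct.includeRight : R →ₐ[ℂ] S ⊗[ℂ] R).toRingHom.comp φ))) := by
    rw [CommRingCat.ofHom_comp, Spec.map_comp, ← e1]
    rfl
  refine (congrArg A1coord e2).trans ((hA _).trans (Eq.trans ?_
    (congrArg₂ (· * ·) hq ((congrArg A1coord e1).trans (hA _))).symm))
  refine Eq.trans ?_ (map_mul _ _ _)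
  congr 1
  change G.hom S u (1 ⊗ₜ φ Polynomial.X) = algebraMap S _ ((u⁻¹ : Sˣ) : S) * (1 ⊗ₜ φ Polynomial.X)
  rw [← h₀, hom_gen, hw, Algebra.TensorProduct.algebraMap_apply]
  simp

end WeightedGenerators

end Weights

/-! ### Torus actions on projective spectra -/

section ProjWeights

open AlgebraicGeometry CategoryTheory CategoryTheory.Limits HomogeneousLocalization

theorem projMap_congr {A B σ τ : Type} [CommRing A] [SetLike σ A] [AddSubgroupClass σ A]
    [CommRing B] [SetLike τ B] [AddSubgroupClass τ B]
    {𝒜 : ℕ → σ} {ℬ : ℕ → τ} [GradedRing 𝒜] [GradedRing ℬ] {f g : 𝒜 →+*ᵍ ℬ}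
    (hf : HomogeneousIdeal.irrelevant ℬ ≤ (HomogeneousIdeal.irrelevant 𝒜).map f)
    (hg : HomogeneousIdeal.irrelevant ℬ ≤ (HomogeneousIdeal.irrelevant 𝒜).map g)
    (h : ∀ x, f x = g x) : Proj.map f hf = Proj.map g hg := by
  obtain rfl : f = g := DFunLike.ext _ _ h
  rfl

theorem projTo_comp {A σ : Type} [CommRing A] [SetLike σ A] [AddSubgroupClass σ A]
    {𝒜 : ℕ → σ} [GradedRing 𝒜] {R S : Type} [CommRing R] [CommRing S] (φ : S →+* 𝒜 0)
    (h : R →+* S) :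
    projTo 𝒜 φ ≫ Spec.map (CommRingCat.ofHom h) = projTo 𝒜 (φ.comp h) := by
  rw [projTo, projTo, Category.assoc, ← Spec.map_comp, ← CommRingCat.ofHom_comp]

theorem projTo_appTop {A σ : Type} [CommRing A] [SetLike σ A] [AddSubgroupClass σ A]
    {𝒜 : ℕ → σ} [GradedRing 𝒜] {R : Type} [CommRing R] (φ : R →+* 𝒜 0) (r : R) :
    (projTo 𝒜 φ).appTop.hom ((Scheme.ΓSpecIso (CommRingCat.of R)).inv.hom r) =
      (Proj.toSpecZero 𝒜).appTop.hom
        ((Scheme.ΓSpecIso (CommRingCat.of (𝒜 0))).inv.hom (φ r)) := by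
  rw [projTo, Scheme.Hom.comp_appTop, CommRingCat.hom_comp, RingHom.comp_apply,
    ΓSpecIso_inv_appTop]

variable {R : Type} [CommRing R] [Algebra ℂ R] (𝒜 : ℕ → Submodule ℂ R)

section Tensor

variable (S : Type) [CommRing S] [Algebra ℂ S]

theorem mem_span_of_mem_baseChange {n : ℕ} {y : S ⊗[ℂ] R} (hy : y ∈ (𝒜 n).baseChange S)
    (I : Ideal (S ⊗[ℂ] R)) (h : ∀ a ∈ 𝒜 n, 1 ⊗ₜ a ∈ I) : y ∈ I := by
  rw [Submodule.baseChange_eq_span] at hy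
  induction hy using Submodule.span_induction with
  | mem x hx =>
    obtain ⟨a, ha, rfl⟩ := hx
    exact h a ha
  | zero => exact zero_mem _
  | add x y _ _ hx hy => exact add_mem hx hy
  | smul c x _ hx =>
    rw [Algebra.smul_def]
    exact Ideal.mul_mem_left _ _ hx

variable [GradedAlgebra 𝒜]

theorem tensorIncl_irrelevant :
    HomogeneousIdeal.irrelevant (fun n => (𝒜 n).baseChange S) ≤
      (HomogeneousIdeal.irrelevant 𝒜).map (tensorIncl 𝒜 S) :=
  irrelevant_le_map _ fun _ _ _ hy => mem_span_of_mem_baseChange 𝒜 S hy _ fun a ha =>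
    Ideal.subset_span ⟨a, ha, rfl⟩

variable {S} in
/-- The homomorphism of graded rings `S ⊗ R → S' ⊗ R` given by a homomorphism `S → S'`. -/
def tensorMapLeft {S' : Type} [CommRing S'] [Algebra ℂ S'] (h : S →ₐ[ℂ] S') :
    (fun n => (𝒜 n).baseChange S) →+*ᵍ (fun n => (𝒜 n).baseChange S') where
  toRingHom := (Algebra.TensorProduct.map h (AlgHom.id ℂ R)).toRingHom
  map_mem {n} x hx := by
    change (Algebra.TensorProduct.map h (AlgHom.id ℂ R)) x ∈ _
    rw [Submodule.baseChange_eq_span] at hx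
    induction hx using Submodule.span_induction with
    | mem x hx =>
      obtain ⟨a, ha, rfl⟩ := hx
      rw [TensorProduct.mk_apply, Algebra.TensorProduct.map_tmul]
      exact Submodule.tmul_mem_baseChange_of_mem _ ha
    | zero => simp
    | add x y _ _ hx hy =>
      rw [map_add]
      exact add_mem hx hy
    | smul c x _ hx =>
      have h1 : (Algebra.TensorProduct.map h (AlgHom.id ℂ R)) (c • x) =
          h c • (Algebra.TensorProduct.map h (AlgHom.id ℂ R)) x := by
        rw [Algebra.smul_def, map_mul, Algebra.smul_def]
        congr 1
      rw [h1]
      exact Submodule.smul_mem _ _ hx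

variable {S} in
theorem tensorMapLeft_irrelevant {S' : Type} [CommRing S'] [Algebra ℂ S'] (h : S →ₐ[ℂ] S') :
    HomogeneousIdeal.irrelevant (fun n => (𝒜 n).baseChange S') ≤
      (HomogeneousIdeal.irrelevant (fun n => (𝒜 n).baseChange S)).map (tensorMapLeft 𝒜 h) :=
  irrelevant_le_map _ fun _ _ _ hy => mem_span_of_mem_baseChange 𝒜 S' hy _ fun a ha =>
    Ideal.subset_span ⟨1 ⊗ₜ a, Submodule.tmul_mem_baseChange_of_mem _ ha, by
      change (Algebra.TensorProduct.map h (AlgHom.id ℂ R)) _ = _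
      simp⟩

end Tensor

variable [GradedAlgebra 𝒜]

namespace WeightedGenerators

variable (G : WeightedGenerators R) (S : Type) [CommRing S] [Algebra ℂ S]

/-- If the generators are homogeneous, the coaction respects the grading. -/
theorem hom_decompose_mem (hG : ∀ i, ∃ d, G.gen i ∈ 𝒜 d) (u : Sˣ) (a : R) (n : ℕ) :
    G.hom S u (1 ⊗ₜ (DirectSum.decompose 𝒜 a n : R)) ∈ (𝒜 n).baseChange S := by
  have ha : a ∈ Algebra.adjoin ℂ (Set.range G.gen) := by
    rw [G.adjoin_gen]
    trivial
  induction ha using Algebra.adjoin_induction generalizing n with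
  | mem x hx =>
    obtain ⟨i, rfl⟩ := hx
    obtain ⟨d, hd⟩ := hG i
    by_cases h : d = n
    · subst h
      rw [DirectSum.decompose_of_mem_same _ hd, hom_gen]
      exact Submodule.tmul_mem_baseChange_of_mem _ hd
    · rw [DirectSum.decompose_of_mem_ne _ hd h, TensorProduct.tmul_zero, map_zero]
      exact zero_mem _
  | algebraMap c =>
    have hd : algebraMap ℂ R c ∈ 𝒜 0 := SetLike.algebraMap_mem_graded 𝒜 c
    by_cases h : 0 = n
    · subst h
      have e : (1 : S) ⊗ₜ[ℂ] algebraMap ℂ R c = algebraMap S (S ⊗[ℂ] R) (algebraMap ℂ S c) := by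
        rw [Algebra.TensorProduct.algebraMap_apply, Algebra.algebraMap_eq_smul_one,
          Algebra.algebraMap_eq_smul_one, TensorProduct.tmul_smul, TensorProduct.smul_tmul',
          smul_eq_mul, mul_one, Algebra.algebraMap_eq_smul_one]
      rw [DirectSum.decompose_of_mem_same _ hd, e, AlgHom.commutes, ← e]
      exact Submodule.tmul_mem_baseChange_of_mem _ hd
    · rw [DirectSum.decompose_of_mem_ne _ hd h, TensorProduct.tmul_zero, map_zero]
      exact zero_mem _
  | add x y _ _ hx hy =>
    rw [DirectSum.decompose_add, DirectSum.add_apply, Submodule.coe_add, TensorProduct.tmul_add,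
      map_add]
    exact add_mem (hx n) (hy n)
  | mul x y _ _ hx hy =>
    rw [DirectSum.decompose_mul, DirectSum.coe_mul_apply_eq_sum_antidiagonal,
      TensorProduct.tmul_sum, map_sum]
    refine sum_mem fun ij hij => ?_
    have h1 : (1 : S) ⊗ₜ[ℂ]
        ((DirectSum.decompose 𝒜 x ij.1 : R) * (DirectSum.decompose 𝒜 y ij.2 : R)) =
        (1 ⊗ₜ (DirectSum.decompose 𝒜 x ij.1 : R)) * (1 ⊗ₜ (DirectSum.decompose 𝒜 y ij.2 : R)) := by
      simp
    rw [h1, map_mul, ← Finset.HasAntidiagonal.mem_antidiagonal.1 hij]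
    exact SetLike.mul_mem_graded (A := fun n => (𝒜 n).baseChange S) (hx _) (hy _)

variable (hG : ∀ i, ∃ d, G.gen i ∈ 𝒜 d)

/-- The automorphism `G.hom S u` of the graded ring `S ⊗ R`. -/
def gradedHom (u : Sˣ) :
    (fun n => (𝒜 n).baseChange S) →+*ᵍ (fun n => (𝒜 n).baseChange S) where
  toRingHom := (G.hom S u).toRingHom
  map_mem {n} x hx := by
    change G.hom S u x ∈ _
    rw [Submodule.baseChange_eq_span] at hx
    induction hx using Submodule.span_induction with
    | mem x hx =>
      obtain ⟨a, ha, rfl⟩ := hx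
      have := G.hom_decompose_mem 𝒜 S hG u a n
      rwa [DirectSum.decompose_of_mem_same _ ha] at this
    | zero => simp
    | add x y _ _ hx hy =>
      rw [map_add]
      exact add_mem hx hy
    | smul c x _ hx =>
      rw [map_smul]
      exact Submodule.smul_mem _ _ hx

theorem gradedHom_apply (u : Sˣ) (x : S ⊗[ℂ] R) : G.gradedHom 𝒜 S hG u x = G.hom S u x := rfl

theorem gradedHom_irrelevant (u : Sˣ) :
    HomogeneousIdeal.irrelevant (fun n => (𝒜 n).baseChange S) ≤
      (HomogeneousIdeal.irrelevant (fun n => (𝒜 n).baseChange S)).map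
        (G.gradedHom 𝒜 S hG u) := by
  refine irrelevant_le_map _ fun n _ y hy => Ideal.subset_span
    ⟨G.gradedHom 𝒜 S hG u⁻¹ y, (G.gradedHom 𝒜 S hG u⁻¹).map_mem hy, ?_⟩
  rw [gradedHom_apply, gradedHom_apply, ← AlgHom.comp_apply, ← hom_mul, inv_mul_cancel, hom_one]
  rfl

/-- The family of automorphisms of the base changes of `Proj 𝒜`. -/
def projFamily : UnitAutFamily (projTo 𝒜 (algebraMap ℂ (𝒜 0))) where
  XS S _ _ := Proj (fun n => (𝒜 n).baseChange S)
  pr S _ _ := Proj.map (tensorIncl 𝒜 S) (tensorIncl_irrelevant 𝒜 S)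
  q S _ _ := projTo (fun n => (𝒜 n).baseChange S) (algebraMap S ((𝒜 0).baseChange S))
  isPullback S _ _ := isPullback_projMap _ _ _ _ _ fun _ _ _ hs =>
    isPushout_away_tensor 𝒜 S hs
  α S _ _ u := Proj.map (G.gradedHom 𝒜 S hG u) (G.gradedHom_irrelevant 𝒜 S hG u)
  α_q S _ _ u := projMap_projTo _ _ _ _ fun s => (G.hom S u).commutes s
  α_one S _ _ := by
    rw [← Proj.map_id]
    refine projMap_congr _ _ fun x => ?_
    rw [gradedHom_apply, hom_one]
    rfl
  α_mul S _ _ u u' := by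
    rw [← Proj.map_comp]
    refine projMap_congr _ _ fun x => ?_
    rw [gradedHom_apply, hom_mul]
    rfl
  natural S S' _ _ _ _ h := by
    refine ⟨Proj.map (tensorMapLeft 𝒜 h) (tensorMapLeft_irrelevant 𝒜 h), ?_, ?_, fun u => ?_⟩
    · rw [← Proj.map_comp]
      refine projMap_congr _ _ fun x => ?_
      change Algebra.TensorProduct.map h (AlgHom.id ℂ R) (1 ⊗ₜ x) = 1 ⊗ₜ x
      simp
    · rw [projTo_comp]
      refine projMap_projTo _ _ _ _ fun s => ?_
      change Algebra.TensorProduct.map h (AlgHom.id ℂ R) (algebraMap S (S ⊗[ℂ] R) s) =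
        algebraMap S' (S' ⊗[ℂ] R) (h s)
      simp [Algebra.TensorProduct.algebraMap_apply]
    · rw [← Proj.map_comp, ← Proj.map_comp, ← Proj.map_comp]
      refine projMap_congr _ _ fun x => ?_
      exact G.hom_natural h u x

/-- The morphism `Proj 𝒜 ⟶ 𝔸¹` is equivariant if the pullback of the coordinate `t` is a generator
of weight `-1`. -/
theorem projFamily_equivariant (φ : Polynomial ℂ →+* 𝒜 0)
    (i₀ : G.ι) (h₀ : G.gen i₀ = φ Polynomial.X) (hw : G.wt i₀ = -1) (u : Sˣ) :
    let F := G.projFamily 𝒜 hG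
    A1coord (F.α S u ≫ F.pr S ≫ projTo 𝒜 φ) =
        (F.q S).appTop.hom ((Scheme.ΓSpecIso (CommRingCat.of S)).inv.hom ((u⁻¹ : Sˣ) : S)) *
          A1coord (F.pr S ≫ projTo 𝒜 φ) := by
  intro F
  let ℬ : ℕ → Submodule S (S ⊗[ℂ] R) := fun n => (𝒜 n).baseChange S
  let ι₁ : Polynomial ℂ →+* ℬ 0 :=
    { toFun := fun r => ⟨1 ⊗ₜ (φ r : R), Submodule.tmul_mem_baseChange_of_mem _ (φ r).2⟩
      map_one' := by ext; simp [Algebra.TensorProduct.one_def]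
      map_zero' := by ext; simp
      map_add' := fun x y => by ext; simp [TensorProduct.tmul_add]
      map_mul' := fun x y => by ext; simp }
  let ι₂ : Polynomial ℂ →+* ℬ 0 :=
    { toFun := fun r => ⟨G.hom S u (1 ⊗ₜ (φ r : R)), (G.gradedHom 𝒜 S hG u).map_mem (ι₁ r).2⟩
      map_one' := by ext; simp [← Algebra.TensorProduct.one_def]
      map_zero' := by ext; simp
      map_add' := fun x y => by ext; simp [TensorProduct.tmul_add]
      map_mul' := fun x y => Subtype.ext ((congrArg (G.hom S u)
        (congrArg Subtype.val (ι₁.map_mul x y))).trans (map_mul (G.hom S u) _ _)) }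
  have e1 : F.pr S ≫ projTo 𝒜 φ = projTo ℬ ι₁ := projMap_projTo _ _ _ _ fun r => rfl
  have e2 : F.α S u ≫ projTo ℬ ι₁ = projTo ℬ ι₂ := projMap_projTo _ _ _ _ fun r => rfl
  have e3 : ι₂ Polynomial.X = algebraMap S (ℬ 0) ((u⁻¹ : Sˣ) : S) * ι₁ Polynomial.X := by
    refine Subtype.ext ?_
    change G.hom S u (1 ⊗ₜ (φ Polynomial.X : R)) =
      algebraMap S (S ⊗[ℂ] R) ((u⁻¹ : Sˣ) : S) * (1 ⊗ₜ (φ Polynomial.X : R))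
    rw [← h₀, hom_gen, hw, Algebra.TensorProduct.algebraMap_apply]
    simp
  have e4 : F.α S u ≫ F.pr S ≫ projTo 𝒜 φ = projTo ℬ ι₂ :=
    (congrArg (F.α S u ≫ ·) e1).trans e2
  refine (congrArg A1coord e4).trans ((projTo_appTop ι₂ _).trans (Eq.trans ?_
    (congrArg₂ (fun a b : Γ(Proj ℬ, ⊤) => a * b)
      (projTo_appTop (𝒜 := ℬ) (algebraMap S (ℬ 0)) _)
      ((congrArg A1coord e1).trans (projTo_appTop ι₁ _))).symm))
  rw [e3, map_mul, map_mul]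

end WeightedGenerators

end ProjWeights

/-! ### Flat degenerations from graded algebras over the affine line -/

section GradedDegenerations

open AlgebraicGeometry CategoryTheory CategoryTheory.Limits HomogeneousLocalization

/-- The spectrum of a `ℂ`-algebra as a `ℂ`-scheme. -/
def specOver (B : Type) [CommRing B] [Algebra ℂ B] : Over SpecC :=
  Over.mk (Spec.map (CommRingCat.ofHom (algebraMap ℂ B)))

/-- The projective spectrum of a graded `ℂ`-algebra as a `ℂ`-scheme. -/
def projOver {B : Type} [CommRing B] [Algebra ℂ B] (ℬ : ℕ → Submodule ℂ B) [GradedAlgebra ℬ] :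
    Over SpecC :=
  Over.mk (projTo ℬ (algebraMap ℂ (ℬ 0)))

theorem nonempty_fibreAt_iso {X Y : Scheme.{0}} {π : X ⟶ A1} {a : ℂ} {f : Y ⟶ X} {p : Y ⟶ SpecC}
    (h : IsPullback f p π (A1pt a)) : Nonempty (fibreAt π a ≅ Over.mk p) :=
  ⟨(Over.isoMk h.isoPullback h.isoPullback_hom_snd).symm⟩

variable {R : Type} [CommRing R] [Algebra ℂ R] {𝒜 : ℕ → Submodule ℂ R} [GradedAlgebra 𝒜]
  (φ : Polynomial ℂ →ₐ[ℂ] 𝒜 0)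

/-- A graded algebra over `ℂ[t]` (via `φ`) specializes at `t = a` to the graded algebra `ℬ`. -/
def IsGradedFibre (a : ℂ) {B : Type} [CommRing B] [Algebra ℂ B] (ℬ : ℕ → Submodule ℂ B)
    [GradedAlgebra ℬ] : Prop :=
  ∃ g : 𝒜 →+*ᵍ ℬ, (∀ r, g (φ r : R) = algebraMap ℂ B (r.eval a)) ∧
    (∀ n, ∀ y ∈ ℬ n, ∃ x ∈ 𝒜 n, g x = y) ∧
    ∀ x, g x = 0 → ∃ x', x = (φ (Polynomial.X - Polynomial.C a) : R) * x'

variable {φ} {a : ℂ} {B : Type} [CommRing B] [Algebra ℂ B] {ℬ : ℕ → Submodule ℂ B}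
    [GradedAlgebra ℬ]

/-- The specialization at `t = a` computes the fibre of the spectrum. -/
theorem IsGradedFibre.spec (h : IsGradedFibre φ a ℬ) :
    Nonempty (fibreAt (Spec.map (CommRingCat.ofHom
      ((algebraMap (𝒜 0) R).comp (φ : Polynomial ℂ →+* 𝒜 0)))) a ≅ specOver B) := by
  obtain ⟨g, h1, h2, h3⟩ := h
  refine nonempty_fibreAt_iso (f := Spec.map (CommRingCat.ofHom (g : R →+* B))) ?_
  refine isPullback_SpecMap_of_isPushout _ _ _ _ (isPushout_of_surjective _ _ _ _ ?_ ?_ ?_ ?_)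
  · ext r
    · simpa using h1 (Polynomial.C r)
    · simpa using h1 Polynomial.X
  · exact fun c => ⟨Polynomial.C c, by simp⟩
  · intro y
    classical
    induction y using DirectSum.Decomposition.inductionOn ℬ with
    | zero => exact ⟨0, map_zero _⟩
    | homogeneous m =>
      obtain ⟨x, -, hx⟩ := h2 _ _ m.2
      exact ⟨x, hx⟩
    | add m m' hm hm' =>
      obtain ⟨x, hx⟩ := hm
      obtain ⟨x', hx'⟩ := hm'
      exact ⟨x + x', by rw [map_add, hx, hx']⟩
  · intro x hx
    obtain ⟨x', rfl⟩ := h3 x hx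
    refine Ideal.mul_mem_right _ _ (Ideal.mem_map_of_mem
      ((algebraMap (𝒜 0) R).comp (φ : Polynomial ℂ →+* 𝒜 0)) ?_)
    simp [RingHom.mem_ker]

/-- The specialization at `t = a` computes the fibre of the projective spectrum. -/
theorem IsGradedFibre.proj (h : IsGradedFibre φ a ℬ) :
    Nonempty (fibreAt (projTo 𝒜 (φ : Polynomial ℂ →+* 𝒜 0)) a ≅ projOver ℬ) := by
  obtain ⟨g, h1, h2, h3⟩ := h
  have hirr : HomogeneousIdeal.irrelevant ℬ ≤ (HomogeneousIdeal.irrelevant 𝒜).map g :=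
    irrelevant_le_map _ fun n _ y hy => by
      obtain ⟨x, hx, rfl⟩ := h2 n y hy
      exact Ideal.subset_span ⟨x, hx, rfl⟩
  refine nonempty_fibreAt_iso (f := Proj.map g hirr) ?_
  refine isPullback_projMap _ _ _ _ _ fun _ _ _ hs =>
    isPushout_away_of_surjective g _ _ _ ?_ ?_ h2 (Polynomial.X - Polynomial.C a) (by simp) h3 hs
  · exact fun c => ⟨Polynomial.C c, by simp⟩
  · intro r
    exact h1 r

/-- A domain over `ℂ[t]` with a torus coaction of weight `-1` on `t` gives a flat degeneration with
affine total space between its fibres. -/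
theorem hasAffineFlatDegeneration_of_isGradedFibre [IsDomain R] [Algebra.FiniteType ℂ R]
    (hφ : Function.Injective φ) (G : WeightedGenerators R)
    (i₀ : G.ι) (h₀ : G.gen i₀ = φ Polynomial.X) (hw : G.wt i₀ = -1) {Y Y₀ : Over SpecC}
    (hY : ∀ a : ℂ, a ≠ 0 → Nonempty (fibreAt (Spec.map (CommRingCat.ofHom
      ((algebraMap (𝒜 0) R).comp (φ : Polynomial ℂ →+* 𝒜 0)))) a ≅ Y))
    (hY₀ : Nonempty (fibreAt (Spec.map (CommRingCat.ofHom
      ((algebraMap (𝒜 0) R).comp (φ : Polynomial ℂ →+* 𝒜 0)))) 0 ≅ Y₀)) :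
    HasAffineFlatDegeneration Y Y₀ := by
  let Φ : Polynomial ℂ →+* R := (algebraMap (𝒜 0) R).comp (φ : Polynomial ℂ →+* 𝒜 0)
  have hΦ : Function.Injective Φ := Subtype.val_injective.comp hφ
  have hC : Φ.comp Polynomial.C = algebraMap ℂ R := by
    ext c
    exact congrArg Subtype.val (φ.commutes c)
  let π : Spec (CommRingCat.of R) ⟶ A1 := Spec.map (CommRingCat.ofHom Φ)
  have hp : π ≫ A1toC = Spec.map (CommRingCat.ofHom (algebraMap ℂ R)) := by
    rw [← hC, CommRingCat.ofHom_comp, Spec.map_comp]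
    rfl
  let F := G.specFamily (π ≫ A1toC) hp
  refine ⟨{ X := Spec (CommRingCat.of R)
            π := π
            integral := inferInstance
            separated := inferInstance
            finiteType := ?_
            quasiCompact := inferInstance
            flat := ?_
            fibre_ne_zero := hY
            fibre_zero := hY₀
            action := F.gmAction
            equivariant := fun u x => F.equivariant π (fun S _ _ u =>
              G.specFamily_equivariant _ hp Φ i₀ h₀ hw S u) u x }, ?_⟩
  · rw [HasRingHomProperty.Spec_iff (P := @LocallyOfFiniteType)]
    have : (Φ.comp Polynomial.C).FiniteType := by
      rw [hC]
      exact RingHom.finiteType_algebraMap.2 inferInstance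
    exact RingHom.FiniteType.of_comp_finiteType this
  · rw [Flat.SpecMap_iff]
    let : Algebra (Polynomial ℂ) R := Φ.toAlgebra
    change Module.Flat (Polynomial ℂ) R
    rw [Module.Flat.flat_iff_torsion_eq_bot_of_isBezout,
      ← Submodule.isTorsionFree_iff_torsion_eq_bot]
    exact Module.isTorsionFree_iff_algebraMap_injective.2 hΦ
  · change IsAffine (Spec _)
    infer_instance

/-- The projective version: it is proper over the affine line because `𝒜₀ = ℂ[t]` and `R` is of
finite type. -/
theorem hasProperFlatDegeneration_of_isGradedFibre [IsDomain R] [Algebra.FiniteType ℂ R]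
    (hφ : Function.Bijective φ) (G : WeightedGenerators R) (hG : ∀ i, ∃ d, G.gen i ∈ 𝒜 d)
    (i₀ : G.ι) (h₀ : G.gen i₀ = φ Polynomial.X) (hw : G.wt i₀ = -1)
    {d : ℕ} (hd : 0 < d) {s : R} (hs : s ∈ 𝒜 d) (hs0 : s ≠ 0) {Y Y₀ : Over SpecC}
    (hY : ∀ a : ℂ, a ≠ 0 →
      Nonempty (fibreAt (projTo 𝒜 (φ : Polynomial ℂ →+* 𝒜 0)) a ≅ Y))
    (hY₀ : Nonempty (fibreAt (projTo 𝒜 (φ : Polynomial ℂ →+* 𝒜 0)) 0 ≅ Y₀)) :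
    HasProperFlatDegeneration Y Y₀ := by
  let Φ : Polynomial ℂ →+* 𝒜 0 := φ
  let π : Proj 𝒜 ⟶ A1 := projTo 𝒜 Φ
  have hp : π ≫ A1toC = projTo 𝒜 (algebraMap ℂ (𝒜 0)) := by
    change projTo 𝒜 Φ ≫ Spec.map _ = _
    rw [projTo_comp]
    congr 1
    ext c
    exact congrArg Subtype.val (φ.commutes c)
  have hproper : IsProper π := by
    have : IsScalarTower ℂ (𝒜 0) R := ⟨fun c x y => smul_mul_assoc c (x : R) y⟩
    have : Algebra.FiniteType (𝒜 0) R := Algebra.FiniteType.of_restrictScalars_finiteType ℂ _ _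
    have h1 : IsIso (Spec.map (CommRingCat.ofHom Φ)) := by
      have : IsIso (CommRingCat.ofHom Φ) :=
        (RingEquiv.ofBijective Φ hφ).toCommRingCatIso.isIso_hom
      infer_instance
    change IsProper (Proj.toSpecZero 𝒜 ≫ Spec.map _)
    infer_instance
  have hact : ∀ p : Proj 𝒜 ⟶ SpecC, p = projTo 𝒜 (algebraMap ℂ (𝒜 0)) →
      ∃ act : GmAction (Over.mk p), ∀ {T : Over SpecC} (u : Γ(T.left, ⊤)ˣ) (x : T ⟶ Over.mk p),
        A1coord ((act.act u x).left ≫ π) = ((u⁻¹ : Γ(T.left, ⊤)ˣ) : Γ(T.left, ⊤)) *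
          A1coord (x.left ≫ π) := by
    rintro _ rfl
    let F := G.projFamily 𝒜 hG
    exact ⟨F.gmAction, fun u x => F.equivariant π (fun S _ _ u =>
      G.projFamily_equivariant 𝒜 S hG Φ i₀ h₀ hw u) u x⟩
  obtain ⟨act, hact⟩ := hact _ hp
  exact ⟨{ X := Proj 𝒜
           π := π
           integral := isIntegral_proj hd hs hs0
           separated := inferInstance
           finiteType := inferInstance
           quasiCompact := inferInstance
           flat := flat_projTo Φ hφ.1
           fibre_ne_zero := hY
           fibre_zero := hY₀
           action := act
           equivariant := hact }, hproper⟩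

end GradedDegenerations

/-! ### The graded algebra generated by a space of polynomials -/

section ConeAlgebra

variable {k P : Type} [CommRing k] [CommRing P] [Algebra k P]

/-- The graded algebra `⨁ₙ Aⁿ zⁿ ⊆ P[z]` of a linear subspace `A` of an algebra `P`. -/
def coneAlg (A : Submodule k P) : Subalgebra k (Polynomial P) where
  carrier := {p | ∀ n, p.coeff n ∈ A ^ n}
  mul_mem' {p q} hp hq n := by
    rw [Polynomial.coeff_mul]
    refine sum_mem fun ij hij => ?_
    rw [← Finset.HasAntidiagonal.mem_antidiagonal.1 hij, pow_add]
    exact Submodule.mul_mem_mul (hp _) (hq _)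
  add_mem' hp hq n := by
    rw [Polynomial.coeff_add]
    exact add_mem (hp n) (hq n)
  algebraMap_mem' r n := by
    rw [Polynomial.algebraMap_apply, Polynomial.coeff_C]
    split_ifs with h
    · rw [h, pow_zero]
      exact Submodule.algebraMap_mem r
    · exact zero_mem _

theorem monomial_mem_coneAlg {A : Submodule k P} {n : ℕ} {a : P} (ha : a ∈ A ^ n) :
    Polynomial.monomial n a ∈ coneAlg A := fun m => by
  rw [Polynomial.coeff_monomial]
  split_ifs with h
  · exact h ▸ ha
  · exact zero_mem _

/-- The algebra `⨁ₙ Aⁿ zⁿ` is generated by its component of degree one. -/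
theorem coneAlg_le_adjoin {ι : Type*} (F : ι → P) :
    coneAlg (Submodule.span k (Set.range F)) ≤
      Algebra.adjoin k (Set.range fun j => Polynomial.monomial 1 (F j)) := by
  intro p hp
  have key : ∀ n, ∀ a ∈ Submodule.span k (Set.range F) ^ n, Polynomial.monomial n a ∈
      Algebra.adjoin k (Set.range fun j => Polynomial.monomial 1 (F j)) := by
    intro n
    induction n with
    | zero =>
      intro a ha
      rw [pow_zero] at ha
      obtain ⟨r, rfl⟩ := Submodule.mem_one.1 ha
      exact Subalgebra.algebraMap_mem _ r
    | succ n ih =>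
      intro a ha
      rw [pow_succ] at ha
      induction ha using Submodule.mul_induction_on' with
      | mem_mul_mem x hx y hy =>
        rw [← Polynomial.monomial_mul_monomial]
        refine mul_mem (ih x hx) ?_
        induction hy using Submodule.span_induction with
        | mem y hy =>
          obtain ⟨j, rfl⟩ := hy
          exact Algebra.subset_adjoin ⟨j, rfl⟩
        | zero => simp
        | add y y' _ _ hy hy' =>
          rw [map_add]
          exact add_mem hy hy'
        | smul c y _ hy =>
          rw [← Polynomial.smul_monomial]
          exact Subalgebra.smul_mem _ hy c
      | add x _ y _ hx hy =>
        rw [map_add]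
        exact add_mem hx hy
  rw [← Polynomial.sum_monomial_eq p]
  exact sum_mem fun n _ => key n _ (hp n)

section MapPow

variable {k' P' : Type} [CommRing k'] [CommRing P'] [Algebra k' P']
  {A : Submodule k P} {A' : Submodule k' P'} (h : k →+* k') (τ : P →+* P')

theorem map_mem_pow (hτ : ∀ r, τ (algebraMap k P r) = algebraMap k' P' (h r))
    (h1 : ∀ x ∈ A, τ x ∈ A') (n : ℕ) (x : P) (hx : x ∈ A ^ n) :
    τ x ∈ A' ^ n := by
  induction n generalizing x with
  | zero =>
    rw [pow_zero] at hx ⊢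
    obtain ⟨r, rfl⟩ := Submodule.mem_one.1 hx
    rw [hτ]
    exact Submodule.algebraMap_mem _
  | succ n ih =>
    rw [pow_succ] at hx ⊢
    induction hx using Submodule.mul_induction_on' with
    | mem_mul_mem x hx y hy =>
      rw [map_mul]
      exact Submodule.mul_mem_mul (ih x hx) (h1 y hy)
    | add x _ y _ hx hy =>
      rw [map_add]
      exact add_mem hx hy

theorem exists_mem_pow (hτ : ∀ r, τ (algebraMap k P r) = algebraMap k' P' (h r))
    (hh : Function.Surjective h) (h2 : ∀ y ∈ A', ∃ x ∈ A, τ x = y) (n : ℕ)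
    (y : P') (hy : y ∈ A' ^ n) : ∃ x ∈ A ^ n, τ x = y := by
  induction n generalizing y with
  | zero =>
    rw [pow_zero] at hy
    obtain ⟨r, rfl⟩ := Submodule.mem_one.1 hy
    obtain ⟨r, rfl⟩ := hh r
    exact ⟨algebraMap k P r, by rw [pow_zero]; exact Submodule.algebraMap_mem _, hτ r⟩
  | succ n ih =>
    rw [pow_succ] at hy
    induction hy using Submodule.mul_induction_on' with
    | mem_mul_mem x hx y hy =>
      obtain ⟨x', hx', rfl⟩ := ih x hx
      obtain ⟨y', hy', rfl⟩ := h2 y hy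
      exact ⟨x' * y', by rw [pow_succ]; exact Submodule.mul_mem_mul hx' hy', map_mul _ _ _⟩
    | add x _ y _ hx hy =>
      obtain ⟨x', hx', rfl⟩ := hx
      obtain ⟨y', hy', rfl⟩ := hy
      exact ⟨x' + y', add_mem hx' hy', map_add _ _ _⟩

end MapPow

variable [Algebra ℂ k] [Algebra ℂ P] [IsScalarTower ℂ k P]

/-- The homogeneous components `Aⁿ zⁿ`, as complex vector spaces. -/
def coneDeg (A : Submodule k P) (n : ℕ) : Submodule ℂ (coneAlg A) where
  carrier := {p | ∀ m, m ≠ n → (p : Polynomial P).coeff m = 0}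
  add_mem' hp hq m hm := by
    rw [Subalgebra.coe_add, Polynomial.coeff_add, hp m hm, hq m hm, add_zero]
  zero_mem' _ _ := rfl
  smul_mem' c p hp m hm := by
    change (c • (p : Polynomial P)).coeff m = 0
    rw [Polynomial.coeff_smul, hp m hm, smul_zero]

theorem mk_monomial_mem_coneDeg {A : Submodule k P} {n : ℕ} {a : P} (ha : a ∈ A ^ n) :
    (⟨Polynomial.monomial n a, monomial_mem_coneAlg ha⟩ : coneAlg A) ∈ coneDeg A n :=
  fun _ hm => Polynomial.coeff_monomial_of_ne _ hm

theorem eq_monomial_of_mem_coneDeg {A : Submodule k P} {n : ℕ} {p : coneAlg A}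
    (hp : p ∈ coneDeg A n) :
    (p : Polynomial P) = Polynomial.monomial n ((p : Polynomial P).coeff n) := by
  ext m
  rw [Polynomial.coeff_monomial]
  split_ifs with h
  · rw [h]
  · exact hp m (Ne.symm h)

theorem coneDeg_isInternal (A : Submodule k P) : DirectSum.IsInternal (coneDeg A) := by
  classical
  constructor
  · have key : ∀ (x : ⨁ n, coneDeg A n) (n : ℕ),
        (DirectSum.coeAddMonoidHom (coneDeg A) x : Polynomial P).coeff n =
          ((x n : coneAlg A) : Polynomial P).coeff n := by
      intro x n
      rw [DirectSum.coeAddMonoidHom_eq_dfinsuppSum, DFinsupp.sum]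
      simp only [AddSubmonoidClass.coe_finsetSum, Polynomial.finsetSum_coeff]
      rw [Finset.sum_eq_single n]
      · intro j _ hj
        exact (x j).2 n hj.symm
      · intro h
        rw [DFinsupp.notMem_support_iff.1 h]
        rfl
    intro x y hxy
    refine DFinsupp.ext fun n => Subtype.ext (Subtype.ext (Polynomial.ext fun m => ?_))
    by_cases hm : m = n
    · subst hm
      rw [← key, hxy, key]
    · rw [(x n).2 m hm, (y n).2 m hm]
  · intro p
    refine ⟨∑ n ∈ (p : Polynomial P).support, DirectSum.of (fun n => coneDeg A n) n
      ⟨_, mk_monomial_mem_coneDeg (p.2 n)⟩, Subtype.ext ?_⟩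
    rw [map_sum]
    simp only [DirectSum.coeAddMonoidHom_of, AddSubmonoidClass.coe_finsetSum]
    exact Polynomial.sum_monomial_eq (p : Polynomial P)

/-- The algebra `⨁ₙ Aⁿ zⁿ` is graded by the powers of `z`. -/
instance coneGraded (A : Submodule k P) : GradedAlgebra (coneDeg A) where
  one_mem m hm := by
    change (1 : Polynomial P).coeff m = 0
    rw [Polynomial.coeff_one, if_neg hm]
  mul_mem := by
    intro i j p q hp hq m hm
    rw [Subalgebra.coe_mul, eq_monomial_of_mem_coneDeg hp, eq_monomial_of_mem_coneDeg hq,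
      Polynomial.monomial_mul_monomial]
    exact Polynomial.coeff_monomial_of_ne _ hm
  toDecomposition := (coneDeg_isInternal A).chooseDecomposition

/-- The structure map from the ground ring to the component of degree zero. -/
def coneZero (A : Submodule k P) : k →ₐ[ℂ] coneDeg A 0 where
  toFun r := ⟨algebraMap k (coneAlg A) r, fun m hm => by
    change (algebraMap k (Polynomial P) r).coeff m = 0
    rw [Polynomial.algebraMap_apply, Polynomial.coeff_C, if_neg hm]⟩
  map_one' := Subtype.ext (map_one _)
  map_zero' := Subtype.ext (map_zero _)
  map_add' _ _ := Subtype.ext (map_add _ _ _)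
  map_mul' _ _ := Subtype.ext (map_mul _ _ _)
  commutes' c := Subtype.ext (IsScalarTower.algebraMap_apply ℂ k (coneAlg A) c).symm

theorem coneZero_apply (A : Submodule k P) (r : k) :
    (coneZero A r : coneAlg A) = algebraMap k (coneAlg A) r := rfl

theorem coneZero_bijective (A : Submodule k P) (h : Function.Injective (algebraMap k P)) :
    Function.Bijective (coneZero A) := by
  constructor
  · intro r r' hr
    have h1 := congrArg (fun x : coneDeg A 0 => ((x : coneAlg A) : Polynomial P).coeff 0) hr
    simp only [coneZero_apply] at h1
    change (algebraMap k (Polynomial P) r).coeff 0 = (algebraMap k (Polynomial P) r').coeff 0 at h1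
    rw [Polynomial.algebraMap_apply, Polynomial.algebraMap_apply, Polynomial.coeff_C_zero,
      Polynomial.coeff_C_zero] at h1
    exact h h1
  · intro x
    have h1 := (x : coneAlg A).2 0
    rw [pow_zero] at h1
    obtain ⟨r, hr⟩ := Submodule.mem_one.1 h1
    refine ⟨r, Subtype.ext (Subtype.ext ?_)⟩
    rw [eq_monomial_of_mem_coneDeg x.2, ← hr]
    rfl

section Map

variable {k' P' : Type} [CommRing k'] [CommRing P'] [Algebra k' P']
  {A : Submodule k P} {A' : Submodule k' P'} (h : k →+* k') (τ : P →+* P')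
  (hτ : ∀ r, τ (algebraMap k P r) = algebraMap k' P' (h r))

variable [Algebra ℂ k'] [Algebra ℂ P'] [IsScalarTower ℂ k' P']

/-- A homomorphism `τ : P → P'` carrying `A` into `A'` induces a homomorphism of graded rings
`⨁ Aⁿ zⁿ → ⨁ A'ⁿ zⁿ`. -/
def coneMap (h1 : ∀ x ∈ A, τ x ∈ A') : coneDeg A →+*ᵍ coneDeg A' where
  toRingHom := ((Polynomial.mapRingHom τ).comp (coneAlg A).val.toRingHom).codRestrict
    (coneAlg A') fun p n => by
      change (Polynomial.map τ p).coeff n ∈ A' ^ n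
      rw [Polynomial.coeff_map]
      exact map_mem_pow h τ hτ h1 n _ (p.2 n)
  map_mem {n} p hp m hm := by
    change (Polynomial.map τ p).coeff m = 0
    rw [Polynomial.coeff_map, hp m hm, map_zero]

theorem coe_coneMap (h1 : ∀ x ∈ A, τ x ∈ A') (p : coneAlg A) :
    (coneMap h τ hτ h1 p : Polynomial P') = Polynomial.map τ p := rfl

end Map

/-- The fibres of `⨁ Ãⁿ zⁿ` over `ℂ[t]`: a specialization `τ` of the coefficient algebra at
`t = a` carrying `Ã` onto `A` and with kernel `(t - a) Ãⁿ` on each `Ãⁿ`. -/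
theorem isGradedFibre_cone {Pt P : Type} [CommRing Pt] [Algebra (Polynomial ℂ) Pt] [Algebra ℂ Pt]
    [IsScalarTower ℂ (Polynomial ℂ) Pt] [CommRing P] [Algebra ℂ P]
    {At : Submodule (Polynomial ℂ) Pt} {A : Submodule ℂ P} (a : ℂ) (τ : Pt →+* P)
    (hτ : ∀ r, τ (algebraMap (Polynomial ℂ) Pt r) = algebraMap ℂ P (r.eval a))
    (h1 : ∀ x ∈ At, τ x ∈ A) (h2 : ∀ y ∈ A, ∃ x ∈ At, τ x = y)
    (h3 : ∀ n, ∀ x ∈ At ^ n, τ x = 0 →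
      ∃ x' ∈ At ^ n, x = (Polynomial.X - Polynomial.C a : Polynomial ℂ) • x') :
    IsGradedFibre (coneZero At) a (coneDeg A) := by
  have hτ' : ∀ r, τ (algebraMap (Polynomial ℂ) Pt r) =
      algebraMap ℂ P (Polynomial.evalRingHom a r) := hτ
  refine ⟨coneMap (Polynomial.evalRingHom a) τ hτ' h1, fun r => Subtype.ext ?_, ?_, ?_⟩
  · rw [coe_coneMap, coneZero_apply]
    change Polynomial.map τ (algebraMap (Polynomial ℂ) (Polynomial Pt) r) =
      algebraMap ℂ (Polynomial P) (r.eval a)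
    rw [Polynomial.algebraMap_apply, Polynomial.map_C, hτ, Polynomial.algebraMap_apply]
  · intro n y hy
    obtain ⟨x, hx, hxy⟩ := exists_mem_pow (Polynomial.evalRingHom a) τ hτ'
      (fun c => ⟨Polynomial.C c, by simp⟩) h2 n _ (y.2 n)
    refine ⟨_, mk_monomial_mem_coneDeg hx, Subtype.ext ?_⟩
    rw [coe_coneMap, eq_monomial_of_mem_coneDeg hy, Polynomial.map_monomial, hxy]
  · intro p hp
    have hp' : ∀ n, τ ((p : Polynomial Pt).coeff n) = 0 := fun n => by
      rw [← Polynomial.coeff_map, ← coe_coneMap (Polynomial.evalRingHom a) τ hτ' h1, hp]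
      rfl
    choose q hq hq' using fun n => h3 n _ (p.2 n) (hp' n)
    refine ⟨⟨∑ n ∈ (p : Polynomial Pt).support, Polynomial.monomial n (q n),
      sum_mem fun n _ => monomial_mem_coneAlg (hq n)⟩, Subtype.ext ?_⟩
    rw [coneZero_apply, ← Algebra.smul_def]
    change (p : Polynomial Pt) = _ • ∑ n ∈ (p : Polynomial Pt).support, Polynomial.monomial n (q n)
    rw [Finset.smul_sum]
    simp_rw [Polynomial.smul_monomial, ← hq']
    exact (Polynomial.sum_monomial_eq _).symm

end ConeAlgebra

/-! ### Specialization of the powers of a family of initial forms -/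

section Specialization

variable {N : ℕ}

/-- The polynomial functions on `ℂ^N`. -/
abbrev Pol (N : ℕ) : Type := MvPolynomial (Fin N) ℂ

/-- The polynomial functions on `ℂ^N` with coefficients depending on the parameter `t`. -/
abbrev PolT (N : ℕ) : Type := MvPolynomial (Fin N) (Polynomial ℂ)

/-- The substitution `xᵢ ↦ t^{ωᵢ} xᵢ`. -/
def weightHom (ω : Fin N → ℕ) : Pol N →ₐ[ℂ] PolT N :=
  MvPolynomial.aeval fun i => (Polynomial.X ^ ω i : Polynomial ℂ) • MvPolynomial.X i

/-- The specialization of the parameter at `t = a`. -/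
def evT (a : ℂ) : PolT N →+* Pol N := MvPolynomial.map (Polynomial.evalRingHom a)

/-- The substitution `xᵢ ↦ cᵢ xᵢ`. -/
def scaleHom (c : Fin N → ℂ) : Pol N →ₐ[ℂ] Pol N :=
  MvPolynomial.aeval fun i => c i • MvPolynomial.X i

theorem evT_algebraMap (a : ℂ) (r : Polynomial ℂ) :
    evT a (algebraMap (Polynomial ℂ) (PolT N) r) = algebraMap ℂ (Pol N) (r.eval a) := by
  rw [evT, MvPolynomial.algebraMap_eq, MvPolynomial.map_C]
  rfl

theorem evT_weightHom (ω : Fin N → ℕ) (a : ℂ) (f : Pol N) :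
    evT a (weightHom ω f) = scaleHom (fun i => a ^ ω i) f := by
  have h : (evT a).comp (weightHom ω : Pol N →+* PolT N) =
      (scaleHom (fun i => a ^ ω i) : Pol N →+* Pol N) := by
    refine MvPolynomial.ringHom_ext (fun c => ?_) (fun i => ?_)
    · simp [weightHom, scaleHom, evT]
    · simp [weightHom, scaleHom, evT, MvPolynomial.smul_eq_C_mul]
  exact congrArg (fun k => k f) h

theorem scaleHom_inv (c : Fin N → ℂ) (hc : ∀ i, c i ≠ 0) (f : Pol N) :
    scaleHom (fun i => (c i)⁻¹) (scaleHom c f) = f := by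
  have h : (scaleHom (fun i => (c i)⁻¹)).comp (scaleHom c) = AlgHom.id ℂ (Pol N) := by
    refine MvPolynomial.algHom_ext fun i => ?_
    simp [scaleHom, smul_smul, hc i]
  exact congrArg (fun k => k f) h

theorem map_smul_of_algebraMap {a : ℂ} {τ : PolT N →+* Pol N}
    (hτ : ∀ r, τ (algebraMap (Polynomial ℂ) (PolT N) r) = algebraMap ℂ (Pol N) (r.eval a))
    (r : Polynomial ℂ) (G : PolT N) : τ (r • G) = r.eval a • τ G := by
  rw [Algebra.smul_def, map_mul, hτ, ← Algebra.smul_def]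

theorem X_pow_smul_injective (n : ℕ) :
    Function.Injective fun G : PolT N => (Polynomial.X ^ n : Polynomial ℂ) • G :=
  smul_right_injective _ (pow_ne_zero n Polynomial.X_ne_zero)

theorem complex_smul_eq (c : ℂ) (G : PolT N) : c • G = Polynomial.C c • G := by
  rw [← Polynomial.algebraMap_eq, algebraMap_smul]

/-- If the specializations at `t = 0` of the `G e` are linearly independent, a combination
`∑ cₑ t^{mₑ} Gₑ` is divisible by `t^n` only if all exponents that occur are at least `n`. -/
theorem le_of_sum_eq_pow_smul {E : Type*} (s : Finset E) {G : E → PolT N}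
    (hG : LinearIndependent ℂ fun e => evT 0 (G e)) (c : E → ℂ) (m : E → ℕ) (n : ℕ) (H : PolT N)
    (h : ∑ e ∈ s, c e • (Polynomial.X ^ m e : Polynomial ℂ) • G e =
      (Polynomial.X ^ n : Polynomial ℂ) • H) :
    ∀ e ∈ s, c e ≠ 0 → n ≤ m e := by
  by_contra! hcon
  obtain ⟨e, he, hce, hme⟩ := hcon
  -- Divide by the lowest power of `t` that occurs and specialize at `t = 0`.
  obtain ⟨e₀, he₀, hmin⟩ := (s.filter fun e => c e ≠ 0).exists_min_image m
    ⟨e, Finset.mem_filter.2 ⟨he, hce⟩⟩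
  rw [Finset.mem_filter] at he₀
  have hlt : m e₀ < n := (hmin e (Finset.mem_filter.2 ⟨he, hce⟩)).trans_lt hme
  have h1 : ∑ e ∈ s, c e • (Polynomial.X ^ (m e - m e₀) : Polynomial ℂ) • G e =
      (Polynomial.X ^ (n - m e₀) : Polynomial ℂ) • H := by
    apply X_pow_smul_injective (m e₀)
    simp only
    rw [smul_smul, ← pow_add, Nat.add_sub_of_le hlt.le, ← h, Finset.smul_sum]
    refine Finset.sum_congr rfl fun e he => ?_
    by_cases hc : c e = 0
    · simp [hc]
    · rw [smul_comm, smul_smul, ← pow_add,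
        Nat.add_sub_of_le (hmin e (Finset.mem_filter.2 ⟨he, hc⟩))]
  have h2 := congrArg (evT 0) h1
  simp only [map_sum, complex_smul_eq, map_smul_of_algebraMap (evT_algebraMap (N := N) 0),
    Polynomial.eval_pow, Polynomial.eval_X, smul_smul] at h2
  rw [zero_pow (by omega), zero_smul] at h2
  have h3 := linearIndependent_iff'.1 hG s _ h2 e₀ he₀.1
  simp only [Nat.sub_self, pow_zero, mul_one, Polynomial.eval_C] at h3
  exact he₀.2 h3

section Frame

variable (ω : Fin N → ℕ) {ι : Type} {F : ι → PolT N} {f : ι → Pol N} {m : ι → ℕ}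
  {A : Submodule ℂ (Pol N)}

/-- Products of `n` of the `F j` are, up to powers of `t`, the substitution `xᵢ ↦ t^{ωᵢ} xᵢ`
applied to elements of `Aⁿ`. -/
theorem exists_weightHom_eq (hf : ∀ j, f j ∈ A)
    (hF : ∀ j, (Polynomial.X ^ m j : Polynomial ℂ) • F j = weightHom ω (f j)) (n : ℕ) :
    ∀ G ∈ Set.range F ^ n, ∃ g ∈ A ^ n, ∃ k : ℕ,
      (Polynomial.X ^ k : Polynomial ℂ) • G = weightHom ω g := by
  induction n with
  | zero =>
    intro G hG
    rw [pow_zero, Set.mem_one] at hG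
    subst hG
    refine ⟨1, ?_, 0, by simp⟩
    rw [pow_zero]
    exact Submodule.one_le.1 le_rfl
  | succ n ih =>
    rintro _ ⟨G, hG, _, ⟨j, rfl⟩, rfl⟩
    obtain ⟨g, hg, k, hk⟩ := ih G hG
    refine ⟨g * f j, ?_, k + m j, ?_⟩
    · rw [pow_succ]
      exact Submodule.mul_mem_mul hg (hf j)
    · simp only
      rw [map_mul, ← hk, ← hF, smul_mul_smul_comm, pow_add]

/-- Bases of `Bⁿ` formed by products of the initial forms lift to linearly independent families
in `Aⁿ`. -/
theorem exists_lift [Finite ι] (hf : ∀ j, f j ∈ A)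
    (hF : ∀ j, (Polynomial.X ^ m j : Polynomial ℂ) • F j = weightHom ω (f j)) (n : ℕ) :
    ∃ (E : Type) (_ : Fintype E) (G : E → PolT N) (g : E → Pol N) (k : E → ℕ),
      (∀ e, G e ∈ Submodule.span (Polynomial ℂ) (Set.range F) ^ n) ∧ (∀ e, g e ∈ A ^ n) ∧
      (∀ e, (Polynomial.X ^ k e : Polynomial ℂ) • G e = weightHom ω (g e)) ∧
      LinearIndependent ℂ (fun e => evT 0 (G e)) ∧ LinearIndependent ℂ g ∧
      Module.finrank ℂ (Submodule.span ℂ (Set.range fun j => evT 0 (F j)) ^ n :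
        Submodule ℂ (Pol N)) = Fintype.card E := by
  have himg : (Set.range fun j => evT 0 (F j)) ^ n = evT 0 '' (Set.range F ^ n) := by
    rw [Set.image_pow, ← Set.range_comp]
    rfl
  obtain ⟨s, hs, hspan, hlin⟩ := exists_linearIndependent ℂ (evT 0 '' (Set.range F ^ n))
  have hpow : ∀ n : ℕ, (Set.range F ^ n).Finite := fun n => by
    induction n with
    | zero => simp
    | succ n ih => exact pow_succ (Set.range F) n ▸ ih.mul (Set.finite_range F)
  have hfin : s.Finite := ((hpow n).image _).subset hs
  have : Fintype s := hfin.fintype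
  choose G hG hGs using fun e : s => hs e.2
  choose g hg k hk using fun e => exists_weightHom_eq ω hf hF n (G e) (hG e)
  have hG0 : LinearIndependent ℂ fun e => evT 0 (G e) := by
    simpa only [hGs] using hlin
  refine ⟨s, this, G, g, k, fun e => ?_, hg, hk, hG0, ?_, ?_⟩
  · rw [Submodule.span_pow]
    exact Submodule.subset_span (hG e)
  · rw [linearIndependent_iff']
    intro t c hc e he
    by_contra hce
    have h1 := congrArg (weightHom ω) hc
    simp only [map_sum, map_smul, ← hk, map_zero] at h1
    have h2 := le_of_sum_eq_pow_smul t hG0 c k (k e + 1) 0 (by rw [h1, smul_zero]) e he hce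
    omega
  · rw [Submodule.span_pow, himg, ← hspan, finrank_span_set_eq_card hlin, Set.toFinset_card]

/-- If all `Aⁿ` and `Bⁿ` have the same dimensions, then the powers of the `ℂ[t]`-module spanned
by the `F j` are free, with bases that lift bases of `Bⁿ` and come from bases of `Aⁿ`. -/
theorem exists_frame [Finite ι] (hA : A.FG) (hf : ∀ j, f j ∈ A)
    (hF : ∀ j, (Polynomial.X ^ m j : Polynomial ℂ) • F j = weightHom ω (f j))
    (n : ℕ) (hdim : Module.finrank ℂ (A ^ n : Submodule ℂ (Pol N)) = Module.finrank ℂ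
      (Submodule.span ℂ (Set.range fun j => evT 0 (F j)) ^ n : Submodule ℂ (Pol N))) :
    ∃ (E : Type) (_ : Fintype E) (G : E → PolT N) (g : E → Pol N) (k : E → ℕ),
      (∀ e, G e ∈ Submodule.span (Polynomial ℂ) (Set.range F) ^ n) ∧
      (∀ e, (Polynomial.X ^ k e : Polynomial ℂ) • G e = weightHom ω (g e)) ∧
      LinearIndependent ℂ (fun e => evT 0 (G e)) ∧ LinearIndependent ℂ g ∧
      Submodule.span ℂ (Set.range g) = A ^ n ∧
      Submodule.span (Polynomial ℂ) (Set.range F) ^ n ≤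
        Submodule.span (Polynomial ℂ) (Set.range G) := by
  obtain ⟨E, hE, G, g, k, hG, hg, hk, hG0, hg0, hcard⟩ := exists_lift ω hf hF n
  have hAn : FiniteDimensional ℂ (A ^ n : Submodule ℂ (Pol N)) :=
    Module.Finite.iff_fg.2 (hA.pow n)
  have hgspan : Submodule.span ℂ (Set.range g) = A ^ n := by
    refine Submodule.eq_of_le_of_finrank_eq (Submodule.span_le.2 ?_) ?_
    · rintro _ ⟨e, rfl⟩
      exact hg e
    · rw [finrank_span_eq_card hg0, hdim, hcard]
  refine ⟨E, hE, G, g, k, hG, hk, hG0, hg0, hgspan, ?_⟩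
  rw [Submodule.span_pow, Submodule.span_le]
  intro H hH
  obtain ⟨h, hh, l, hl⟩ := exists_weightHom_eq ω hf hF n H hH
  rw [← hgspan, Submodule.mem_span_range_iff_exists_fun] at hh
  obtain ⟨c, rfl⟩ := hh
  simp only [map_sum, map_smul, ← hk] at hl
  have h1 := le_of_sum_eq_pow_smul Finset.univ hG0 c k l H hl.symm
  have h2 : H = ∑ e, c e • (Polynomial.X ^ (k e - l) : Polynomial ℂ) • G e := by
    apply X_pow_smul_injective l
    simp only
    rw [hl, Finset.smul_sum]
    refine Finset.sum_congr rfl fun e he => ?_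
    by_cases hc : c e = 0
    · simp [hc]
    · rw [smul_comm _ (c e), smul_smul, ← pow_add, Nat.add_sub_of_le (h1 e he hc)]
  rw [SetLike.mem_coe, h2]
  refine sum_mem fun e _ => ?_
  rw [complex_smul_eq]
  exact Submodule.smul_mem _ _ (Submodule.smul_mem _ _ (Submodule.subset_span ⟨e, rfl⟩))

/-- If generators of a `ℂ[t]`-module of polynomials stay linearly independent under the
specialization `τ` at `t = a`, the kernel of `τ` on the module consists of the multiples of `t -
a`. -/
theorem exists_smul_of_frame {a : ℂ} {τ : PolT N →+* Pol N}
    (hτ : ∀ r, τ (algebraMap (Polynomial ℂ) (PolT N) r) = algebraMap ℂ (Pol N) (r.eval a))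
    {E : Type} [Fintype E] {G : E → PolT N} (hlin : LinearIndependent ℂ fun e => τ (G e))
    {T : Submodule (Polynomial ℂ) (PolT N)} (hG : ∀ e, G e ∈ T)
    (hT : T ≤ Submodule.span (Polynomial ℂ) (Set.range G)) (x : PolT N) (hx : x ∈ T)
    (h0 : τ x = 0) :
    ∃ x' ∈ T, x = (Polynomial.X - Polynomial.C a : Polynomial ℂ) • x' := by
  obtain ⟨r, rfl⟩ := (Submodule.mem_span_range_iff_exists_fun _).1 (hT hx)
  simp only [map_sum, map_smul_of_algebraMap hτ] at h0
  have h1 : ∀ e, ∃ q, r e = (Polynomial.X - Polynomial.C a) * q := fun e =>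
    Polynomial.dvd_iff_isRoot.2 (linearIndependent_iff'.1 hlin Finset.univ _ h0 e
      (Finset.mem_univ e))
  choose q hq using h1
  refine ⟨∑ e, q e • G e, sum_mem fun e _ => Submodule.smul_mem _ _ (hG e), ?_⟩
  rw [Finset.smul_sum]
  refine Finset.sum_congr rfl fun e _ => ?_
  rw [hq, smul_smul]

variable [Finite ι] (hA : A.FG) (hf : ∀ j, f j ∈ A)
  (hF : ∀ j, (Polynomial.X ^ m j : Polynomial ℂ) • F j = weightHom ω (f j))
  (hdim : ∀ n, Module.finrank ℂ (A ^ n : Submodule ℂ (Pol N)) = Module.finrank ℂ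
      (Submodule.span ℂ (Set.range fun j => evT 0 (F j)) ^ n : Submodule ℂ (Pol N)))

include hA hf hF hdim

/-- The fibre over `t = 0` is the graded algebra of the space of initial forms. -/
theorem isGradedFibre_zero :
    IsGradedFibre (coneZero (Submodule.span (Polynomial ℂ) (Set.range F))) 0
      (coneDeg (Submodule.span ℂ (Set.range fun j => evT 0 (F j)))) := by
  refine isGradedFibre_cone 0 (evT 0) (evT_algebraMap 0) (fun x hx => ?_) (fun y hy => ?_)
    fun n x hx h0 => ?_
  · induction hx using Submodule.span_induction with
    | mem x hx =>
      obtain ⟨j, rfl⟩ := hx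
      exact Submodule.subset_span ⟨j, rfl⟩
    | zero => simp
    | add x y _ _ hx hy =>
      rw [map_add]
      exact add_mem hx hy
    | smul c x _ hx =>
      rw [map_smul_of_algebraMap (evT_algebraMap 0)]
      exact Submodule.smul_mem _ _ hx
  · induction hy using Submodule.span_induction with
    | mem x hx =>
      obtain ⟨j, rfl⟩ := hx
      exact ⟨F j, Submodule.subset_span ⟨j, rfl⟩, rfl⟩
    | zero => exact ⟨0, zero_mem _, map_zero _⟩
    | add x y _ _ hx hy =>
      obtain ⟨x', hx', rfl⟩ := hx
      obtain ⟨y', hy', rfl⟩ := hy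
      exact ⟨x' + y', add_mem hx' hy', map_add _ _ _⟩
    | smul c x _ hx =>
      obtain ⟨x', hx', rfl⟩ := hx
      refine ⟨Polynomial.C c • x', Submodule.smul_mem _ _ hx', ?_⟩
      rw [map_smul_of_algebraMap (evT_algebraMap 0), Polynomial.eval_C]
  · obtain ⟨E, _, G, g, k, hG, -, hlin, -, -, hT⟩ := exists_frame ω hA hf hF n (hdim n)
    exact exists_smul_of_frame (evT_algebraMap 0) hlin hG hT x hx h0

/-- The fibre over `t = a ≠ 0` is the graded algebra of `A`: the scaling `xᵢ ↦ a^{-ωᵢ} xᵢ` undoes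
the substitution. -/
theorem isGradedFibre_of_ne_zero {a : ℂ} (ha : a ≠ 0) :
    IsGradedFibre (coneZero (Submodule.span (Polynomial ℂ) (Set.range F))) a (coneDeg A) := by
  let τ : PolT N →+* Pol N :=
    (scaleHom (fun i => (a ^ ω i)⁻¹) : Pol N →+* Pol N).comp (evT a)
  have hτ : ∀ r, τ (algebraMap (Polynomial ℂ) (PolT N) r) =
      algebraMap ℂ (Pol N) (r.eval a) := fun r => by
    change scaleHom _ (evT a _) = _
    rw [evT_algebraMap, AlgHom.commutes]
  have hτ' : ∀ (k : ℕ) (G : PolT N) (g : Pol N),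
      (Polynomial.X ^ k : Polynomial ℂ) • G = weightHom ω g → τ G = (a ^ k)⁻¹ • g := by
    intro k G g h
    have h1 := congrArg τ h
    rw [map_smul_of_algebraMap hτ] at h1
    change _ = scaleHom _ (evT a (weightHom ω g)) at h1
    rw [evT_weightHom, scaleHom_inv _ fun i => pow_ne_zero _ ha] at h1
    rw [← h1, Polynomial.eval_pow, Polynomial.eval_X, smul_smul,
      inv_mul_cancel₀ (pow_ne_zero _ ha), one_smul]
  refine isGradedFibre_cone a τ hτ (fun x hx => ?_) (fun y hy => ?_) fun n x hx h0 => ?_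
  · induction hx using Submodule.span_induction with
    | mem x hx =>
      obtain ⟨j, rfl⟩ := hx
      rw [hτ' _ _ _ (hF j)]
      exact Submodule.smul_mem _ _ (hf j)
    | zero => simp
    | add x y _ _ hx hy =>
      rw [map_add]
      exact add_mem hx hy
    | smul c x _ hx =>
      rw [map_smul_of_algebraMap hτ]
      exact Submodule.smul_mem _ _ hx
  · obtain ⟨E, _, G, g, k, hG, hk, -, -, hspan, -⟩ := exists_frame ω hA hf hF 1 (hdim 1)
    rw [pow_one] at hspan
    simp only [pow_one] at hG
    rw [← hspan, Submodule.mem_span_range_iff_exists_fun] at hy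
    obtain ⟨c, rfl⟩ := hy
    refine ⟨∑ e, (Polynomial.C (c e) * Polynomial.X ^ k e) • G e,
      sum_mem fun e _ => Submodule.smul_mem _ _ (hG e), ?_⟩
    rw [map_sum]
    refine Finset.sum_congr rfl fun e _ => ?_
    rw [map_smul_of_algebraMap hτ, hτ' _ _ _ (hk e), smul_smul, Polynomial.eval_mul,
      Polynomial.eval_C, Polynomial.eval_pow, Polynomial.eval_X, mul_assoc,
      mul_inv_cancel₀ (pow_ne_zero _ ha), mul_one]
  · obtain ⟨E, _, G, g, k, hG, hk, -, hlin, -, hT⟩ := exists_frame ω hA hf hF n (hdim n)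
    refine exists_smul_of_frame hτ ?_ hG hT x hx h0
    have h1 := hlin.units_smul fun e => Units.mk0 (a ^ k e)⁻¹ (inv_ne_zero (pow_ne_zero _ ha))
    have h2 : (fun e => τ (G e)) =
        (fun e => Units.mk0 (a ^ k e)⁻¹ (inv_ne_zero (pow_ne_zero _ ha))) • g :=
      funext fun e => hτ' _ _ _ (hk e)
    rw [h2]
    exact h1

end Frame

end Specialization

/-! ### Degeneration of a space of polynomials to a space of initial forms -/

section TorusWeights

variable {N : ℕ} (ω : Fin N → ℕ) (S : Type) [CommRing S] [Algebra ℂ S] (u : Sˣ)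

/-- The coaction on `ℂ[t][x][z]` of weight `-1` on `t`, weight `ωᵢ` on `xᵢ` and weight `0`
on `z`. -/
def torusHom : Polynomial (PolT N) →ₐ[ℂ] S ⊗[ℂ] Polynomial (PolT N) where
  __ := Polynomial.eval₂RingHom
    (MvPolynomial.eval₂Hom
      (Polynomial.aeval (((u⁻¹ : Sˣ) : S) ⊗ₜ[ℂ] algebraMap (Polynomial ℂ) (Polynomial (PolT N))
        Polynomial.X) : Polynomial ℂ →ₐ[ℂ] S ⊗[ℂ] Polynomial (PolT N)).toRingHom
      fun i => ((u ^ ω i : Sˣ) : S) ⊗ₜ[ℂ] Polynomial.C (MvPolynomial.X i))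
    ((1 : S) ⊗ₜ[ℂ] Polynomial.X)
  commutes' c := by
    have h : algebraMap ℂ (Polynomial (PolT N)) c =
      Polynomial.C (MvPolynomial.C (Polynomial.C c)) := rfl
    simp [h]

theorem torusHom_X : torusHom ω S u Polynomial.X = 1 ⊗ₜ Polynomial.X := by
  change Polynomial.eval₂RingHom _ _ Polynomial.X = _
  simp

theorem torusHom_C_X (i : Fin N) : torusHom ω S u (Polynomial.C (MvPolynomial.X i)) =
    ((u ^ ω i : Sˣ) : S) ⊗ₜ Polynomial.C (MvPolynomial.X i) := by
  change Polynomial.eval₂RingHom _ _ _ = _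
  simp

theorem torusHom_t : torusHom ω S u (algebraMap (Polynomial ℂ) (Polynomial (PolT N))
    Polynomial.X) = ((u⁻¹ : Sˣ) : S) ⊗ₜ algebraMap (Polynomial ℂ) (Polynomial (PolT N))
      Polynomial.X := by
  change Polynomial.eval₂RingHom _ _ (Polynomial.C (MvPolynomial.C Polynomial.X)) = _
  simp

/-- The elements `f (t^{ω₁} x₁, …)` are invariant, because the weights of `t^{ωᵢ}` and `xᵢ`
cancel. -/
theorem torusHom_weightHom (f : Pol N) :
    torusHom ω S u (Polynomial.C (weightHom ω f)) = 1 ⊗ₜ Polynomial.C (weightHom ω f) := by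
  have h : ((torusHom ω S u).comp (Algebra.ofId (PolT N) (Polynomial (PolT N))
      |>.restrictScalars ℂ)).comp (weightHom ω) =
      ((Algebra.TensorProduct.includeRight :
        Polynomial (PolT N) →ₐ[ℂ] S ⊗[ℂ] Polynomial (PolT N)).comp
        (Algebra.ofId (PolT N) (Polynomial (PolT N)) |>.restrictScalars ℂ)).comp
        (weightHom ω) := by
    refine MvPolynomial.algHom_ext fun i => ?_
    have h1 : Algebra.ofId (PolT N) (Polynomial (PolT N)) (weightHom ω (MvPolynomial.X i)) =
        algebraMap (Polynomial ℂ) (Polynomial (PolT N)) Polynomial.X ^ ω i *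
          Polynomial.C (MvPolynomial.X i) := by
      rw [weightHom, MvPolynomial.aeval_X, ← map_pow, ← Algebra.smul_def, Algebra.ofId_apply,
        Polynomial.algebraMap_eq, Polynomial.smul_C]
    simp only [AlgHom.comp_apply, AlgHom.restrictScalars_apply, h1, map_mul, map_pow, torusHom_t,
      torusHom_C_X, Algebra.TensorProduct.includeRight_apply]
    simp only [Algebra.TensorProduct.tmul_pow, Algebra.TensorProduct.tmul_mul_tmul, one_pow,
      one_mul]
    congr 1
    rw [← Units.val_pow_eq_pow_val, ← Units.val_mul, inv_pow, inv_mul_cancel, Units.val_one]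
  exact congrArg (fun k => k f) h

/-- If `t^m F` is invariant, then `F` has weight `m`. -/
theorem torusHom_of_eq {F : PolT N} {f : Pol N} {m : ℕ}
    (hF : (Polynomial.X ^ m : Polynomial ℂ) • F = weightHom ω f) :
    torusHom ω S u (Polynomial.C F) = ((u ^ m : Sˣ) : S) ⊗ₜ Polynomial.C F := by
  let t : Polynomial (PolT N) := algebraMap (Polynomial ℂ) (Polynomial (PolT N)) Polynomial.X
  have ht : Polynomial.C (weightHom ω f) = t ^ m * Polynomial.C F := by
    rw [← hF, ← map_pow, ← Algebra.smul_def, Polynomial.smul_C]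
  have h1 := torusHom_weightHom ω S u f
  rw [ht, map_mul, map_pow, torusHom_t, Algebra.TensorProduct.tmul_pow] at h1
  have hinj : Function.Injective
      ((LinearMap.mulLeft ℂ (t ^ m)).lTensor S : S ⊗[ℂ] Polynomial (PolT N) →ₗ[ℂ] _) := by
    refine Module.Flat.lTensor_preserves_injective_linearMap _ ?_
    have ht0 : t ^ m ≠ 0 := by
      refine pow_ne_zero _ ?_
      change Polynomial.C (MvPolynomial.C Polynomial.X) ≠ 0
      simp
    exact mul_right_injective₀ ht0
  have hmul : ∀ y, (LinearMap.mulLeft ℂ (t ^ m)).lTensor S y = (1 : S) ⊗ₜ[ℂ] (t ^ m) * y := by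
    intro y
    induction y using TensorProduct.induction_on with
    | zero => simp
    | tmul a b => simp
    | add a b ha hb => rw [map_add, ha, hb, mul_add]
  apply hinj
  rw [hmul, hmul]
  have h2 := congrArg (((u ^ m : Sˣ) : S) ⊗ₜ[ℂ] (1 : Polynomial (PolT N)) * ·) h1
  simp only [← mul_assoc] at h2
  rw [Algebra.TensorProduct.tmul_mul_tmul, Algebra.TensorProduct.tmul_mul_tmul,
    ← Units.val_pow_eq_pow_val, ← Units.val_mul, inv_pow, mul_inv_cancel, Units.val_one, one_mul,
    mul_one] at h2
  rw [h2, Algebra.TensorProduct.tmul_mul_tmul]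
  simp only [one_mul]

end TorusWeights

section ConeWeights

variable {N : ℕ} (ω : Fin N → ℕ) {ι : Type} {F : ι → PolT N} {f : ι → Pol N} {m : ι → ℕ}
  (hF : ∀ j, (Polynomial.X ^ m j : Polynomial ℂ) • F j = weightHom ω (f j))

variable (F) in
/-- The generators `t` and `F j z` of the algebra `⨁ Ãⁿ zⁿ`. -/
def coneGen : Option ι → coneAlg (Submodule.span (Polynomial ℂ) (Set.range F))
  | none => algebraMap (Polynomial ℂ) _ Polynomial.X
  | some j => ⟨Polynomial.monomial 1 (F j), monomial_mem_coneAlg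
      (by rw [pow_one]; exact Submodule.subset_span ⟨j, rfl⟩)⟩

variable (F) in
theorem adjoin_coneGen : Algebra.adjoin ℂ (Set.range (coneGen F)) = ⊤ := by
  let R := coneAlg (Submodule.span (Polynomial ℂ) (Set.range F))
  have key : ∀ p ∈ Algebra.adjoin (Polynomial ℂ) (Set.range fun j => Polynomial.monomial 1 (F j)),
      ∃ q ∈ Algebra.adjoin ℂ (Set.range (coneGen F)), (q : Polynomial (PolT N)) = p := by
    intro p hp
    induction hp using Algebra.adjoin_induction with
    | mem x hx =>
      obtain ⟨j, rfl⟩ := hx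
      exact ⟨coneGen F (some j), Algebra.subset_adjoin ⟨some j, rfl⟩, rfl⟩
    | algebraMap r =>
      refine ⟨algebraMap (Polynomial ℂ) R r, ?_, rfl⟩
      have h1 : algebraMap (Polynomial ℂ) R r =
          Polynomial.aeval (algebraMap (Polynomial ℂ) R Polynomial.X) r := by
        have := Polynomial.aeval_algebraMap_apply R (Polynomial.X : Polynomial ℂ) r
        rw [this, Polynomial.aeval_X_left_apply]
      rw [h1]
      have h2 : {algebraMap (Polynomial ℂ) R Polynomial.X} ⊆ Set.range (coneGen F) :=
        Set.singleton_subset_iff.2 ⟨none, rfl⟩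
      exact Algebra.adjoin_mono h2 (Polynomial.aeval_mem_adjoin_singleton ℂ _)
    | add x y _ _ hx hy =>
      obtain ⟨x', hx', rfl⟩ := hx
      obtain ⟨y', hy', rfl⟩ := hy
      exact ⟨x' + y', add_mem hx' hy', rfl⟩
    | mul x y _ _ hx hy =>
      obtain ⟨x', hx', rfl⟩ := hx
      obtain ⟨y', hy', rfl⟩ := hy
      exact ⟨x' * y', mul_mem hx' hy', rfl⟩
  refine eq_top_iff.2 fun p _ => ?_
  obtain ⟨q, hq, h⟩ := key p (coneAlg_le_adjoin F p.2)
  rwa [← Subtype.ext h]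

include hF in
/-- The coaction on `ℂ[t][x][z]` restricts to the subalgebra `⨁ Ãⁿ zⁿ`, whose base change is a
subalgebra by flatness. -/
theorem exists_coneHom (S : Type) [CommRing S] [Algebra ℂ S] (u : Sˣ) :
    ∃ α : coneAlg (Submodule.span (Polynomial ℂ) (Set.range F)) →ₐ[ℂ]
      S ⊗[ℂ] coneAlg (Submodule.span (Polynomial ℂ) (Set.range F)),
    ∀ i : Option ι, α (coneGen F i) =
      ((u ^ (i.elim (-1) fun j => (m j : ℤ)) : Sˣ) : S) ⊗ₜ coneGen F i := by
  let R := coneAlg (Submodule.span (Polynomial ℂ) (Set.range F))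
  let v : R →ₐ[ℂ] Polynomial (PolT N) := R.val.restrictScalars ℂ
  let κ : S ⊗[ℂ] R →ₐ[ℂ] S ⊗[ℂ] Polynomial (PolT N) :=
    Algebra.TensorProduct.map (AlgHom.id ℂ S) v
  have hκ : Function.Injective κ := by
    have h1 : Function.Injective (v.toLinearMap.lTensor S) :=
      Module.Flat.lTensor_preserves_injective_linearMap _ Subtype.val_injective
    exact h1
  let θ := (torusHom ω S u).comp v
  have hgen : ∀ i : Option ι, θ (coneGen F i) =
      κ (((u ^ (i.elim (-1) fun j => (m j : ℤ)) : Sˣ) : S) ⊗ₜ coneGen F i) := by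
    intro i
    change torusHom ω S u (coneGen F i : Polynomial (PolT N)) = _
    rw [Algebra.TensorProduct.map_tmul]
    cases i with
    | none =>
      change torusHom ω S u (algebraMap (Polynomial ℂ) (Polynomial (PolT N)) Polynomial.X) = _
      rw [torusHom_t, Option.elim_none, zpow_neg_one]
      rfl
    | some j =>
      change torusHom ω S u (Polynomial.monomial 1 (F j)) =
        ((u ^ (m j : ℤ) : Sˣ) : S) ⊗ₜ Polynomial.monomial 1 (F j)
      rw [← Polynomial.C_mul_X_eq_monomial, map_mul, torusHom_X, torusHom_of_eq ω S u (hF j),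
        Algebra.TensorProduct.tmul_mul_tmul, mul_one, zpow_natCast]
  have hθ : ∀ x, θ x ∈ κ.range := by
    intro x
    have hx : x ∈ Algebra.adjoin ℂ (Set.range (coneGen F)) := by
      rw [adjoin_coneGen]
      trivial
    have hle : Algebra.adjoin ℂ (Set.range (coneGen F)) ≤ κ.range.comap θ := by
      refine Algebra.adjoin_le ?_
      rintro _ ⟨i, rfl⟩
      exact ⟨_, (hgen i).symm⟩
    exact hle hx
  refine ⟨((AlgEquiv.ofInjective κ hκ).symm : κ.range →ₐ[ℂ] _).comp (θ.codRestrict _ hθ),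
    fun i => hκ ?_⟩
  rw [← hgen]
  have h1 := AlgEquiv.ofInjective_apply κ hκ
    ((AlgEquiv.ofInjective κ hκ).symm (θ.codRestrict _ hθ (coneGen F i)))
  rw [AlgEquiv.apply_symm_apply] at h1
  exact h1.symm

/-- The torus action on the spectrum of `⨁ Ãⁿ zⁿ`: `t` has weight `-1` and `F j z` has
weight `m j`. -/
def coneWeights : WeightedGenerators (coneAlg (Submodule.span (Polynomial ℂ) (Set.range F))) where
  ι := Option ι
  gen := coneGen F
  wt i := i.elim (-1) fun j => (m j : ℤ)
  adjoin_gen := adjoin_coneGen F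
  exists_hom S _ _ u := exists_coneHom ω hF S u

theorem coneGen_mem (i : Option ι) : ∃ d, coneGen F i ∈
    coneDeg (Submodule.span (Polynomial ℂ) (Set.range F)) d := by
  cases i with
  | none => exact ⟨0, (coneZero _ Polynomial.X).2⟩
  | some j => exact ⟨1, mk_monomial_mem_coneDeg
      (by rw [pow_one]; exact Submodule.subset_span ⟨j, rfl⟩)⟩

end ConeWeights

section Degeneration

open AlgebraicGeometry CategoryTheory

theorem IsGradedFibre.trans {R : Type} [CommRing R] [Algebra ℂ R] {𝒜 : ℕ → Submodule ℂ R}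
    [GradedAlgebra 𝒜] {φ : Polynomial ℂ →ₐ[ℂ] 𝒜 0} {a : ℂ} {B B' : Type} [CommRing B]
    [Algebra ℂ B] {ℬ : ℕ → Submodule ℂ B} [GradedAlgebra ℬ] [CommRing B'] [Algebra ℂ B']
    {ℬ' : ℕ → Submodule ℂ B'} [GradedAlgebra ℬ'] (h : IsGradedFibre φ a ℬ) (e : B ≃ₐ[ℂ] B')
    (he : ∀ n x, x ∈ ℬ n ↔ e x ∈ ℬ' n) : IsGradedFibre φ a ℬ' := by
  obtain ⟨g, h1, h2, h3⟩ := h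
  refine ⟨{ toRingHom := (e : B →+* B').comp (g : R →+* B)
            map_mem := fun hx => (he _ _).1 (g.map_mem hx) }, fun r => ?_, fun n y hy => ?_,
    fun x hx => ?_⟩
  · exact (congrArg e (h1 r)).trans (e.commutes _)
  · obtain ⟨x, hx, hxy⟩ := h2 n (e.symm y) ((he _ _).2 (by rwa [e.apply_symm_apply]))
    exact ⟨x, hx, (congrArg e hxy).trans (e.apply_symm_apply y)⟩
  · exact h3 x (e.injective (Eq.trans hx (map_zero e).symm))

variable {N : ℕ} (ω : Fin N → ℕ) {ι : Type} [Finite ι] {F : ι → PolT N} {f : ι → Pol N}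
  {m : ι → ℕ} {A B : Submodule ℂ (Pol N)} (hA : A.FG) (hf : ∀ j, f j ∈ A)
  (hF : ∀ j, (Polynomial.X ^ m j : Polynomial ℂ) • F j = weightHom ω (f j))
  (hB : B = Submodule.span ℂ (Set.range fun j => evT 0 (F j)))
  (hdim : ∀ n, Module.finrank ℂ (A ^ n : Submodule ℂ (Pol N)) =
    Module.finrank ℂ (B ^ n : Submodule ℂ (Pol N)))
  {C C₀ : Type} [CommRing C] [Algebra ℂ C] {𝒞 : ℕ → Submodule ℂ C} [GradedAlgebra 𝒞]
  [CommRing C₀] [Algebra ℂ C₀] {𝒞₀ : ℕ → Submodule ℂ C₀} [GradedAlgebra 𝒞₀]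
  (e : coneAlg A ≃ₐ[ℂ] C) (he : ∀ n x, x ∈ coneDeg A n ↔ e x ∈ 𝒞 n)
  (e₀ : coneAlg B ≃ₐ[ℂ] C₀) (he₀ : ∀ n x, x ∈ coneDeg B n ↔ e₀ x ∈ 𝒞₀ n)

include hA hf hF hB hdim e he e₀ he₀

/-- If `B` is spanned by initial forms of elements of `A` and all powers of `A` and `B` have the
same dimension, the graded algebra of `A` degenerates to that of `B`. The total space is the
spectrum, or the projective spectrum, of `⨁ Ãⁿ zⁿ`, with `Ã` the `ℂ[t]`-module spanned by the `F
j`. -/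
theorem hasFlatDegenerations_of_initial (hB0 : B ≠ ⊥) :
    HasAffineFlatDegeneration (specOver C) (specOver C₀) ∧
      HasProperFlatDegeneration (projOver 𝒞) (projOver 𝒞₀) := by
  subst hB
  have hne : ∀ a : ℂ, a ≠ 0 → IsGradedFibre
      (coneZero (Submodule.span (Polynomial ℂ) (Set.range F))) a 𝒞 := fun a ha =>
    (isGradedFibre_of_ne_zero ω hA hf hF hdim ha).trans e he
  have hz : IsGradedFibre (coneZero (Submodule.span (Polynomial ℂ) (Set.range F))) 0 𝒞₀ :=
    (isGradedFibre_zero ω hA hf hF hdim).trans e₀ he₀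
  have hbij := coneZero_bijective (Submodule.span (Polynomial ℂ) (Set.range F))
    (MvPolynomial.C_injective (Fin N) (Polynomial ℂ))
  have hft : Algebra.FiniteType ℂ (coneAlg (Submodule.span (Polynomial ℂ) (Set.range F))) :=
    ⟨Subalgebra.fg_def.2 ⟨_, Set.finite_range _, adjoin_coneGen F⟩⟩
  refine ⟨hasAffineFlatDegeneration_of_isGradedFibre hbij.1 (coneWeights ω hF) none rfl rfl
    (fun a ha => (hne a ha).spec) hz.spec, ?_⟩
  obtain ⟨j, hj⟩ : ∃ j, F j ≠ 0 := by
    by_contra! h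
    refine hB0 (Submodule.span_eq_bot.2 ?_)
    rintro _ ⟨j, rfl⟩
    simp [h j]
  refine hasProperFlatDegeneration_of_isGradedFibre hbij (coneWeights ω hF) coneGen_mem none rfl
    rfl one_pos (mk_monomial_mem_coneDeg (a := F j) (n := 1)
      (by rw [pow_one]; exact Submodule.subset_span ⟨j, rfl⟩)) ?_
    (fun a ha => (hne a ha).proj) hz.proj
  intro h
  exact hj ((Polynomial.monomial_eq_zero_iff _ _).1 (congrArg Subtype.val h))

end Degeneration

/-! ### Coordinate rings of orbit closures -/

section OrbitPolynomials

variable {N : ℕ} {V W : Type*} [AddCommGroup V] [Module ℂ V] [AddCommGroup W] [Module ℂ W]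
  (b : Module.Basis (Fin N) ℂ V) (ρ : V →ₗ[ℂ] Module.End ℂ W) (w : W)

/-- For a linear form `ξ`, the polynomial function `x ↦ ξ (ρ(x)ᵏ w)` in the coordinates of `x`. -/
def powPol : ℕ → Module.Dual ℂ W →ₗ[ℂ] Pol N
  | 0 => (Algebra.linearMap ℂ (Pol N)).comp (Module.Dual.eval ℂ W w)
  | k + 1 => ∑ i, (LinearMap.mulLeft ℂ (MvPolynomial.X i)).comp
      ((powPol k).comp (LinearMap.lcomp ℂ ℂ (ρ (b i))))

theorem powPol_zero (ξ : Module.Dual ℂ W) : powPol b ρ w 0 ξ = MvPolynomial.C (ξ w) := rfl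

theorem powPol_succ (k : ℕ) (ξ : Module.Dual ℂ W) : powPol b ρ w (k + 1) ξ =
    ∑ i, MvPolynomial.X i * powPol b ρ w k (ξ.comp (ρ (b i))) := by
  rw [powPol, LinearMap.sum_apply]
  rfl

theorem eval_powPol (k : ℕ) (ξ : Module.Dual ℂ W) (c : Fin N → ℂ) :
    MvPolynomial.eval c (powPol b ρ w k ξ) = ξ ((ρ (b.equivFun.symm c) ^ k) w) := by
  induction k generalizing ξ with
  | zero => simp [powPol_zero]
  | succ k ih =>
    rw [powPol_succ, map_sum, pow_succ', Module.End.mul_apply]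
    have h : ∀ u, ξ (ρ (b.equivFun.symm c) u) = ∑ i, c i * ξ (ρ (b i) u) := fun u => by
      rw [Module.Basis.equivFun_symm_apply, map_sum, LinearMap.sum_apply, map_sum]
      simp only [map_smul, LinearMap.smul_apply, smul_eq_mul]
    rw [h]
    refine Finset.sum_congr rfl fun i _ => ?_
    rw [map_mul, ih, MvPolynomial.eval_X]
    rfl

/-- For a linear form `ξ`, the polynomial function `x ↦ ξ (exp(ρ(x)) w)`, with the exponential
series truncated before degree `K`. -/
def orbitPol (K : ℕ) : Module.Dual ℂ W →ₗ[ℂ] Pol N :=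
  ∑ k ∈ Finset.range K, ((k.factorial : ℂ)⁻¹) • powPol b ρ w k

/-- The space of the polynomial functions `x ↦ ξ (exp(ρ(x)) w)`. -/
def orbitSpace (K : ℕ) : Submodule ℂ (Pol N) := LinearMap.range (orbitPol b ρ w K)

theorem expEnd_apply {T : Module.End ℂ W} {K : ℕ} (hT : T ^ K = 0) (w : W) :
    expEnd T w = ∑ k ∈ Finset.range K, ((k.factorial : ℂ)⁻¹) • (T ^ k) w := by
  let : Module ℚ (Module.End ℂ W) := Module.compHom _ (algebraMap ℚ ℂ)
  have h : expEnd T = ∑ k ∈ Finset.range K, ((k.factorial : ℚ)⁻¹) • T ^ k :=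
    IsNilpotent.exp_eq_sum hT
  rw [h, LinearMap.sum_apply]
  refine Finset.sum_congr rfl fun k _ => ?_
  change ((algebraMap ℚ ℂ (k.factorial : ℚ)⁻¹) • T ^ k) w = _
  rw [LinearMap.smul_apply]
  congr 1
  simp

theorem eval_orbitPol {K : ℕ} (hK : ∀ x, ρ x ^ K = 0) (ξ : Module.Dual ℂ W) (c : Fin N → ℂ) :
    MvPolynomial.eval c (orbitPol b ρ w K ξ) = ξ (expEnd (ρ (b.equivFun.symm c)) w) := by
  rw [expEnd_apply (hK _), orbitPol, LinearMap.sum_apply, map_sum, map_sum]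
  refine Finset.sum_congr rfl fun k _ => ?_
  rw [LinearMap.smul_apply, MvPolynomial.smul_eval, eval_powPol, map_smul, smul_eq_mul]

theorem orbitSpace_fg [FiniteDimensional ℂ W] (K : ℕ) : (orbitSpace b ρ w K).FG :=
  Module.Finite.iff_fg.1 (inferInstanceAs (Module.Finite ℂ (LinearMap.range (orbitPol b ρ w K))))

end OrbitPolynomials

section CoordinateRing

variable {N : ℕ} {V W : Type*} [AddCommGroup V] [Module ℂ V] [AddCommGroup W] [Module ℂ W]
  [FiniteDimensional ℂ W] (b : Module.Basis (Fin N) ℂ V) (ρ : V →ₗ[ℂ] Module.End ℂ W) (w : W)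
  (K : ℕ)

/-- The homomorphism from the polynomial ring of `W` given by the parametrization
`(z, x) ↦ z exp(ρ(x)) w` of the cone over the orbit. -/
def coneParam : MvPolynomial (Fin (Module.finrank ℂ W)) ℂ →ₐ[ℂ] coneAlg (orbitSpace b ρ w K) :=
  MvPolynomial.aeval fun j => ⟨Polynomial.monomial 1
    (orbitPol b ρ w K ((Module.finBasis ℂ W).coord j)),
      monomial_mem_coneAlg (by rw [pow_one]; exact ⟨_, rfl⟩)⟩

theorem coneParam_X (j : Fin (Module.finrank ℂ W)) :
    (coneParam b ρ w K (MvPolynomial.X j) : Polynomial (Pol N)) =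
      Polynomial.monomial 1 (orbitPol b ρ w K ((Module.finBasis ℂ W).coord j)) := by
  rw [coneParam, MvPolynomial.aeval_X]

theorem coneParam_surjective : Function.Surjective (coneParam b ρ w K) := by
  have hspan : orbitSpace b ρ w K = Submodule.span ℂ
      (Set.range fun j => orbitPol b ρ w K ((Module.finBasis ℂ W).coord j)) := by
    have h1 := (Module.finBasis ℂ W).dualBasis.span_eq
    rw [orbitSpace, LinearMap.range_eq_map, ← h1, Submodule.map_span, ← Set.range_comp]
    congr 2
    ext j
    simp
  intro p
  have h2 := coneAlg_le_adjoin _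
    ((congrArg (fun A => (p : Polynomial (Pol N)) ∈ coneAlg A) hspan).mp p.2)
  have h3 : Algebra.adjoin ℂ (Set.range fun j => Polynomial.monomial 1
      (orbitPol b ρ w K ((Module.finBasis ℂ W).coord j))) ≤
      ((coneAlg (orbitSpace b ρ w K)).val.comp (coneParam b ρ w K)).range := by
    refine Algebra.adjoin_le ?_
    rintro _ ⟨j, rfl⟩
    exact ⟨MvPolynomial.X j, coneParam_X b ρ w K j⟩
  obtain ⟨g, hg⟩ := h3 h2
  exact ⟨g, Subtype.ext hg⟩

variable {K} in
/-- A polynomial vanishes on the cone over the orbit if and only if its pullback along the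
parametrization is the zero polynomial, because `ℂ` is infinite. -/
theorem ker_coneParam (hK : ∀ x, ρ x ^ K = 0) :
    RingHom.ker (coneParam b ρ w K) = coneIdeal ρ w := by
  have hev : ∀ (s : ℂ) (c : Fin N → ℂ) (g : MvPolynomial (Fin (Module.finrank ℂ W)) ℂ),
      ((coneParam b ρ w K g : Polynomial (Pol N)).map (MvPolynomial.eval c)).eval s =
        MvPolynomial.aeval (coords (s • expEnd (ρ (b.equivFun.symm c)) w)) g := by
    intro s c g
    have h : (((Polynomial.aeval s).comp ((Polynomial.mapAlgHom (MvPolynomial.aeval c)).comp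
        ((coneAlg (orbitSpace b ρ w K)).val))).comp (coneParam b ρ w K) :
          MvPolynomial (Fin (Module.finrank ℂ W)) ℂ →ₐ[ℂ] ℂ) =
        MvPolynomial.aeval (coords (s • expEnd (ρ (b.equivFun.symm c)) w)) := by
      refine MvPolynomial.algHom_ext fun j => ?_
      rw [MvPolynomial.aeval_X, AlgHom.comp_apply, AlgHom.comp_apply, AlgHom.comp_apply]
      change Polynomial.aeval s (Polynomial.map (MvPolynomial.eval c)
        (coneParam b ρ w K (MvPolynomial.X j) : Polynomial (Pol N))) = _
      rw [coneParam_X, Polynomial.map_monomial, eval_orbitPol b ρ w hK, Polynomial.aeval_monomial]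
      simp [coords, mul_comm]
    exact congrArg (fun k => k g) h
  have hsymm : ∀ x : V, b.equivFun.symm (b.equivFun x) = x := fun x => b.equivFun.symm_apply_apply x
  ext g
  rw [RingHom.mem_ker]
  constructor
  · rintro hg _ ⟨_, ⟨s, _, ⟨x, rfl⟩, rfl⟩, rfl⟩
    have := hev s (b.equivFun x) g
    rw [hg, hsymm] at this
    rw [← this]
    simp
  · intro hg
    refine Subtype.ext (Polynomial.ext fun n => MvPolynomial.funext fun c => ?_)
    have h1 : (coneParam b ρ w K g : Polynomial (Pol N)).map (MvPolynomial.eval c) = 0 := by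
      refine Polynomial.funext fun s => ?_
      rw [hev, Polynomial.eval_zero]
      exact hg _ ⟨_, ⟨s, _, ⟨_, rfl⟩, rfl⟩, rfl⟩
    rw [← Polynomial.coeff_map, h1]
    simp

/-- The homogeneous coordinate ring of the orbit closure, as an algebra of polynomial functions in
the parameters `(z, x)`. -/
def coordRingEquiv (hK : ∀ x, ρ x ^ K = 0) : coneAlg (orbitSpace b ρ w K) ≃ₐ[ℂ] CoordRing ρ w :=
  (Ideal.quotientKerAlgEquivOfSurjective (coneParam_surjective b ρ w K)).symm.trans
    (Ideal.quotientEquivAlgOfEq ℂ (ker_coneParam b ρ w hK))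

theorem coordRingEquiv_coneParam (hK : ∀ x, ρ x ^ K = 0)
    (g : MvPolynomial (Fin (Module.finrank ℂ W)) ℂ) :
    coordRingEquiv b ρ w K hK (coneParam b ρ w K g) = Ideal.Quotient.mk _ g := by
  rw [coordRingEquiv, AlgEquiv.trans_apply, Ideal.quotientKerAlgEquivOfSurjective_symm_apply]
  rfl

theorem coneParam_mem_coneDeg {n : ℕ} {g : MvPolynomial (Fin (Module.finrank ℂ W)) ℂ}
    (hg : g.IsHomogeneous n) : coneParam b ρ w K g ∈ coneDeg (orbitSpace b ρ w K) n := by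
  rw [← MvPolynomial.support_sum_monomial_coeff g, map_sum]
  refine sum_mem fun d hd => ?_
  have hd' : ∑ i ∈ d.support, d i • 1 = n := by
    have h := hg (MvPolynomial.mem_support_iff.1 hd)
    rw [← h, Finsupp.weight_apply]
    rfl
  rw [MvPolynomial.monomial_eq, ← MvPolynomial.algebraMap_eq, ← Algebra.smul_def, map_smul,
    Finsupp.prod, map_prod]
  refine Submodule.smul_mem _ _ ?_
  rw [← hd']
  simp only [map_pow]
  refine SetLike.prod_mem_graded _ _ _ fun i _ => SetLike.pow_mem_graded _ ?_
  intro m hm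
  rw [coneParam_X]
  exact Polynomial.coeff_monomial_of_ne _ hm

theorem mem_coneDeg_iff (hK : ∀ x, ρ x ^ K = 0) (n : ℕ) (x : coneAlg (orbitSpace b ρ w K)) :
    x ∈ coneDeg (orbitSpace b ρ w K) n ↔ coordRingEquiv b ρ w K hK x ∈ coordDeg ρ w n := by
  let E : coordDeg ρ w →+*ᵍ coneDeg (orbitSpace b ρ w K) :=
    { toRingHom := ((coordRingEquiv b ρ w K hK).symm : CoordRing ρ w →+* _)
      map_mem := by
        rintro i _ ⟨g, hg, rfl⟩
        change (coordRingEquiv b ρ w K hK).symm (Ideal.Quotient.mk _ g) ∈ _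
        rw [← coordRingEquiv_coneParam b ρ w K hK, AlgEquiv.symm_apply_apply]
        exact coneParam_mem_coneDeg b ρ w K hg }
  obtain ⟨y, rfl⟩ := (coordRingEquiv b ρ w K hK).symm.surjective x
  rw [AlgEquiv.apply_symm_apply]
  refine ⟨fun h => ?_, fun h => E.map_mem h⟩
  have h1 : E (DirectSum.decompose (coordDeg ρ w) y n) = E y := by
    rw [GradedRingHom.map_directSumDecompose]
    exact DirectSum.decompose_of_mem_same _ h
  rw [← (coordRingEquiv b ρ w K hK).symm.injective h1]
  exact SetLike.coe_mem _

end CoordinateRing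

/-! ### Monomial orders given by weights -/

section MonomialWeights

variable {N : ℕ}

theorem exists_dominating {I : Type*} (s : Finset I) (x y : I → ℤ) (hx : ∀ i ∈ s, 0 < x i) :
    ∃ L : ℤ, ∀ i ∈ s, 0 < L * x i + y i := by
  refine ⟨∑ j ∈ s, |y j| + 1, fun i hi => ?_⟩
  have h1 : |y i| ≤ ∑ j ∈ s, |y j| :=
    Finset.single_le_sum (f := fun j => |y j|) (fun j _ => abs_nonneg _) hi
  have h2 : ∑ j ∈ s, |y j| + 1 ≤ (∑ j ∈ s, |y j| + 1) * x i :=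
    le_mul_of_one_le_right (by linarith [abs_nonneg (y i)]) (hx i hi)
  linarith [neg_abs_le (y i)]

/-- Gordan's theorem of the alternative: integral vectors without a nontrivial relation with
nonnegative coefficients lie in an open half-space. -/
theorem exists_pos_functional {I : Type*} (s : Finset I) (d : I → Fin N → ℤ)
    (h : ∀ n : I → ℕ, ∑ i ∈ s, n i • d i = 0 → ∀ i ∈ s, n i = 0) :
    ∃ ω : (Fin N → ℤ) →+ ℤ, ∀ i ∈ s, 0 < ω (d i) := by
  classical
  induction s using Finset.induction_on generalizing d with
  | empty => exact ⟨0, by simp⟩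
  | insert i₀ s hi₀ ih =>
    have hne : ∀ i ∈ s, i ≠ i₀ := fun i hi he => hi₀ (he ▸ hi)
    obtain ⟨ω₁, hω₁⟩ := ih d fun n hn i hi => by
      have h1 := h (fun j => if j = i₀ then 0 else n j) (by
        rw [Finset.sum_insert hi₀, if_pos rfl, zero_smul, zero_add, ← hn]
        refine Finset.sum_congr rfl fun j hj => ?_
        rw [if_neg (hne j hj)]) i (Finset.mem_insert_of_mem hi)
      simpa [hne i hi] using h1
    have hd₀ : d i₀ ≠ 0 := by
      intro h0
      have h1 := h (fun j => if j = i₀ then 1 else 0) (by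
        rw [Finset.sum_insert hi₀, h0, smul_zero, zero_add]
        refine Finset.sum_eq_zero fun j hj => ?_
        rw [if_neg (hne j hj), zero_smul]) i₀ (Finset.mem_insert_self _ _)
      simp at h1
    rcases lt_trichotomy 0 (ω₁ (d i₀)) with h0 | h0 | h0
    · exact ⟨ω₁, fun i hi => (Finset.mem_insert.1 hi).elim (fun e => e ▸ h0) (hω₁ i)⟩
    · obtain ⟨θ, hθ⟩ : ∃ θ : (Fin N → ℤ) →+ ℤ, 0 < θ (d i₀) := by
        obtain ⟨j, hj⟩ := Function.ne_iff.1 hd₀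
        rcases lt_or_gt_of_ne hj with hj | hj
        · exact ⟨-Pi.evalAddMonoidHom _ j, by simpa using hj⟩
        · exact ⟨Pi.evalAddMonoidHom _ j, hj⟩
      obtain ⟨L, hL⟩ := exists_dominating s (fun i => ω₁ (d i)) (fun i => θ (d i)) hω₁
      refine ⟨L • ω₁ + θ, fun i hi => ?_⟩
      rcases Finset.mem_insert.1 hi with rfl | hi
      · simpa [← h0] using hθ
      · simpa using hL i hi
    · -- Move the vectors of `s` along `d i₀` into the kernel of `ω₁`.
      obtain ⟨a, ha⟩ := Int.eq_ofNat_of_zero_le (neg_nonneg.2 h0.le)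
      have hpos : ∀ i ∈ s, ((ω₁ (d i)).toNat : ℤ) = ω₁ (d i) := fun i hi =>
        Int.toNat_of_nonneg (hω₁ i hi).le
      have ha0 : a ≠ 0 := by
        rintro rfl
        simp at ha
        omega
      obtain ⟨ω₂, hω₂⟩ := ih (fun i => a • d i + (ω₁ (d i)).toNat • d i₀) fun n hn i hi => by
        have h1 := h (fun j => if j = i₀ then ∑ i ∈ s, n i * (ω₁ (d i)).toNat else n j * a) (by
          rw [Finset.sum_insert hi₀, if_pos rfl, ← hn, Finset.sum_smul, ← Finset.sum_add_distrib]
          refine Finset.sum_congr rfl fun j hj => ?_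
          rw [if_neg (hne j hj), smul_add, smul_smul, smul_smul, add_comm])
          i (Finset.mem_insert_of_mem hi)
        simpa [hne i hi, ha0] using h1
      let ω₃ : (Fin N → ℤ) →+ ℤ := (a : ℤ) • ω₂ + ω₂ (d i₀) • ω₁
      have h3 : ∀ i ∈ s, 0 < ω₃ (d i) := fun i hi => by
        have h4 := hω₂ i hi
        rw [map_add, map_nsmul, map_nsmul, nsmul_eq_mul, nsmul_eq_mul, hpos i hi] at h4
        simp only [ω₃, AddMonoidHom.add_apply, AddMonoidHom.smul_apply, smul_eq_mul]
        linarith [mul_comm (ω₂ (d i₀)) (ω₁ (d i))]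
      obtain ⟨L, hL⟩ := exists_dominating s (fun i => ω₃ (d i)) (fun i => -ω₁ (d i)) h3
      refine ⟨L • ω₃ - ω₁, fun i hi => ?_⟩
      rcases Finset.mem_insert.1 hi with rfl | hi
      · have h5 : ω₃ (d i) = 0 := by
          simp only [ω₃, AddMonoidHom.add_apply, AddMonoidHom.smul_apply, smul_eq_mul]
          have : (a : ℤ) = -ω₁ (d i) := ha.symm
          rw [this]
          ring
        simp [h5, h0]
      · simpa [sub_eq_add_neg] using hL i hi

/-- A monomial order is given, on the multi-exponents of degree less than `K`, by nonnegative
integral weights: the differences of comparable pairs satisfy no nontrivial relation with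
nonnegative coefficients, since the inequalities between the pairs can be added up. -/
theorem exists_weight (ord : MonomialOrder (Fin N)) (K : ℕ) :
    ∃ ω : Fin N → ℕ, ∀ p q : Fin N →₀ ℕ, p.degree < K → q.degree < K →
      ord.toSyn p < ord.toSyn q → Finsupp.weight ω p < Finsupp.weight ω q := by
  classical
  -- With the bound `K + 2` the unit vectors are included, so that the weights are nonnegative.
  have hfin : {p : Fin N →₀ ℕ | p.degree < K + 2}.Finite := by
    refine Set.Finite.subset (Set.finite_Iic (Finsupp.equivFunOnFinite.symm fun _ => K + 2)) ?_
    intro p hp i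
    have := Finsupp.le_degree i p
    have hp' : p.degree < K + 2 := hp
    simp only [Finsupp.coe_equivFunOnFinite_symm]
    omega
  let s := (hfin.toFinset ×ˢ hfin.toFinset).filter fun x => ord.toSyn x.1 < ord.toSyn x.2
  obtain ⟨ω, hω⟩ := exists_pos_functional s
    (fun x : (Fin N →₀ ℕ) × (Fin N →₀ ℕ) => fun i => (x.2 i : ℤ) - x.1 i) fun n hn => by
      have h1 : ∑ x ∈ s, n x • x.1 = ∑ x ∈ s, n x • x.2 := by
        ext i
        have h2 : ∑ x ∈ s, (n x : ℤ) * ((x.2 i : ℤ) - x.1 i) = 0 := by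
          refine Eq.trans (Finset.sum_congr rfl fun x _ => ?_)
            ((Finset.sum_apply i s _).symm.trans (congrFun hn i))
          exact (nsmul_eq_mul _ _).symm
        simp only [mul_sub, Finset.sum_sub_distrib, sub_eq_zero] at h2
        simp only [Finsupp.coe_finsetSum, Finset.sum_apply, Finsupp.smul_apply, smul_eq_mul]
        exact_mod_cast h2.symm
      by_contra! hcon
      obtain ⟨x, hx, hnx⟩ := hcon
      have h2 : ∑ x ∈ s, n x • ord.toSyn x.1 < ∑ x ∈ s, n x • ord.toSyn x.2 := by
        refine Finset.sum_lt_sum (fun y hy => ?_) ⟨x, hx, ?_⟩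
        · exact nsmul_le_nsmul_right (Finset.mem_filter.1 hy).2.le _
        · exact nsmul_lt_nsmul_right hnx (Finset.mem_filter.1 hx).2
      have h3 := congrArg ord.toSyn h1
      simp only [map_sum, map_nsmul] at h3
      exact h2.ne h3
  have hmem : ∀ p q : Fin N →₀ ℕ, p.degree < K + 2 → q.degree < K + 2 →
      ord.toSyn p < ord.toSyn q → 0 < ω fun i => (q i : ℤ) - p i := fun p q hp hq h =>
    hω (p, q) (Finset.mem_filter.2 ⟨Finset.mem_product.2 ⟨hfin.mem_toFinset.2 hp,
      hfin.mem_toFinset.2 hq⟩, h⟩)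
  have hsum : ∀ y : Fin N → ℤ, ω y = ∑ i, y i * ω (Pi.single i 1) := by
    intro y
    conv_lhs => rw [← Finset.univ_sum_single y]
    rw [map_sum]
    refine Finset.sum_congr rfl fun i _ => ?_
    rw [← smul_eq_mul, ← map_zsmul]
    congr 1
    ext j
    by_cases h : j = i
    · subst h
      simp
    · simp [h]
  have hpos : ∀ i, 0 ≤ ω (Pi.single i 1) := by
    intro i
    have h1 := hmem 0 (Finsupp.single i 1) (by simp) (by simp) (by
      rw [map_zero]
      refine lt_of_le_of_ne (ord.zero_le _) fun h => ?_
      have := ord.toSyn.map_eq_zero_iff.1 h.symm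
      simp at this)
    have h2 : (fun j => ((Finsupp.single i 1 : Fin N →₀ ℕ) j : ℤ) - (0 : Fin N →₀ ℕ) j) =
        Pi.single i 1 := by
      ext j
      by_cases h : j = i
      · subst h
        simp
      · simp [h]
    rw [h2] at h1
    exact h1.le
  refine ⟨fun i => (ω (Pi.single i 1)).toNat, fun p q hp hq h => ?_⟩
  have h1 := hmem p q (by omega) (by omega) h
  rw [hsum] at h1
  simp only [sub_mul, Finset.sum_sub_distrib, sub_pos] at h1
  have h2 : ∀ r : Fin N →₀ ℕ, ((Finsupp.weight (fun i => (ω (Pi.single i 1)).toNat) r : ℕ) : ℤ) =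
      ∑ i, (r i : ℤ) * ω (Pi.single i 1) := by
    intro r
    rw [Finsupp.weight_apply, Finsupp.sum_fintype _ _ (by simp), Nat.cast_sum]
    refine Finset.sum_congr rfl fun i _ => ?_
    rw [smul_eq_mul, Nat.cast_mul, Int.toNat_of_nonneg (hpos i)]
  have h3 := h2 p
  have h4 := h2 q
  omega

end MonomialWeights

/-! ### Initial forms and moments -/

section InitialForms

open AlgebraicGeometry CategoryTheory

variable {N : ℕ} (ω : Fin N → ℕ)

theorem weightHom_monomial (p : Fin N →₀ ℕ) (c : ℂ) :
    weightHom ω (MvPolynomial.monomial p c) =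
      MvPolynomial.monomial p (Polynomial.C c * Polynomial.X ^ Finsupp.weight ω p) := by
  rw [weightHom, MvPolynomial.aeval_monomial, Finsupp.prod_fintype _ _ (by simp)]
  simp only [MvPolynomial.smul_eq_C_mul, mul_pow, Finset.prod_mul_distrib]
  rw [MvPolynomial.monomial_eq, Finsupp.prod_fintype _ _ (by simp), map_mul, ← mul_assoc]
  congr 2
  rw [Finsupp.weight_apply, Finsupp.sum_fintype _ _ (by simp), ← Finset.prod_pow_eq_pow_sum,
    map_prod]
  refine Finset.prod_congr rfl fun i _ => ?_
  rw [← map_pow, ← pow_mul, smul_eq_mul, mul_comm]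

/-- A polynomial all of whose monomials have weight at least `m` is divisible by `t^m` after the
substitution `xᵢ ↦ t^{ωᵢ} xᵢ`, and the quotient specializes at `t = 0` to the part of weight `m`. -/
theorem exists_initial (f : Pol N) (m : ℕ)
    (h : ∀ p, f.coeff p ≠ 0 → m ≤ Finsupp.weight ω p) :
    ∃ F : PolT N, (Polynomial.X ^ m : Polynomial ℂ) • F = weightHom ω f ∧
      ∀ p, (evT 0 F).coeff p = if Finsupp.weight ω p = m then f.coeff p else 0 := by
  classical
  refine ⟨∑ p ∈ f.support, MvPolynomial.monomial p
    (Polynomial.C (f.coeff p) * Polynomial.X ^ (Finsupp.weight ω p - m)), ?_, fun q => ?_⟩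
  · conv_rhs => rw [← MvPolynomial.support_sum_monomial_coeff f]
    rw [Finset.smul_sum, map_sum]
    refine Finset.sum_congr rfl fun p hp => ?_
    rw [weightHom_monomial, MvPolynomial.smul_monomial, smul_eq_mul, mul_left_comm, ← pow_add,
      Nat.add_sub_of_le (h p (MvPolynomial.mem_support_iff.1 hp))]
  · rw [map_sum, MvPolynomial.coeff_sum]
    simp only [evT, MvPolynomial.map_monomial, MvPolynomial.coeff_monomial,
      Finset.sum_ite_eq']
    by_cases hq : f.coeff q = 0
    · simp [hq]
    · rw [if_pos (MvPolynomial.mem_support_iff.2 hq)]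
      have := h q hq
      split_ifs with hw
      · simp [hw]
      · simp only [Polynomial.coe_evalRingHom, Polynomial.eval_mul, Polynomial.eval_C,
          Polynomial.eval_pow, Polynomial.eval_X]
        rw [zero_pow (by omega), mul_zero]

/-- The polynomial `g` is the initial form of an element of `A` with respect to the weights `ω`. -/
def IsInitial (A : Submodule ℂ (Pol N)) (g : Pol N) : Prop :=
  ∃ f ∈ A, ∃ (m : ℕ) (F : PolT N),
    (Polynomial.X ^ m : Polynomial ℂ) • F = weightHom ω f ∧ evT 0 F = g

/-- A polynomial with a unique term of lowest weight has that term as initial form. -/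
theorem isInitial_monomial {A : Submodule ℂ (Pol N)} {f : Pol N} (hf : f ∈ A) {p : Fin N →₀ ℕ}
    (hp : f.coeff p ≠ 0)
    (h : ∀ q, f.coeff q ≠ 0 → q ≠ p → Finsupp.weight ω p < Finsupp.weight ω q) :
    IsInitial ω A (MvPolynomial.monomial p 1) := by
  obtain ⟨F, hF, hF0⟩ := exists_initial ω ((f.coeff p)⁻¹ • f) (Finsupp.weight ω p) fun q hq => by
    by_cases hqp : q = p
    · rw [hqp]
    · refine (h q (fun h0 => hq ?_) hqp).le
      rw [MvPolynomial.coeff_smul, h0, smul_zero]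
  refine ⟨_, A.smul_mem _ hf, _, F, hF, MvPolynomial.ext _ _ fun q => ?_⟩
  rw [hF0, MvPolynomial.coeff_monomial]
  by_cases hqp : p = q
  · subst hqp
    rw [if_pos rfl, if_pos rfl, MvPolynomial.coeff_smul, smul_eq_mul, inv_mul_cancel₀ hp]
  · rw [if_neg hqp]
    split_ifs with hw
    · by_contra hne
      have h1 := h q (fun h0 => hne (by rw [MvPolynomial.coeff_smul, h0, smul_zero])) (Ne.symm hqp)
      omega
    · rfl

variable {A B : Submodule ℂ (Pol N)}

theorem exists_initial_family (hB : B.FG)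
    (h : B ≤ Submodule.span ℂ {g | g ∈ B ∧ IsInitial ω A g}) :
    ∃ (ι : Type) (_ : Finite ι) (F : ι → PolT N) (f : ι → Pol N) (m : ι → ℕ), (∀ j, f j ∈ A) ∧
      (∀ j, (Polynomial.X ^ m j : Polynomial ℂ) • F j = weightHom ω (f j)) ∧
      B = Submodule.span ℂ (Set.range fun j => evT 0 (F j)) := by
  have hspan : Submodule.span ℂ {g | g ∈ B ∧ IsInitial ω A g} = B :=
    le_antisymm (Submodule.span_le.2 fun g hg => hg.1) h
  obtain ⟨s, hs, hs'⟩ := (Submodule.fg_span_iff_fg_span_finset_subset _).1 (hspan ▸ hB)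
  choose f hf m F hF hF0 using fun g : s => (hs g.2).2
  refine ⟨s, inferInstance, F, f, m, hf, hF, ?_⟩
  rw [← hspan, hs']
  congr 1
  ext g
  constructor
  · exact fun hg => ⟨⟨g, hg⟩, hF0 _⟩
  · rintro ⟨g, rfl⟩
    simp only [hF0]
    exact g.2

/-- Spaces of initial forms have powers of at most the dimension of the powers of the original
space. -/
theorem finrank_pow_le_of_initial (hA : A.FG) (hB : B.FG)
    (h : B ≤ Submodule.span ℂ {g | g ∈ B ∧ IsInitial ω A g}) (n : ℕ) :
    Module.finrank ℂ (B ^ n : Submodule ℂ (Pol N)) ≤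
      Module.finrank ℂ (A ^ n : Submodule ℂ (Pol N)) := by
  obtain ⟨ι, _, F, f, m, hf, hF, rfl⟩ := exists_initial_family ω hB h
  obtain ⟨E, _, G, g, k, -, hg, -, -, hlin, hcard⟩ := exists_lift ω hf hF n
  have : FiniteDimensional ℂ (A ^ n : Submodule ℂ (Pol N)) := Module.Finite.iff_fg.2 (hA.pow n)
  rw [hcard, ← finrank_span_eq_card hlin]
  refine Submodule.finrank_mono (Submodule.span_le.2 ?_)
  rintro _ ⟨e, rfl⟩
  exact hg e

end InitialForms

section Moments

variable {N : ℕ} {V W : Type*} [AddCommGroup V] [Module ℂ V] [AddCommGroup W] [Module ℂ W]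
  (b : Module.Basis (Fin N) ℂ V) (ρ : V →ₗ[ℂ] Module.End ℂ W) (w : W)

open Classical in
/-- The coefficient of `x^p` in the `W`-valued polynomial `ρ(∑ xᵢ bᵢ)ᵏ w`. -/
def momentVec : ℕ → (Fin N →₀ ℕ) → W
  | 0, p => if p = 0 then w else 0
  | k + 1, p => ∑ i, if i ∈ p.support then ρ (b i) (momentVec k (p - Finsupp.single i 1)) else 0

theorem momentVec_succ (k : ℕ) (p : Fin N →₀ ℕ) : momentVec b ρ w (k + 1) p =
    ∑ i, if i ∈ p.support then ρ (b i) (momentVec b ρ w k (p - Finsupp.single i 1)) else 0 := by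
  rw [momentVec]

theorem degree_sub_single {p : Fin N →₀ ℕ} {i : Fin N} (hi : i ∈ p.support) :
    (p - Finsupp.single i 1).degree + 1 = p.degree ∧
      p - Finsupp.single i 1 + Finsupp.single i 1 = p := by
  have h : p - Finsupp.single i 1 + Finsupp.single i 1 = p :=
    tsub_add_cancel_of_le (Finsupp.single_le_iff.2
      (Nat.one_le_iff_ne_zero.2 (Finsupp.mem_support_iff.1 hi)))
  refine ⟨?_, h⟩
  conv_rhs => rw [← h]
  simp

theorem momentVec_eq_zero {k : ℕ} {p : Fin N →₀ ℕ} (h : p.degree ≠ k) :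
    momentVec b ρ w k p = 0 := by
  induction k generalizing p with
  | zero =>
    rw [momentVec, if_neg]
    rintro rfl
    simp at h
  | succ k ih =>
    rw [momentVec_succ]
    refine Finset.sum_eq_zero fun i _ => ?_
    split_ifs with hi
    · rw [ih, map_zero]
      have := (degree_sub_single hi).1
      omega
    · rfl

theorem coeff_powPol (k : ℕ) (ξ : Module.Dual ℂ W) (p : Fin N →₀ ℕ) :
    (powPol b ρ w k ξ).coeff p = ξ (momentVec b ρ w k p) := by
  classical
  induction k generalizing ξ p with
  | zero =>
    rw [powPol_zero, MvPolynomial.coeff_C, momentVec]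
    by_cases hp : p = 0
    · rw [if_pos hp.symm, if_pos hp]
    · rw [if_neg (Ne.symm hp), if_neg hp, map_zero]
  | succ k ih =>
    rw [powPol_succ, MvPolynomial.coeff_sum, momentVec_succ, map_sum]
    refine Finset.sum_congr rfl fun i _ => ?_
    rw [MvPolynomial.coeff_X_mul']
    split_ifs with hi
    · rw [ih]
      rfl
    · rw [map_zero]

theorem coeff_orbitPol (K : ℕ) (ξ : Module.Dual ℂ W) (p : Fin N →₀ ℕ) :
    (orbitPol b ρ w K ξ).coeff p = if p.degree < K then
      ((p.degree.factorial : ℂ)⁻¹) * ξ (momentVec b ρ w p.degree p) else 0 := by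
  rw [orbitPol, LinearMap.sum_apply, MvPolynomial.coeff_sum]
  simp only [LinearMap.smul_apply, MvPolynomial.coeff_smul, coeff_powPol, smul_eq_mul]
  split_ifs with h
  · rw [Finset.sum_eq_single p.degree]
    · intro k _ hk
      rw [momentVec_eq_zero b ρ w hk.symm, map_zero, mul_zero]
    · intro hh
      exact absurd (Finset.mem_range.2 h) hh
  · refine Finset.sum_eq_zero fun k hk => ?_
    rw [momentVec_eq_zero b ρ w, map_zero, mul_zero]
    rintro rfl
    exact h (Finset.mem_range.1 hk)

theorem momentVec_eq_zero_of_pow [FiniteDimensional ℂ W] {k : ℕ} (h : ∀ x, ρ x ^ k = 0)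
    (p : Fin N →₀ ℕ) : momentVec b ρ w k p = 0 := by
  rw [← Module.forall_dual_apply_eq_zero_iff ℂ]
  intro ξ
  have h1 : powPol b ρ w k ξ = 0 := MvPolynomial.funext fun c => by
    rw [eval_powPol, h]
    simp
  rw [← coeff_powPol, h1, MvPolynomial.coeff_zero]

theorem momentVec_mem_pbw (k : ℕ) (p : Fin N →₀ ℕ) : momentVec b ρ w k p ∈ pbw ρ w k := by
  induction k generalizing p with
  | zero =>
    rw [momentVec]
    split_ifs
    · exact mem_pbw_zero ρ w
    · exact zero_mem _
  | succ k ih =>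
    rw [momentVec_succ]
    refine sum_mem fun i _ => ?_
    split_ifs
    · exact pbw_le_comap ρ w (b i) k (ih _)
    · exact zero_mem _

theorem pow_mem_span_words (x : V) (k : ℕ) : ρ x ^ k ∈ Submodule.span ℂ
    {T | ∃ l : List (Fin N), l.length = k ∧ T = (l.map fun i => ρ (b i)).prod} := by
  induction k with
  | zero => exact Submodule.subset_span ⟨[], rfl, by simp⟩
  | succ k ih =>
    rw [pow_succ']
    have h : ∀ T ∈ Submodule.span ℂ {T | ∃ l : List (Fin N), l.length = k ∧
        T = (l.map fun i => ρ (b i)).prod}, ρ x * T ∈ Submodule.span ℂ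
          {T | ∃ l : List (Fin N), l.length = k + 1 ∧ T = (l.map fun i => ρ (b i)).prod} := by
      intro T hT
      induction hT using Submodule.span_induction with
      | mem T hT =>
        obtain ⟨l, hl, rfl⟩ := hT
        rw [← b.sum_repr x, map_sum, Finset.sum_mul]
        refine sum_mem fun i _ => ?_
        rw [map_smul, smul_mul_assoc]
        exact Submodule.smul_mem _ _ (Submodule.subset_span ⟨i :: l, by simp [hl], by simp⟩)
      | zero => simp
      | add T T' _ _ hT hT' =>
        rw [mul_add]
        exact add_mem hT hT'
      | smul c T _ hT =>
        rw [mul_smul_comm]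
        exact Submodule.smul_mem _ _ hT
    exact h _ ih

theorem pow_eq_zero_of_words {K : ℕ}
    (h : ∀ l : List (Fin N), l.length = K → (l.map fun i => ρ (b i)).prod = 0) (x : V) :
    ρ x ^ K = 0 := by
  have h1 := pow_mem_span_words b ρ x K
  have h2 : {T | ∃ l : List (Fin N), l.length = K ∧ T = (l.map fun i => ρ (b i)).prod} ⊆ {0} := by
    rintro _ ⟨l, hl, rfl⟩
    exact h l hl
  simpa using Submodule.span_mono h2 h1

end Moments

section GradedClasses

variable {ι W : Type*} [DecidableEq ι] [AddCommGroup W] [Module ℂ W] (F G : ι → Submodule ℂ W)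

theorem grClass_congr {i j : ι} (h : i = j) {w w' : W} (hw : w ∈ F i) (hw' : w' ∈ F j)
    (hsub : w - w' ∈ G i) : grClass F G i w hw = grClass F G j w' hw' := by
  subst h
  rw [grClass, grClass]
  congr 1
  exact (Submodule.Quotient.eq _).2 hsub

theorem grClass_eq_zero {i : ι} {w : W} (hw : w ∈ F i) (h : w ∈ G i) :
    grClass F G i w hw = 0 := by
  rw [grClass, (Submodule.Quotient.mk_eq_zero ((G i).submoduleOf (F i))).2 h, map_zero]

theorem grClass_sum {i : ι} {κ : Type*} (s : Finset κ) (w : κ → W) (hw : ∀ j, w j ∈ F i) :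
    grClass F G i (∑ j ∈ s, w j) (sum_mem fun j _ => hw j) =
      ∑ j ∈ s, grClass F G i (w j) (hw j) := by
  classical
  induction s using Finset.induction_on with
  | empty => exact grClass_eq_zero F G _ (zero_mem _)
  | insert j s hj ih =>
    refine (grClass_congr F G rfl _ (add_mem (hw j)
      (sum_mem (t := s) fun j _ => hw j)) ?_).trans ?_
    · rw [Finset.sum_insert hj, sub_self]
      exact zero_mem _
    · rw [grClass_add _ _ _ _ _ (hw j) (sum_mem fun j _ => hw j), ih, Finset.sum_insert hj]

/-- The linear form on the graded space, concentrated in degree `i`, induced by a linear form that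
vanishes on `Gᵢ`. -/
def grDual (i : ι) (ξ : Module.Dual ℂ W) (hξ : ∀ w ∈ G i, ξ w = 0) : Module.Dual ℂ (Gr F G) :=
  (Submodule.liftQ ((G i).submoduleOf (F i)) (ξ.comp (F i).subtype) fun x hx => hξ x hx).comp
    (DirectSum.component ℂ ι _ i)

theorem grDual_same (i : ι) (ξ : Module.Dual ℂ W) (hξ : ∀ w ∈ G i, ξ w = 0) {w : W}
    (hw : w ∈ F i) : grDual F G i ξ hξ (grClass F G i w hw) = ξ w := by
  rw [grDual, grClass, LinearMap.comp_apply, DirectSum.component.lof_self]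
  rfl

theorem grDual_of_ne {i j : ι} (ξ : Module.Dual ℂ W) (hξ : ∀ w ∈ G i, ξ w = 0) {w : W}
    (hw : w ∈ F j) (h : j ≠ i) : grDual F G i ξ hξ (grClass F G j w hw) = 0 := by
  rw [grDual, grClass, LinearMap.comp_apply, DirectSum.component.of, dif_neg h, map_zero]

theorem exists_prod_grMap {κ : Type*} (σ : κ → ι → ι) (T : κ → Module.End ℂ W)
    (hF : ∀ k i, F i ≤ (F (σ k i)).comap (T k)) (hG : ∀ k i, G i ≤ (G (σ k i)).comap (T k))
    (l : List κ) (i : ι) (w : W) (hw : w ∈ F i) :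
    ∃ j, ∃ h : (l.map T).prod w ∈ F j,
      (l.map fun k => grMap F G (σ k) (T k) (hF k) (hG k)).prod (grClass F G i w hw) =
        grClass F G j ((l.map T).prod w) h := by
  induction l with
  | nil => exact ⟨i, hw, rfl⟩
  | cons k l ih =>
    obtain ⟨j, h, hj⟩ := ih
    refine ⟨σ k j, hF k j h, ?_⟩
    rw [List.map_cons, List.prod_cons, Module.End.mul_apply, hj, grMap_grClass]
    rfl

end GradedClasses

/-! ### Moments of Lie modules and of their degenerations -/

section LieMoments

variable {𝔫 M : Type*} [LieRing 𝔫] [LieAlgebra ℂ 𝔫] [AddCommGroup M] [Module ℂ M]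
  [LieRingModule 𝔫 M] [LieModule ℂ 𝔫 M] {N : ℕ} (b : Module.Basis (Fin N) ℂ 𝔫)
  (ord : HomogeneousOrder N) (v : M)

theorem pbw_le_monFilPrev {s : ℕ} {p : Fin N →₀ ℕ} (h : s < p.degree) :
    pbw (lieAct 𝔫 M) v s ≤ monFilPrev b ord v p := by
  refine (pbw_le_span b v s).trans (Submodule.span_mono ?_)
  rintro _ ⟨q, hq, rfl⟩
  exact ⟨q, ord.homogeneous _ _ (hq.trans_lt h), rfl⟩

theorem pbwPrev_le_monFilPrev (p : Fin N →₀ ℕ) :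
    pbwPrev (lieAct 𝔫 M) v p.degree ≤ monFilPrev b ord v p := by
  refine Submodule.span_le.2 ?_
  rintro _ ⟨l, hl, rfl⟩
  exact pbw_le_monFilPrev b ord v hl (word_mem_pbw _ v l le_rfl)

theorem monomialVec_mem_monFil (p : Fin N →₀ ℕ) : monomialVec b v p ∈ monFil b ord v p :=
  Submodule.subset_span ⟨p, le_rfl, rfl⟩

theorem actT_basis (i : Fin N) : actT b ord v (b i) = genT b ord v i :=
  b.constr_basis ℂ _ i

theorem actA_apply (x : 𝔫) : actA 𝔫 v x = grMap _ _ (fun s => s + 1) (lieAct 𝔫 M x)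
    (pbw_le_comap _ v x) (pbwPrev_le_comap _ v x) := rfl

/-- The coefficient of `x^p` in `ρ(∑ xᵢ fᵢ)^|p| v` is a positive multiple of the ordered monomial
`v(p)` up to lower order, both in `M` and in `M^t`. -/
theorem exists_momentVec_eq (k : ℕ) (p : Fin N →₀ ℕ) (hp : p.degree = k) :
    ∃ c : ℕ, 0 < c ∧
      momentVec b (lieAct 𝔫 M) v k p - c • monomialVec b v p ∈ pbwPrev (lieAct 𝔫 M) v k ∧
      momentVec b (actT b ord v) (vecT b ord v) k p =
        c • grClass _ _ p (monomialVec b v p) (monomialVec_mem_monFil b ord v p) := by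
  induction k generalizing p with
  | zero =>
    obtain rfl := (Finsupp.degree_eq_zero_iff p).1 hp
    have h0 : monomialVec b v 0 = v := by simp [monomialVec]
    refine ⟨1, one_pos, ?_, ?_⟩
    · rw [momentVec, if_pos rfl, h0, one_smul, sub_self]
      exact zero_mem _
    · rw [momentVec, if_pos rfl, one_smul, vecT]
      exact grClass_congr _ _ rfl _ _ (by rw [h0, sub_self]; exact zero_mem _)
  | succ k ih =>
    choose! c hc hcM hcT using ih
    have hq : ∀ i ∈ p.support, (p - Finsupp.single i 1).degree = k := fun i hi => by
      have := (degree_sub_single hi).1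
      omega
    refine ⟨∑ i ∈ p.support, c (p - Finsupp.single i 1), ?_, ?_, ?_⟩
    · refine Finset.sum_pos (fun i hi => hc _ (hq i hi)) ?_
      rw [Finset.nonempty_iff_ne_empty, Ne, Finsupp.support_eq_empty]
      rintro rfl
      simp at hp
    · rw [momentVec_succ, ← Finset.sum_filter, Finset.sum_smul]
      have hsupp : (Finset.univ.filter fun i => i ∈ p.support) = p.support := by
        ext i
        simp
      rw [hsupp, ← Finset.sum_sub_distrib]
      refine sum_mem fun i hi => ?_
      have h1 := pbwPrev_le_comap (lieAct 𝔫 M) v (b i) k (hcM _ (hq i hi))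
      rw [Submodule.mem_comap, map_sub, map_nsmul] at h1
      have h2 := monomialVec_sub_mem b v (p - Finsupp.single i 1) i
      rw [(degree_sub_single hi).2, hq i hi] at h2
      have h3 := add_mem h1 (nsmul_mem (pbw_le_pbwPrev _ v (Nat.lt_succ_self k) h2)
        (c (p - Finsupp.single i 1)))
      rwa [smul_sub, sub_add_sub_cancel] at h3
    · rw [momentVec_succ, ← Finset.sum_filter, Finset.sum_smul]
      have hsupp : (Finset.univ.filter fun i => i ∈ p.support) = p.support := by
        ext i
        simp
      rw [hsupp]
      refine Finset.sum_congr rfl fun i hi => ?_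
      rw [hcT _ (hq i hi), map_nsmul, actT_basis, genT, grMap_grClass]
      congr 1
      refine grClass_congr _ _ (degree_sub_single hi).2 _ _ ?_
      have h2 := monomialVec_sub_mem b v (p - Finsupp.single i 1) i
      rw [(degree_sub_single hi).2] at h2
      rw [(degree_sub_single hi).2]
      refine pbw_le_monFilPrev b ord v ?_ h2
      have := (degree_sub_single hi).1
      omega

theorem momentVec_actA (k : ℕ) (p : Fin N →₀ ℕ) :
    momentVec b (actA 𝔫 v) (vecA 𝔫 v) k p =
      grClass _ _ k (momentVec b (lieAct 𝔫 M) v k p) (momentVec_mem_pbw b _ v k p) := by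
  induction k generalizing p with
  | zero =>
    by_cases hp : p = 0
    · subst hp
      have h1 : momentVec b (lieAct 𝔫 M) v 0 0 = v := by rw [momentVec, if_pos rfl]
      rw [momentVec, if_pos rfl, vecA]
      exact grClass_congr _ _ rfl _ _ (by rw [h1, sub_self]; exact zero_mem _)
    · rw [momentVec, if_neg hp, grClass_eq_zero]
      rw [momentVec, if_neg hp]
      exact zero_mem _
  | succ k ih =>
    have hmem : ∀ i, (if i ∈ p.support then
        lieAct 𝔫 M (b i) (momentVec b (lieAct 𝔫 M) v k (p - Finsupp.single i 1)) else 0) ∈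
          pbw (lieAct 𝔫 M) v (k + 1) := fun i => by
      split_ifs
      · exact pbw_le_comap _ v (b i) k (momentVec_mem_pbw b _ v k _)
      · exact zero_mem _
    refine Eq.trans ?_ ((grClass_sum _ _ _ _ hmem).symm.trans
      (grClass_congr _ _ rfl _ _ (by rw [momentVec_succ, sub_self]; exact zero_mem _)))
    rw [momentVec_succ]
    refine Finset.sum_congr rfl fun i _ => ?_
    by_cases hi : i ∈ p.support
    · rw [if_pos hi, ih, actA_apply, grMap_grClass]
      exact grClass_congr _ _ rfl _ _ (by rw [if_pos hi, sub_self]; exact zero_mem _)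
    · rw [if_neg hi, grClass_eq_zero]
      rw [if_neg hi]
      exact zero_mem _

variable [LieModule.IsNilpotent 𝔫 M]

variable (𝔫 M) in
/-- All sufficiently long products of operators of a nilpotent module vanish. -/
theorem exists_word_eq_zero : ∃ K : ℕ, ∀ (l : List 𝔫), l.length = K →
    (l.map (lieAct 𝔫 M)).prod = 0 := by
  obtain ⟨K, hK⟩ := (LieModule.isNilpotent_iff ℂ 𝔫 M).1 inferInstance
  refine ⟨K, fun l hl => LinearMap.ext fun m => ?_⟩
  have h : ∀ l : List 𝔫, (l.map (lieAct 𝔫 M)).prod m ∈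
      LieModule.lowerCentralSeries ℂ 𝔫 M l.length := by
    intro l
    induction l with
    | nil => simp
    | cons x l ih =>
      rw [List.map_cons, List.prod_cons, List.length_cons, LieModule.lowerCentralSeries_succ]
      exact LieSubmodule.lie_mem_lie (LieSubmodule.mem_top x) ih
  have h1 := h l
  rw [hl, hK] at h1
  simpa using h1

end LieMoments

section Nilpotency

variable {𝔫 M : Type*} [LieRing 𝔫] [LieAlgebra ℂ 𝔫] [AddCommGroup M] [Module ℂ M]
  [LieRingModule 𝔫 M] [LieModule ℂ 𝔫 M] {N : ℕ} (b : Module.Basis (Fin N) ℂ 𝔫)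
  (ord : HomogeneousOrder N) (v : M) {K : ℕ}
  (hK : ∀ (l : List 𝔫), l.length = K → (l.map (lieAct 𝔫 M)).prod = 0)

include hK

theorem lieAct_pow_eq_zero (x : 𝔫) : lieAct 𝔫 M x ^ K = 0 := by
  simpa using hK (List.replicate K x) (by simp)

theorem prod_lieAct_basis_eq_zero (l : List (Fin N)) (hl : l.length = K) :
    (l.map fun i => lieAct 𝔫 M (b i)).prod = 0 := by
  have := hK (l.map b) (by simpa using hl)
  rwa [List.map_map] at this

theorem actA_pow_eq_zero (b : Module.Basis (Fin N) ℂ 𝔫) (x : 𝔫) : actA 𝔫 v x ^ K = 0 := by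
  refine pow_eq_zero_of_words (W := Ma 𝔫 v) b (actA 𝔫 v) (fun l hl => ?_) x
  refine gr_hom_ext (W' := Ma 𝔫 v) (pbw (lieAct 𝔫 M) v) (pbwPrev (lieAct 𝔫 M) v) _ _
    fun s m hm => ?_
  obtain ⟨j, h, hj⟩ := exists_prod_grMap (pbw (lieAct 𝔫 M) v) (pbwPrev (lieAct 𝔫 M) v)
    (fun (_ : Fin N) s => s + 1) (fun i => lieAct 𝔫 M (b i)) (fun i => pbw_le_comap _ v (b i))
    (fun i => pbwPrev_le_comap _ v (b i)) l s m hm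
  refine hj.trans ?_
  rw [grClass_eq_zero, LinearMap.zero_apply]
  rw [prod_lieAct_basis_eq_zero b hK l hl]
  exact zero_mem _

theorem actT_pow_eq_zero (x : 𝔫) : actT b ord v x ^ K = 0 := by
  refine pow_eq_zero_of_words (W := Mt b ord v) b (actT b ord v) (fun l hl => ?_) x
  refine gr_hom_ext (W' := Mt b ord v) (monFil b ord v) (monFilPrev b ord v) _ _
    fun p m hm => ?_
  obtain ⟨j, h, hj⟩ := exists_prod_grMap (monFil b ord v) (monFilPrev b ord v)
    (fun (i : Fin N) p => p + Finsupp.single i 1) (fun i => lieAct 𝔫 M (b i))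
    (fun i => monFil_le_comap b ord v i) (fun i => monFilPrev_le_comap b ord v i) l p m hm
  simp only [actT_basis]
  refine hj.trans ?_
  rw [grClass_eq_zero, LinearMap.zero_apply]
  rw [prod_lieAct_basis_eq_zero b hK l hl]
  exact zero_mem _

theorem degree_lt_of_essential {p : Fin N →₀ ℕ} (hp : p ∈ essential b ord v) : p.degree < K := by
  by_contra! h
  refine hp ?_
  rw [monomialVec_eq_word, word]
  have h1 : ((expList b p).map (lieAct 𝔫 M)).prod = 0 := by
    rw [← List.take_append_drop K (expList b p), List.map_append, List.prod_append,
      hK _ (by rw [List.length_take, length_expList]; omega), zero_mul]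
  rw [h1]
  exact zero_mem _

end Nilpotency

section LieInitial

variable {𝔫 M : Type*} [LieRing 𝔫] [LieAlgebra ℂ 𝔫] [AddCommGroup M] [Module ℂ M]
  [LieRingModule 𝔫 M] [LieModule ℂ 𝔫 M] {N : ℕ} (b : Module.Basis (Fin N) ℂ 𝔫)
  (ord : HomogeneousOrder N) (v : M) (K : ℕ)

/-- The space of orbit polynomials of `M^a` is spanned by initial forms, with respect to the
degree, of orbit polynomials of `M`. -/
theorem orbitSpace_actA_le :
    orbitSpace b (actA 𝔫 v) (vecA 𝔫 v) K ≤ Submodule.span ℂ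
      {g | g ∈ orbitSpace b (actA 𝔫 v) (vecA 𝔫 v) K ∧
        IsInitial (fun _ => 1) (orbitSpace b (lieAct 𝔫 M) v K) g} := by
  rintro _ ⟨η, rfl⟩
  rw [orbitPol, LinearMap.sum_apply]
  refine sum_mem fun s hs => ?_
  rw [Finset.mem_range] at hs
  obtain ⟨ξ, hξ⟩ := LinearMap.exists_extend
    ((η.comp (DirectSum.lof ℂ ℕ (fun s => pbw (lieAct 𝔫 M) v s ⧸
      (pbwPrev (lieAct 𝔫 M) v s).submoduleOf (pbw (lieAct 𝔫 M) v s)) s)).comp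
        (Submodule.mkQ ((pbwPrev (lieAct 𝔫 M) v s).submoduleOf (pbw (lieAct 𝔫 M) v s))))
  have hξ' : ∀ m (hm : m ∈ pbw (lieAct 𝔫 M) v s), ξ m = η (grClass _ _ s m hm) := fun m hm =>
    congrArg (fun k => k ⟨m, hm⟩) hξ
  have hξ0 : ∀ m ∈ pbwPrev (lieAct 𝔫 M) v s, ξ m = 0 := fun m hm => by
    have hm' : m ∈ pbw (lieAct 𝔫 M) v s :=
      (Submodule.span_mono fun _ ⟨l, hl, h⟩ => ⟨l, hl.le, h⟩ :
        pbwPrev (lieAct 𝔫 M) v s ≤ pbw (lieAct 𝔫 M) v s) hm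
    rw [hξ' m hm', grClass_eq_zero _ _ _ hm, map_zero]
  have hg : ((s.factorial : ℂ)⁻¹ • powPol b (actA 𝔫 v) (vecA 𝔫 v) s) η =
      orbitPol b (actA 𝔫 v) (vecA 𝔫 v) K (grDual _ _ s ξ hξ0) := by
    refine MvPolynomial.ext _ _ fun p => ?_
    rw [LinearMap.smul_apply, MvPolynomial.coeff_smul, coeff_powPol, coeff_orbitPol, smul_eq_mul]
    by_cases hp : p.degree = s
    · rw [hp, if_pos hs, momentVec_actA, grDual_same, hξ']
    · rw [momentVec_eq_zero b _ _ hp, map_zero, mul_zero]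
      split_ifs
      · rw [momentVec_actA, grDual_of_ne _ _ _ _ _ hp, mul_zero]
      · rfl
  refine Submodule.subset_span ⟨hg ▸ ⟨_, rfl⟩, ?_⟩
  have hdeg : ∀ p : Fin N →₀ ℕ, Finsupp.weight (fun _ => 1) p = p.degree := fun p => by
    rw [Finsupp.degree_eq_weight_one]
  have hcoeff : ∀ p : Fin N →₀ ℕ, p.degree < s →
      (orbitPol b (lieAct 𝔫 M) v K ξ).coeff p = 0 := fun p hp => by
    rw [coeff_orbitPol, if_pos (hp.trans hs),
      hξ0 _ (pbw_le_pbwPrev _ v hp (momentVec_mem_pbw b _ v _ p)), mul_zero]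
  obtain ⟨F, hF, hF0⟩ := exists_initial (fun _ => 1) (orbitPol b (lieAct 𝔫 M) v K ξ) s
    fun p hp => by
      rw [hdeg]
      by_contra! h
      exact hp (hcoeff p h)
  refine ⟨_, ⟨ξ, rfl⟩, s, F, hF, ?_⟩
  rw [hg]
  refine MvPolynomial.ext _ _ fun p => ?_
  rw [hF0, hdeg, coeff_orbitPol, coeff_orbitPol]
  by_cases hp : p.degree = s
  · rw [if_pos hp, hp, if_pos hs, if_pos hs, momentVec_actA, grDual_same]
  · rw [if_neg hp]
    split_ifs
    · rw [momentVec_actA, grDual_of_ne _ _ _ _ _ hp, mul_zero]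
    · rfl

/-- A linear form that vanishes below `v(p)` takes the same value on `v(p)` and on the coefficient
of `x^p`, up to a positive factor. -/
theorem exists_dual_momentVec_eq {p : Fin N →₀ ℕ} (ξ : Module.Dual ℂ M)
    (hξ : ∀ m ∈ monFilPrev b ord v p, ξ m = 0) :
    ∃ c : ℕ, 0 < c ∧ ξ (momentVec b (lieAct 𝔫 M) v p.degree p) = c * ξ (monomialVec b v p) := by
  obtain ⟨c, hc, h, -⟩ := exists_momentVec_eq b ord v p.degree p rfl
  refine ⟨c, hc, ?_⟩
  have := hξ _ (pbwPrev_le_monFilPrev b ord v p h)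
  rw [map_sub, map_nsmul, sub_eq_zero, nsmul_eq_mul] at this
  exact this

/-- For an essential multi-exponent `p`, a linear form that detects `v(p)` and vanishes on all
smaller ordered monomials. -/
theorem exists_dual_of_essential {p : Fin N →₀ ℕ} (hp : p ∈ essential b ord v) :
    ∃ ξ : Module.Dual ℂ M, ξ (monomialVec b v p) ≠ 0 ∧
      ∀ m ∈ monFilPrev b ord v p, ξ m = 0 := by
  obtain ⟨ξ, h1, h2⟩ := Submodule.exists_le_ker_of_notMem hp
  exact ⟨ξ, h1, fun m hm => h2 hm⟩

theorem momentVec_mem_monFil (p : Fin N →₀ ℕ) :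
    momentVec b (lieAct 𝔫 M) v p.degree p ∈ monFil b ord v p := by
  obtain ⟨c, -, h, -⟩ := exists_momentVec_eq b ord v p.degree p rfl
  have h1 := monFilPrev_le_monFil b ord v p (pbwPrev_le_monFilPrev b ord v p h)
  simpa using add_mem h1 (nsmul_mem (monomialVec_mem_monFil b ord v p) c)

variable {K}

/-- An orbit polynomial of `M` for a linear form that detects `v(p)` and vanishes on the smaller
ordered monomials has `x^p` as its only term of lowest weight. -/
theorem isInitial_of_essential {ω : Fin N → ℕ}
    (hω : ∀ p q : Fin N →₀ ℕ, p.degree < K → q.degree < K →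
      ord.toSyn p < ord.toSyn q → Finsupp.weight ω p < Finsupp.weight ω q)
    {p : Fin N →₀ ℕ} (hp : p ∈ essential b ord v) (hpK : p.degree < K) :
    IsInitial ω (orbitSpace b (lieAct 𝔫 M) v K) (MvPolynomial.monomial p 1) := by
  obtain ⟨ξ, h1, h2⟩ := exists_dual_of_essential b ord v hp
  obtain ⟨c, hc, h3⟩ := exists_dual_momentVec_eq b ord v ξ h2
  refine isInitial_monomial ω (f := orbitPol b (lieAct 𝔫 M) v K ξ)
    (LinearMap.mem_range_self _ ξ) ?_ fun q hq hqp => ?_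
  · rw [coeff_orbitPol, if_pos hpK, h3]
    exact mul_ne_zero (inv_ne_zero (Nat.cast_ne_zero.2 (Nat.factorial_ne_zero _)))
      (mul_ne_zero (Nat.cast_ne_zero.2 hc.ne') h1)
  · rw [coeff_orbitPol] at hq
    split_ifs at hq with hqK
    · refine hω p q hpK hqK (lt_of_le_of_ne (not_lt.1 fun h => hq ?_) fun h =>
        hqp (ord.toSyn.injective h).symm)
      rw [h2 _ (monFil_le_monFilPrev b ord v q p h (momentVec_mem_monFil b ord v q)), mul_zero]
    · exact absurd rfl hq

/-- The analogue for `M^a`, where the linear form is taken on the component of degree `|p|`. -/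
theorem isInitial_actA_of_essential {ω : Fin N → ℕ}
    (hω : ∀ p q : Fin N →₀ ℕ, p.degree < K → q.degree < K →
      ord.toSyn p < ord.toSyn q → Finsupp.weight ω p < Finsupp.weight ω q)
    {p : Fin N →₀ ℕ} (hp : p ∈ essential b ord v) (hpK : p.degree < K) :
    IsInitial ω (orbitSpace b (actA 𝔫 v) (vecA 𝔫 v) K) (MvPolynomial.monomial p 1) := by
  obtain ⟨ξ, h1, h2⟩ := exists_dual_of_essential b ord v hp
  have h0 : ∀ m ∈ pbwPrev (lieAct 𝔫 M) v p.degree, ξ m = 0 := fun m hm =>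
    h2 m (pbwPrev_le_monFilPrev b ord v p hm)
  obtain ⟨c, hc, h3⟩ := exists_dual_momentVec_eq b ord v ξ h2
  refine isInitial_monomial ω (f := orbitPol b (actA 𝔫 v) (vecA 𝔫 v) K
    (grDual _ _ p.degree ξ h0))
      (LinearMap.mem_range_self _ _) ?_ fun q hq hqp => ?_
  · rw [coeff_orbitPol, if_pos hpK, momentVec_actA, grDual_same, h3]
    exact mul_ne_zero (inv_ne_zero (Nat.cast_ne_zero.2 (Nat.factorial_ne_zero _)))
      (mul_ne_zero (Nat.cast_ne_zero.2 hc.ne') h1)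
  · rw [coeff_orbitPol] at hq
    split_ifs at hq with hqK
    · refine hω p q hpK hqK (lt_of_le_of_ne (not_lt.1 fun h => hq ?_) fun h =>
        hqp (ord.toSyn.injective h).symm)
      rw [momentVec_actA]
      by_cases hd : q.degree = p.degree
      · have h4 : ∀ k (hk : k = p.degree) m (hm : m ∈ pbw (lieAct 𝔫 M) v k), ξ m = 0 →
            grDual _ _ p.degree ξ h0 (grClass _ _ k m hm) = 0 := by
          rintro _ rfl m hm h
          rw [grDual_same, h]
        rw [h4 _ hd _ _ (h2 _ (monFil_le_monFilPrev b ord v q p h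
          (momentVec_mem_monFil b ord v q))), mul_zero]
      · rw [grDual_of_ne _ _ _ _ _ hd, mul_zero]
    · exact absurd rfl hq

/-- The orbit polynomials of `M^t` are the combinations of the essential monomials. -/
theorem orbitSpace_actT (hK : ∀ p ∈ essential b ord v, p.degree < K) :
    orbitSpace b (actT b ord v) (vecT b ord v) K =
      Submodule.span ℂ ((fun p => MvPolynomial.monomial p (1 : ℂ)) '' essential b ord v) := by
  have hmom := fun p : Fin N →₀ ℕ => exists_momentVec_eq b ord v p.degree p rfl
  choose c hc _ hcT using hmom
  refine le_antisymm ?_ (Submodule.span_le.2 ?_)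
  · rintro _ ⟨η, rfl⟩
    rw [← MvPolynomial.support_sum_monomial_coeff (orbitPol b (actT b ord v) (vecT b ord v) K η)]
    refine sum_mem fun p hp => ?_
    rw [MvPolynomial.mem_support_iff, coeff_orbitPol] at hp
    split_ifs at hp with hpK
    · have hpe : p ∈ essential b ord v := fun h => hp (by
        rw [hcT, grClass_eq_zero _ _ _ h, smul_zero, map_zero, mul_zero])
      have : MvPolynomial.monomial p
          ((orbitPol b (actT b ord v) (vecT b ord v) K η).coeff p) =
          ((orbitPol b (actT b ord v) (vecT b ord v) K η).coeff p) •
            MvPolynomial.monomial p (1 : ℂ) := by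
        rw [MvPolynomial.smul_monomial, smul_eq_mul, mul_one]
      rw [this]
      exact Submodule.smul_mem _ _ (Submodule.subset_span ⟨p, hpe, rfl⟩)
    · exact absurd rfl hp
  · rintro _ ⟨p, hp, rfl⟩
    obtain ⟨ξ, h1, h2⟩ := exists_dual_of_essential b ord v hp
    have hne : ((p.degree.factorial : ℂ)⁻¹) * (c p * ξ (monomialVec b v p)) ≠ 0 :=
      mul_ne_zero (inv_ne_zero (Nat.cast_ne_zero.2 (Nat.factorial_ne_zero _)))
        (mul_ne_zero (Nat.cast_ne_zero.2 (hc p).ne') h1)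
    have h3 : orbitPol b (actT b ord v) (vecT b ord v) K (grDual _ _ p ξ h2) =
        (((p.degree.factorial : ℂ)⁻¹) * (c p * ξ (monomialVec b v p))) •
          MvPolynomial.monomial p (1 : ℂ) := by
      refine MvPolynomial.ext _ _ fun q => ?_
      rw [coeff_orbitPol, MvPolynomial.coeff_smul, MvPolynomial.coeff_monomial, hcT, map_nsmul]
      by_cases hqp : p = q
      · subst hqp
        rw [if_pos (hK p hp), if_pos rfl, grDual_same, nsmul_eq_mul, smul_eq_mul, mul_one]
      · rw [if_neg hqp, grDual_of_ne _ _ _ _ _ (Ne.symm hqp)]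
        simp
    have h4 := (orbitSpace b (actT b ord v) (vecT b ord v) K).smul_mem
      (((p.degree.factorial : ℂ)⁻¹) * (c p * ξ (monomialVec b v p)))⁻¹
      (h3 ▸ LinearMap.mem_range_self _ (grDual _ _ p ξ h2))
    rwa [smul_smul, inv_mul_cancel₀ hne, one_smul] at h4

end LieInitial

/-! ### Tensor powers and Cartan components -/

section TensorPowers

variable {V W : Type*} [AddCommGroup V] [Module ℂ V] [AddCommGroup W] [Module ℂ W] (n : ℕ)

/-- The operator `1 ⊗ ⋯ ⊗ T ⊗ ⋯ ⊗ 1`, with `T` in place `i`. -/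
def slot (i : Fin n) (T : Module.End ℂ W) : Module.End ℂ (⨂[ℂ]^n W) :=
  PiTensorProduct.map (Function.update (fun _ => LinearMap.id) i T)

theorem slot_one (i : Fin n) : slot n i (1 : Module.End ℂ W) = 1 := by
  have h : Function.update (fun _ : Fin n => (LinearMap.id : Module.End ℂ W)) i 1 = fun _ => 1 :=
    Function.update_eq_self_iff.2 rfl
  rw [slot, h]
  exact PiTensorProduct.map_one

theorem slot_mul (i : Fin n) (S T : Module.End ℂ W) :
    slot n i (S * T) = slot n i S * slot n i T := by
  have h : Function.update (fun _ : Fin n => (LinearMap.id : Module.End ℂ W)) i (S * T) =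
      fun j => (Function.update (fun _ : Fin n => (LinearMap.id : Module.End ℂ W)) i S j) *
        (Function.update (fun _ : Fin n => (LinearMap.id : Module.End ℂ W)) i T j) := by
    ext1 j
    by_cases hj : j = i
    · subst hj
      simp
    · simp only [Function.update_of_ne hj]
      rfl
  rw [slot, h]
  exact PiTensorProduct.map_mul _ _

theorem slot_add (i : Fin n) (S T : Module.End ℂ W) :
    slot n i (S + T) = slot n i S + slot n i T :=
  PiTensorProduct.map_update_add (fun _ : Fin n => (LinearMap.id : Module.End ℂ W)) i S T

/-- The homomorphism that sends `T` to `1 ⊗ ⋯ ⊗ T ⊗ ⋯ ⊗ 1`, with `T` in place `i`. -/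
def slotHom (i : Fin n) : Module.End ℂ W →+* Module.End ℂ (⨂[ℂ]^n W) :=
  RingHom.mk' ⟨⟨slot n i, slot_one n i⟩, slot_mul n i⟩ (slot_add n i)

variable {n}

theorem slotHom_tprod (i : Fin n) (T : Module.End ℂ W) (w : Fin n → W) :
    slotHom n i T (PiTensorProduct.tprod ℂ w) =
      PiTensorProduct.tprod ℂ (Function.update w i (T (w i))) := by
  refine (PiTensorProduct.map_tprod _ w).trans ?_
  congr 1
  ext1 j
  by_cases hj : j = i
  · subst hj
    simp
  · simp [Function.update_of_ne hj]

theorem slotHom_commute {i j : Fin n} (h : i ≠ j) (S T : Module.End ℂ W) :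
    Commute (slotHom n i S) (slotHom n j T) := by
  refine PiTensorProduct.ext (MultilinearMap.ext fun w => ?_)
  change slotHom n i S (slotHom n j T (PiTensorProduct.tprod ℂ w)) =
    slotHom n j T (slotHom n i S (PiTensorProduct.tprod ℂ w))
  rw [slotHom_tprod, slotHom_tprod, slotHom_tprod, slotHom_tprod, Function.update_of_ne h,
    Function.update_of_ne h.symm, Function.update_comm h]

theorem tensorOp_eq (T : Module.End ℂ W) : tensorOp n T = ∑ i, slotHom n i T := rfl

theorem slotHom_smul (i : Fin n) (c : ℂ) (T : Module.End ℂ W) :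
    slotHom n i (c • T) = c • slotHom n i T :=
  PiTensorProduct.map_update_smul (fun _ : Fin n => (LinearMap.id : Module.End ℂ W)) i c T

variable (n) in
/-- The diagonal action on the tensor power, as a linear map. -/
def tensorAct (ρ : V →ₗ[ℂ] Module.End ℂ W) : V →ₗ[ℂ] Module.End ℂ (⨂[ℂ]^n W) where
  toFun x := tensorOp n (ρ x)
  map_add' x y := by simp only [tensorOp_eq, map_add, Finset.sum_add_distrib]
  map_smul' c x := by
    simp only [tensorOp_eq, map_smul, slotHom_smul, Finset.smul_sum, RingHom.id_apply]

theorem tensorOp_commutator (S T : Module.End ℂ W) :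
    tensorOp n (S * T - T * S) = tensorOp n S * tensorOp n T - tensorOp n T * tensorOp n S := by
  have h : ∀ i, slotHom n i (S * T - T * S) =
      slotHom n i S * (∑ j, slotHom n j T) - (∑ j, slotHom n j T) * slotHom n i S := fun i => by
    rw [Finset.mul_sum, Finset.sum_mul, ← Finset.sum_sub_distrib,
      Finset.sum_eq_single i, map_sub, map_mul, map_mul]
    · exact fun j _ hj => sub_eq_zero.2 (slotHom_commute hj.symm S T)
    · simp
  rw [tensorOp_eq, tensorOp_eq, tensorOp_eq, Finset.sum_mul, Finset.mul_sum,
    ← Finset.sum_sub_distrib]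
  exact Finset.sum_congr rfl fun i _ => h i

theorem tensorOp_isNilpotent {T : Module.End ℂ W} (h : IsNilpotent T) :
    IsNilpotent (∑ i, slotHom n i T) :=
  Commute.isNilpotent_sum (fun i _ => h.map (slotHom n i)) fun i j _ _ => by
    by_cases hij : i = j
    · subst hij
      exact Commute.refl _
    · exact slotHom_commute hij T T

/-- The exponential of the diagonal action is the diagonal action of the exponential. -/
theorem expEnd_tensorOp {T : Module.End ℂ W} (h : IsNilpotent T) (w : W) :
    expEnd (tensorOp n T) (PiTensorProduct.tprod ℂ fun _ => w) =
      PiTensorProduct.tprod ℂ fun _ => expEnd T w := by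
  classical
  let : Module ℚ (Module.End ℂ W) := Module.compHom _ (algebraMap ℚ ℂ)
  let : Module ℚ (Module.End ℂ (⨂[ℂ]^n W)) := Module.compHom _ (algebraMap ℚ ℂ)
  have hc : ∀ i j : Fin n, Commute (slotHom n i T) (slotHom n j T) := fun i j => by
    by_cases hij : i = j
    · rw [hij]
    · exact slotHom_commute hij T T
  have key : ∀ s : Finset (Fin n), IsNilpotent.exp (∑ i ∈ s, slotHom n i T)
      (PiTensorProduct.tprod ℂ fun _ => w) =
        PiTensorProduct.tprod ℂ fun i => if i ∈ s then IsNilpotent.exp T w else w := by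
    intro s
    induction s using Finset.induction_on with
    | empty => simp
    | insert i s hi ih =>
      rw [Finset.sum_insert hi, IsNilpotent.exp_add_of_commute
        (Commute.sum_right _ _ _ fun j _ => hc i j) (h.map _)
        (Commute.isNilpotent_sum (fun i _ => h.map (slotHom n i)) fun i j _ _ => hc i j),
        Module.End.mul_apply, ih, ← IsNilpotent.map_exp h, slotHom_tprod, if_neg hi]
      congr 1
      ext1 j
      by_cases hj : j = i
      · subst hj
        simp
      · simp [hj]
  have := key Finset.univ
  simpa using! this

end TensorPowers

section OrbitSpacePowers

variable {N : ℕ} {V W : Type*} [AddCommGroup V] [Module ℂ V] [AddCommGroup W] [Module ℂ W]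
  [FiniteDimensional ℂ W] (b : Module.Basis (Fin N) ℂ V) (ρ : V →ₗ[ℂ] Module.End ℂ W) (w : W)

/-- The orbit polynomials of the tensor power `W^{⊗ n}` are spanned by the products of `n` orbit
polynomials of `W`, because `exp` acts diagonally on `w ⊗ ⋯ ⊗ w`. -/
theorem orbitSpace_tensorAct (n : ℕ) {K K' : ℕ} (hK : ∀ x, ρ x ^ K = 0)
    (hK' : ∀ x, tensorAct n ρ x ^ K' = 0) :
    orbitSpace b (tensorAct n ρ) (PiTensorProduct.tprod ℂ fun _ => w) K' =
      orbitSpace b ρ w K ^ n := by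
  have hprod : ∀ ξ : Fin n → Module.Dual ℂ W,
      orbitPol b (tensorAct n ρ) (PiTensorProduct.tprod ℂ fun _ => w) K'
        (PiTensorProduct.dualDistrib (PiTensorProduct.tprod ℂ ξ)) =
          ∏ i, orbitPol b ρ w K (ξ i) := fun ξ => by
    refine MvPolynomial.funext fun c => ?_
    rw [eval_orbitPol b _ _ hK', map_prod]
    refine (congrArg _ (expEnd_tensorOp ⟨K, hK _⟩ w)).trans ?_
    rw [PiTensorProduct.dualDistrib_apply]
    exact Finset.prod_congr rfl fun i _ => (eval_orbitPol b ρ w hK (ξ i) c).symm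
  have hsurj : LinearMap.range (PiTensorProduct.dualDistrib (R := ℂ) (M := fun _ : Fin n => W)) =
      ⊤ :=
    LinearMap.range_eq_top.2 (PiTensorProduct.dualDistribEquivOfBasis
      fun _ : Fin n => Module.finBasis ℂ W).surjective
  have h1 : orbitSpace b (tensorAct n ρ) (PiTensorProduct.tprod ℂ fun _ => w) K' =
      Submodule.span ℂ (Set.range fun ξ : Fin n → Module.Dual ℂ W =>
        ∏ i, orbitPol b ρ w K (ξ i)) := by
    rw [orbitSpace, LinearMap.range_eq_map, ← hsurj, LinearMap.range_eq_map,
      ← PiTensorProduct.span_tprod_eq_top, Submodule.map_span, Submodule.map_span,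
      ← Set.range_comp, ← Set.range_comp]
    congr 2
    exact funext hprod
  rw [h1, Submodule.pow_eq_span_pow_set]
  congr 1
  ext g
  rw [Set.mem_pow]
  constructor
  · rintro ⟨ξ, rfl⟩
    exact ⟨fun i => ⟨_, LinearMap.mem_range_self _ (ξ i)⟩, by rw [List.prod_ofFn]⟩
  · rintro ⟨f, rfl⟩
    choose ξ hξ using fun i => (f i).2
    exact ⟨ξ, by simp only [hξ, List.prod_ofFn]⟩

theorem exists_tensorAct_pow_eq_zero (n : ℕ) {K : ℕ} (hK : ∀ x, ρ x ^ K = 0) :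
    ∃ K', ∀ x, tensorAct n ρ x ^ K' = 0 :=
  ⟨Module.finrank ℂ (⨂[ℂ]^n W), fun x => by
    have h : IsNilpotent (tensorAct n ρ x) := tensorOp_isNilpotent ⟨K, hK x⟩
    obtain ⟨k, hk⟩ := h
    refine LinearMap.ext fun u => ?_
    have h2 : u ∈ LinearMap.ker (tensorAct n ρ x ^ k) := by rw [hk]; trivial
    exact Module.End.ker_pow_le_ker_pow_finrank _ _ h2⟩

end OrbitSpacePowers

section CyclicDimension

variable {𝔫 M : Type*} [LieRing 𝔫] [LieAlgebra ℂ 𝔫] [AddCommGroup M] [Module ℂ M]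
  [LieRingModule 𝔫 M] [LieModule ℂ 𝔫 M] [FiniteDimensional ℂ M] {N : ℕ}
  (b : Module.Basis (Fin N) ℂ 𝔫) (ord : HomogeneousOrder N) (v : M)

include ord in
/-- By the Poincaré–Birkhoff–Witt theorem the coefficients of `exp(x) v` span the cyclic module: the
coefficient of `x^p` is a multiple of `v(p)` up to lower order, and the `v(p)` span. -/
theorem ker_orbitPol {K : ℕ} (hK : ∀ x, lieAct 𝔫 M x ^ K = 0) :
    LinearMap.ker (orbitPol b (lieAct 𝔫 M) v K) =
      (cyclicSpan (lieAct 𝔫 M) v).dualAnnihilator := by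
  ext ξ
  rw [LinearMap.mem_ker, Submodule.mem_dualAnnihilator]
  constructor
  · intro h
    have hmom : ∀ s p, ξ (momentVec b (lieAct 𝔫 M) v s p) = 0 := by
      intro s p
      by_cases hp : p.degree = s
      · subst hp
        by_cases hs : p.degree < K
        · have h1 := coeff_orbitPol b (lieAct 𝔫 M) v K ξ p
          rw [h, if_pos hs, MvPolynomial.coeff_zero] at h1
          exact (mul_eq_zero.1 h1.symm).resolve_left
            (inv_ne_zero (Nat.cast_ne_zero.2 (Nat.factorial_ne_zero _)))
        · rw [momentVec_eq_zero_of_pow b _ v (fun x => pow_eq_zero_of_le (not_lt.1 hs) (hK x)),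
            map_zero]
      · rw [momentVec_eq_zero b _ v hp, map_zero]
    have hprev : ∀ s, pbwPrev (lieAct 𝔫 M) v s ≤ LinearMap.ker ξ := by
      intro s
      induction s with
      | zero =>
        refine Submodule.span_le.2 ?_
        rintro _ ⟨l, hl, -⟩
        exact absurd hl (Nat.not_lt_zero _)
      | succ s ih =>
        have h1 : pbwPrev (lieAct 𝔫 M) v (s + 1) ≤ pbw (lieAct 𝔫 M) v s :=
          Submodule.span_mono fun _ ⟨l, hl, h⟩ => ⟨l, Nat.lt_succ_iff.1 hl, h⟩
        refine h1.trans ((pbw_le_span b v s).trans (Submodule.span_le.2 ?_))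
        rintro _ ⟨q, hq, rfl⟩
        obtain ⟨c, hc, h2, -⟩ := exists_momentVec_eq b ord v q.degree q rfl
        have h3 : pbwPrev (lieAct 𝔫 M) v q.degree ≤ pbwPrev (lieAct 𝔫 M) v s :=
          Submodule.span_mono fun _ ⟨l, hl, h⟩ => ⟨l, hl.trans_le hq, h⟩
        have h4 := ih (h3 h2)
        rw [LinearMap.mem_ker, map_sub, hmom, zero_sub, neg_eq_zero, map_nsmul,
          smul_eq_zero] at h4
        exact h4.resolve_left hc.ne'
    intro m hm
    refine (Submodule.span_le.2 ?_ : cyclicSpan (lieAct 𝔫 M) v ≤ LinearMap.ker ξ) hm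
    rintro _ ⟨l, rfl⟩
    exact hprev _ (word_mem_pbwPrev _ v l (Nat.lt_succ_self _))
  · intro h
    refine MvPolynomial.ext _ _ fun p => ?_
    rw [coeff_orbitPol, MvPolynomial.coeff_zero]
    have h1 : pbw (lieAct 𝔫 M) v p.degree ≤ cyclicSpan (lieAct 𝔫 M) v :=
      Submodule.span_mono fun _ ⟨l, _, h⟩ => ⟨l, h⟩
    rw [h _ (h1 (momentVec_mem_pbw b _ v _ p)), mul_zero, ite_self]

include ord in
theorem finrank_orbitSpace {K : ℕ} (hK : ∀ x, lieAct 𝔫 M x ^ K = 0) :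
    Module.finrank ℂ (orbitSpace b (lieAct 𝔫 M) v K) =
      Module.finrank ℂ (cyclicSpan (lieAct 𝔫 M) v) := by
  have h1 := LinearMap.finrank_range_add_finrank_ker (orbitPol b (lieAct 𝔫 M) v K)
  rw [ker_orbitPol b ord v hK, Subspace.dual_finrank_eq,
    ← Subspace.finrank_add_finrank_dualAnnihilator_eq (cyclicSpan (lieAct 𝔫 M) v)] at h1
  exact Nat.add_right_cancel h1

/-- The dimension formula for an action given by operators rather than by a Lie module instance. -/
theorem finrank_orbitSpace_of_lie {U : Type*} [AddCommGroup U] [Module ℂ U]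
    [FiniteDimensional ℂ U] (ord : HomogeneousOrder N) (ρ : 𝔫 →ₗ[ℂ] Module.End ℂ U) (u : U)
    (hρ : ∀ x y, ρ ⁅x, y⁆ = ρ x * ρ y - ρ y * ρ x) {K : ℕ} (hK : ∀ x, ρ x ^ K = 0) :
    Module.finrank ℂ (orbitSpace b ρ u K) = Module.finrank ℂ (cyclicSpan ρ u) := by
  let : LieRingModule 𝔫 U :=
    { bracket := fun x m => ρ x m
      add_lie := fun x y m => by
        rw [map_add, LinearMap.add_apply]
      lie_add := fun x => map_add (ρ x)
      leibniz_lie := fun x y m => by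
        change ρ x (ρ y m) = ρ ⁅x, y⁆ m + ρ y (ρ x m)
        rw [hρ, LinearMap.sub_apply, Module.End.mul_apply, Module.End.mul_apply, sub_add_cancel] }
  have : LieModule ℂ 𝔫 U :=
    { smul_lie := fun c x m => by
        change ρ (c • x) m = c • ρ x m
        rw [map_smul, LinearMap.smul_apply]
      lie_smul := fun c x => map_smul (ρ x) c }
  exact finrank_orbitSpace (M := U) b ord u hK

include ord in
/-- The `n`-th component of the homogeneous coordinate ring of the orbit closure has the dimension
of the Cartan component `M^{⊙ n}`. -/
theorem finrank_orbitSpace_pow {K : ℕ} (hK : ∀ x, lieAct 𝔫 M x ^ K = 0) (n : ℕ) :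
    Module.finrank ℂ (orbitSpace b (lieAct 𝔫 M) v K ^ n : Submodule ℂ (Pol N)) =
      Module.finrank ℂ (cartanPower (lieAct 𝔫 M) v n) := by
  obtain ⟨K', hK'⟩ := exists_tensorAct_pow_eq_zero (lieAct 𝔫 M) n hK
  rw [← orbitSpace_tensorAct b (lieAct 𝔫 M) v n hK hK']
  refine finrank_orbitSpace_of_lie b ord (tensorAct n (lieAct 𝔫 M)) _ (fun x y => ?_) hK'
  refine Eq.trans ?_ (tensorOp_commutator (lieAct 𝔫 M x) (lieAct 𝔫 M y))
  refine congrArg (tensorOp n) (LinearMap.ext fun m => ?_)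
  simp only [LinearMap.sub_apply, Module.End.mul_apply, lieAct_apply, lie_lie]

end CyclicDimension

/-! ### Minkowski sums and orbit closures -/

section Minkowski

variable {N : ℕ}

theorem image_monomial_pow (S : Set (Fin N →₀ ℕ)) (n : ℕ) :
    ((fun p => MvPolynomial.monomial p (1 : ℂ)) '' S) ^ n =
      (fun p => MvPolynomial.monomial p (1 : ℂ)) '' minkowski n S := by
  ext g
  rw [Set.mem_pow]
  constructor
  · rintro ⟨f, rfl⟩
    choose p hp hpf using fun i => (f i).2
    refine ⟨∑ i, p i, ⟨p, hp, rfl⟩, ?_⟩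
    simp only [List.prod_ofFn, ← hpf, MvPolynomial.monomial_sum_one]
  · rintro ⟨_, ⟨p, hp, rfl⟩, rfl⟩
    refine ⟨fun i => ⟨_, p i, hp i, rfl⟩, ?_⟩
    simp only [List.prod_ofFn, MvPolynomial.monomial_sum_one]

theorem finrank_span_monomial_pow (S : Set (Fin N →₀ ℕ)) (n : ℕ) :
    Module.finrank ℂ (Submodule.span ℂ ((fun p => MvPolynomial.monomial p (1 : ℂ)) '' S) ^ n :
      Submodule ℂ (Pol N)) = (minkowski n S).ncard := by
  have hlin : LinearIndependent ℂ fun p : Fin N →₀ ℕ => MvPolynomial.monomial p (1 : ℂ) := by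
    have := (MvPolynomial.basisMonomials (Fin N) ℂ).linearIndependent
    rwa [MvPolynomial.coe_basisMonomials] at this
  rw [Submodule.span_pow, image_monomial_pow, Module.finrank, rank_span_set
    (hlin.linearIndepOn_id.mono (Set.image_subset_range _ _)), ← Nat.card, Nat.card_coe_set_eq,
    Set.ncard_image_of_injective _ hlin.injective]

end Minkowski

section OrbitDegenerations

open AlgebraicGeometry CategoryTheory

variable {N : ℕ} {V W W' : Type*} [AddCommGroup V] [Module ℂ V] [AddCommGroup W] [Module ℂ W]
  [FiniteDimensional ℂ W] [AddCommGroup W'] [Module ℂ W'] [FiniteDimensional ℂ W']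
  (b : Module.Basis (Fin N) ℂ V) {ρ : V →ₗ[ℂ] Module.End ℂ W} {w : W}
  {ρ' : V →ₗ[ℂ] Module.End ℂ W'} {w' : W'} {K : ℕ} (ω : Fin N → ℕ)

/-- The orbit closure of `w` degenerates to that of `w'` if the orbit polynomials of `w'` are
spanned by initial forms of those of `w` and the dimensions of all powers agree. -/
theorem hasFlatDegenerations_orbit (hK : ∀ x, ρ x ^ K = 0) (hK' : ∀ x, ρ' x ^ K = 0)
    (h : orbitSpace b ρ' w' K ≤ Submodule.span ℂ
      {g | g ∈ orbitSpace b ρ' w' K ∧ IsInitial ω (orbitSpace b ρ w K) g})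
    (hdim : ∀ n, Module.finrank ℂ (orbitSpace b ρ w K ^ n : Submodule ℂ (Pol N)) =
      Module.finrank ℂ (orbitSpace b ρ' w' K ^ n : Submodule ℂ (Pol N)))
    (h0 : orbitSpace b ρ w K ≠ ⊥) :
    HasAffineFlatDegeneration (affineCone ρ w) (affineCone ρ' w') ∧
      HasProperFlatDegeneration (flagVariety ρ w) (flagVariety ρ' w') := by
  obtain ⟨ι, _, F, f, m, hf, hF, hB⟩ := exists_initial_family ω (orbitSpace_fg b ρ' w' K) h
  have h1 := hdim 1
  rw [pow_one, pow_one] at h1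
  have : FiniteDimensional ℂ (orbitSpace b ρ w K) := Module.Finite.iff_fg.2 (orbitSpace_fg b ρ w K)
  refine hasFlatDegenerations_of_initial ω (orbitSpace_fg b ρ w K) hf hF hB hdim
    (coordRingEquiv b ρ w K hK) (mem_coneDeg_iff b ρ w K hK) (coordRingEquiv b ρ' w' K hK')
    (mem_coneDeg_iff b ρ' w' K hK') fun hbot => h0 ?_
  rw [hbot, finrank_bot] at h1
  exact Submodule.finrank_eq_zero.1 h1

end OrbitDegenerations

end Favourable

end

open Favourable in
theorem mainTheorem2 {𝔫 M : Type*} [LieRing 𝔫] [LieAlgebra ℂ 𝔫] [LieRing.IsNilpotent 𝔫]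
    [AddCommGroup M] [Module ℂ M] [FiniteDimensional ℂ M]
    [LieRingModule 𝔫 M] [LieModule ℂ 𝔫 M] [LieModule.IsNilpotent 𝔫 M]
    {N : ℕ} (b : Module.Basis (Fin N) ℂ 𝔫) (ord : HomogeneousOrder N)
    (v : M) (hv : v ≠ 0) (hM : IsFavourable b ord v) :
    (HasAffineFlatDegeneration (affineCone (lieAct 𝔫 M) v) (affineCone (actA 𝔫 v) (vecA 𝔫 v)) ∧
      HasAffineFlatDegeneration (affineCone (lieAct 𝔫 M) v)
        (affineCone (actT b ord v) (vecT b ord v)) ∧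
      HasAffineFlatDegeneration (affineCone (actA 𝔫 v) (vecA 𝔫 v))
        (affineCone (actT b ord v) (vecT b ord v))) ∧
    (HasProperFlatDegeneration (flagVariety (lieAct 𝔫 M) v)
        (flagVariety (actA 𝔫 v) (vecA 𝔫 v)) ∧
      HasProperFlatDegeneration (flagVariety (lieAct 𝔫 M) v)
        (flagVariety (actT b ord v) (vecT b ord v)) ∧
      HasProperFlatDegeneration (flagVariety (actA 𝔫 v) (vecA 𝔫 v))
        (flagVariety (actT b ord v) (vecT b ord v))) := by
  obtain ⟨K, hK⟩ := exists_word_eq_zero 𝔫 M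
  obtain ⟨ω, hω⟩ := exists_weight ord.toMonomialOrder K
  have hess : ∀ p ∈ essential b ord v, p.degree < K := fun p hp =>
    degree_lt_of_essential b ord v hK hp
  have hKM := lieAct_pow_eq_zero hK
  have hKa := actA_pow_eq_zero v hK b
  have hKt := actT_pow_eq_zero b ord v hK
  have hT := orbitSpace_actT b ord v hess
  have hMa := orbitSpace_actA_le b v K
  have hMt : orbitSpace b (actT b ord v) (vecT b ord v) K ≤ Submodule.span ℂ
      {g | g ∈ orbitSpace b (actT b ord v) (vecT b ord v) K ∧
        IsInitial ω (orbitSpace b (lieAct 𝔫 M) v K) g} := by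
    conv_lhs => rw [hT]
    refine Submodule.span_mono ?_
    rintro _ ⟨p, hp, rfl⟩
    exact ⟨hT ▸ Submodule.subset_span ⟨p, hp, rfl⟩,
      isInitial_of_essential b ord v hω hp (hess p hp)⟩
  have hat : orbitSpace b (actT b ord v) (vecT b ord v) K ≤ Submodule.span ℂ
      {g | g ∈ orbitSpace b (actT b ord v) (vecT b ord v) K ∧
        IsInitial ω (orbitSpace b (actA 𝔫 v) (vecA 𝔫 v) K) g} := by
    conv_lhs => rw [hT]
    refine Submodule.span_mono ?_
    rintro _ ⟨p, hp, rfl⟩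
    exact ⟨hT ▸ Submodule.subset_span ⟨p, hp, rfl⟩,
      isInitial_actA_of_essential b ord v hω hp (hess p hp)⟩
  have hdim : ∀ n,
      Module.finrank ℂ (orbitSpace b (lieAct 𝔫 M) v K ^ n : Submodule ℂ (Pol N)) =
        Module.finrank ℂ (orbitSpace b (actT b ord v) (vecT b ord v) K ^ n :
          Submodule ℂ (Pol N)) := fun n => by
    rw [finrank_orbitSpace_pow b ord v hKM, hM.finrank_eq, hT, finrank_span_monomial_pow]
  -- The dimensions for `M^a` lie between those for `M^t` and `M`, which agree.
  have hdim' : ∀ n,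
      Module.finrank ℂ (orbitSpace b (lieAct 𝔫 M) v K ^ n : Submodule ℂ (Pol N)) =
        Module.finrank ℂ (orbitSpace b (actA 𝔫 v) (vecA 𝔫 v) K ^ n : Submodule ℂ (Pol N)) :=
    fun n => le_antisymm
      ((hdim n).le.trans (finrank_pow_le_of_initial ω (orbitSpace_fg b _ _ K)
        (orbitSpace_fg b _ _ K) hat n))
      (finrank_pow_le_of_initial _ (orbitSpace_fg b _ _ K) (orbitSpace_fg b _ _ K) hMa n)
  have h0 : orbitSpace b (lieAct 𝔫 M) v K ≠ ⊥ := fun hbot => by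
    have h1 := finrank_orbitSpace b ord v hKM
    rw [hbot, finrank_bot, hM.cyclic, finrank_top] at h1
    have := Module.finrank_zero_iff.1 h1.symm
    exact hv (Subsingleton.elim _ _)
  have h0' : orbitSpace b (actA 𝔫 v) (vecA 𝔫 v) K ≠ ⊥ := fun hbot => by
    have h1 := hdim' 1
    rw [pow_one, pow_one, hbot, finrank_bot] at h1
    have : FiniteDimensional ℂ (orbitSpace b (lieAct 𝔫 M) v K) :=
      Module.Finite.iff_fg.2 (orbitSpace_fg b _ _ K)
    exact h0 (Submodule.finrank_eq_zero.1 h1)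
  have h1 := hasFlatDegenerations_orbit b _ hKM hKa hMa hdim' h0
  have h2 := hasFlatDegenerations_orbit b ω hKM hKt hMt hdim h0
  have h3 := hasFlatDegenerations_orbit b ω hKa hKt hat
    (fun n => (hdim' n).symm.trans (hdim n)) h0'
  exact ⟨⟨h1.1, h2.1, h3.1⟩, h1.2, h2.2, h3.2⟩
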